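/- **Setting.** Let $1\le k\le n$ and let $\mu:\binom{[n]}{k}\to\mathbb R_{\ge 0}$ be not identically zero; $\mu$ also denotes the probability distribution proportional to it. For $S\subseteq[n]$ with $\Pr_{T\sim\mu}[S\subseteq T]>0$, the conditional distribution $\mu(\cdot\mid S)$ is the distribution on $(k-|S|)$-subsets $F$ of $[n]\setminus S$ with $\mu(F\mid S)\propto\mu(F\cup S)$, and the conditional marginal of $i\notin S$ is $\Pr_\mu[i\mid S]=\Pr_{T\sim\mu}[i\in T\mid S\subseteq T]$. A probability distribution $\pi$ on $m$-subsets is $\frac1\alpha$-*entropically independent*, $\alpha\in(0,1]$, if for all probability distributions $\nu$ on $m$-subsets $$D_{\mathrm{KL}}(\nu D_{m\to1}\,\|\,\pi D_{m\to1})\le\frac1{\alpha m}D_{\mathrm{KL}}(\nu\,\|\,\pi),$$ where $\nu D_{m\to 1}$ is the distribution of a uniformly random element of a random set drawn from $\nu$. **Model.** Algorithms are randomized PRAM programs with exact unit-cost arithmetic on reals and on natural numbers, comparisons, and independent uniform $[0,1]$ random numbers. They receive $n,k,\varepsilon$ as input and access $\mu$ only through a subroutine which, given $S\subseteq[n]$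 (written in the shared memory) and $i\notin S$, returns $\Pr_\mu[i\mid S]$ if $\Pr_{T\sim\mu}[S\subseteq T]>0$ (and an arbitrary value otherwise). A call takes $\tau$ parallel time and occupies $\kappa$ machines. **Theorem.** For all constants $a,d\in\mathbb N$ there are constants $K$ and $D$ such that for all constants $\alpha\in(0,1]$ and $c>0$ there are a program $P$ and a constant $C$ with the following property. Let $n$, $k\ge1$, $\varepsilon\in(0,1)$ and $\mu$ be as above, suppose that all conditional distributions of $\mu$ (including $\mu$ itself) are $\frac1\alpha$-entropically independent, and that conditional marginals are computed in parallel time $\tau\le a(1+\log\frac n\varepsilon)^d$ with $\kappa\le a(\frac n\varepsilon)^d$ machines per call. Then $P$ on input $(n,k,\varepsilon)$ always halts within parallel time $$C\,\sqrt k\,\Bigl(\frac k\varepsilon\Bigr)^{c}\Bigl(1+\log\frac n\varepsilon\Bigr)^{D}=\widetilde O\Bigl(\sqrt k\,\bigl(\tfrac k\varepsilon\bigr)^{c}\Bigr)$$ using at most $C\,(n/\varepsilon)^{K/\min(c,1)}=(n/\varepsilon)^{O(1/c)}$ machines, and the law of its output is within total variation distance $\varepsilon$ of $\mu$. -/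

import Mathlib

open MeasureTheory

namespace ParSampling

section Distributions

variable {ι : Type*} [Fintype ι]

/-- The Kullback-Leibler divergence `∑ q log (q / p)` of two densities on a finite set,
with the value `⊤` when `q` is not absolutely continuous with respect to `p`. -/
noncomputable def klDivergence (q p : ι → ℝ) : EReal :=
  open Classical in
  if ∀ i, p i = 0 → q i = 0 then ((∑ i, q i * Real.log (q i / p i) : ℝ) : EReal) else ⊤

/-- Total variation distance of two densities on a finite set. -/
noncomputable def tvDist (p q : ι → ℝ) : ℝ := (∑ i, |p i - q i|) / 2

end Distributions

section Subsets

variable {n : ℕ}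

/-- A nonnegative, not identically zero weight on the `k`-subsets of an `n`-element set,
extended by zero to all subsets. It need not be normalized. -/
structure IsWeight (n k : ℕ) (μ : Finset (Fin n) → ℝ) : Prop where
  nonneg : ∀ S, 0 ≤ μ S
  supp : ∀ S, S.card ≠ k → μ S = 0
  pos : 0 < ∑ S, μ S

/-- The counting query: total weight of the supersets of `S`. -/
noncomputable def superWeight (μ : Finset (Fin n) → ℝ) (S : Finset (Fin n)) : ℝ :=
  ∑ T ∈ Finset.univ.filter (fun T => S ⊆ T), μ T

/-- The conditional distribution `μ(· ∣ S)`, on the subsets `F` of the complement of `S`: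
it is proportional to `μ (F ∪ S)`. For `S = ∅` this is the normalization of `μ`. -/
noncomputable def condDist (μ : Finset (Fin n) → ℝ) (S F : Finset (Fin n)) : ℝ :=
  if Disjoint F S then μ (F ∪ S) / superWeight μ S else 0

/-- The conditional marginal: the probability that `i ∈ T` given `S ⊆ T`, for `T ∼ μ`. -/
noncomputable def condMarginal (μ : Finset (Fin n) → ℝ) (S : Finset (Fin n)) (i : Fin n) : ℝ :=
  superWeight μ (insert i S) / superWeight μ S

/-- The distribution `ν D_{m → 1}` of a uniformly random element of a random `m`-subset. -/
noncomputable def downToOne (m : ℕ) (ν : Finset (Fin n) → ℝ) (i : Fin n) : ℝ :=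
  ∑ S, ν S * (if i ∈ S then 1 / (m : ℝ) else 0)

/-- `(1/α)`-entropic independence of a probability density `μ` on `m`-subsets. -/
def EntropicallyIndependent (α : ℝ) (m : ℕ) (μ : Finset (Fin n) → ℝ) : Prop :=
  ∀ ν : Finset (Fin n) → ℝ, IsWeight n m ν → ∑ S, ν S = 1 →
    klDivergence (downToOne m ν) (downToOne m μ) ≤
      ((1 / (α * m) : ℝ) : EReal) * klDivergence ν μ

/-- All conditional distributions of `μ` are `(1/α)`-entropically independent. -/
def AllCondEntropicallyIndependent (α : ℝ) (k : ℕ) (μ : Finset (Fin n) → ℝ) : Prop :=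
  ∀ S : Finset (Fin n), S.card < k → 0 < superWeight μ S →
    EntropicallyIndependent α (k - S.card) (condDist μ S)

/-- `O S i` is the conditional marginal of `i` given `S`, whenever `i ∉ S` and the event
`S ⊆ T` has positive probability. The other values of `O` are arbitrary. -/
def IsMarginalOracle (μ : Finset (Fin n) → ℝ) (O : Finset (Fin n) → Fin n → ℝ) : Prop :=
  ∀ S i, i ∉ S → 0 < superWeight μ S → O S i = condMarginal μ S i

end Subsets

/-! ### Randomized parallel random access machines over the reals

The shared memory consists of arrays of natural numbers (used for counting, addressing and
control) and arrays of real numbers. All processors run the same program in lockstep.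
In one parallel statement of width `w`, the processors `0, …, w - 1` each read the shared
memory (concurrent reads are allowed), evaluate expressions, and write one memory cell each
(exclusive writes). There is no conversion from reals to naturals except by comparison. -/

/-- Natural-number expressions evaluated by one processor. -/
inductive NExp where
  | const (c : ℕ)
  | pid
  | load (a : ℕ) (i : NExp)
  | add (x y : NExp)
  | sub (x y : NExp)
  | mul (x y : NExp)
  | div (x y : NExp)
  | mod (x y : NExp)
  | ite (c x y : NExp)

/-- Real expressions evaluated by one processor; `rand i` reads the `i`-th cell of the
random tape. -/
inductive RExp where
  | ofNat (x : NExp)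
  | load (a : ℕ) (i : NExp)
  | rand (i : NExp)
  | add (x y : RExp)
  | sub (x y : RExp)
  | mul (x y : RExp)
  | div (x y : RExp)
  | ite (c : NExp) (x y : RExp)

/-- Programs. In the parallel statements `a` is the target array, `width` the number of
processors, `idx` the cell that a processor writes.
* `setN`, `setR` store the value of an expression;
* `setLt` stores, in an array of naturals, `1` if `x < y` and `0` otherwise;
* `query` stores the oracle's answer for the element `elt` and the set whose indicator vector
  is stored in the array `b` of naturals from the cell `base` on. -/
inductive Prog where
  | setN (a : ℕ) (width idx val : NExp)
  | setR (a : ℕ) (width idx : NExp) (val : RExp)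
  | setLt (a : ℕ) (width idx : NExp) (x y : RExp)
  | query (a : ℕ) (width idx : NExp) (b : ℕ) (base elt : NExp)
  | seq (P Q : Prog)
  | cond (c : NExp) (P Q : Prog)
  | loop (c : NExp) (P : Prog)

/-- The shared memory: `nat a i` and `real a i` are the cells `i` of the `a`-th arrays. -/
structure Mem where
  nat : ℕ → ℕ → ℕ
  real : ℕ → ℕ → ℝ

/-- The random tape: a sequence of reals in `[0,1]`. -/
abbrev Tape := ℕ → unitInterval

/-- The cells of the random tape are independent and uniform on `[0,1]`. -/
noncomputable def tapeLaw : Measure Tape :=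
  Measure.infinitePi (fun _ : ℕ => (volume : Measure unitInterval))

namespace NExp

/-- Number of operations in an expression. -/
def size : NExp → ℕ
  | const _ => 1
  | pid => 1
  | load _ i => i.size + 1
  | add x y => x.size + y.size + 1
  | sub x y => x.size + y.size + 1
  | mul x y => x.size + y.size + 1
  | div x y => x.size + y.size + 1
  | mod x y => x.size + y.size + 1
  | ite c x y => c.size + x.size + y.size + 1

/-- The value computed by the processor with index `p`. Subtraction is truncated and division
is integer division. -/
def eval (s : Mem) (p : ℕ) : NExp → ℕ
  | const c => c
  | pid => p
  | load a i => s.nat a (i.eval s p)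
  | add x y => x.eval s p + y.eval s p
  | sub x y => x.eval s p - y.eval s p
  | mul x y => x.eval s p * y.eval s p
  | div x y => x.eval s p / y.eval s p
  | mod x y => x.eval s p % y.eval s p
  | ite c x y => if c.eval s p ≠ 0 then x.eval s p else y.eval s p

end NExp

namespace RExp

/-- Number of operations in an expression. -/
def size : RExp → ℕ
  | ofNat x => x.size + 1
  | load _ i => i.size + 1
  | rand i => i.size + 1
  | add x y => x.size + y.size + 1
  | sub x y => x.size + y.size + 1
  | mul x y => x.size + y.size + 1
  | div x y => x.size + y.size + 1
  | ite c x y => c.size + x.size + y.size + 1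

/-- The value computed by the processor with index `p`. -/
noncomputable def eval (ω : Tape) (s : Mem) (p : ℕ) : RExp → ℝ
  | ofNat x => (x.eval s p : ℝ)
  | load a i => s.real a (i.eval s p)
  | rand i => (ω (i.eval s p) : ℝ)
  | add x y => x.eval ω s p + y.eval ω s p
  | sub x y => x.eval ω s p - y.eval ω s p
  | mul x y => x.eval ω s p * y.eval ω s p
  | div x y => x.eval ω s p / y.eval ω s p
  | ite c x y => if c.eval s p ≠ 0 then x.eval ω s p else y.eval ω s p

end RExp

open Classical in
/-- The array `f` after the processors `p < w` have written `val p` to the cell `idx p`. -/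
noncomputable def scatter {β : Type} (f : ℕ → β) (w : ℕ) (idx : ℕ → ℕ) (val : ℕ → β) : ℕ → β :=
  fun i => if h : ∃ p, p < w ∧ idx p = i then val (Nat.find h) else f i

/-- Store into the `a`-th array of naturals. -/
noncomputable def Mem.putNat (s : Mem) (a w : ℕ) (idx val : ℕ → ℕ) : Mem :=
  { s with nat := Function.update s.nat a (scatter (s.nat a) w idx val) }

/-- Store into the `a`-th array of reals. -/
noncomputable def Mem.putReal (s : Mem) (a w : ℕ) (idx : ℕ → ℕ) (val : ℕ → ℝ) : Mem :=
  { s with real := Function.update s.real a (scatter (s.real a) w idx val) }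

/-- The subset of `{0, …, n - 1}` whose indicator vector is stored in the `b`-th array of
naturals from the cell `base` on. -/
def Mem.readSet (s : Mem) (n b base : ℕ) : Finset (Fin n) :=
  Finset.univ.filter (fun j : Fin n => s.nat b (base + j) ≠ 0)

/-- The oracle's answer to a query; it is `0` if the queried index is out of range. -/
def answer {n : ℕ} (O : Finset (Fin n) → Fin n → ℝ) (S : Finset (Fin n)) (e : ℕ) : ℝ :=
  if h : e < n then O S ⟨e, h⟩ else 0

/-- No two of the processors `p < w` write to the same cell. -/
def Exclusive (w : ℕ) (idx : ℕ → ℕ) : Prop :=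
  ∀ p p' : ℕ, p < w → p' < w → idx p = idx p' → p = p'

/-- `Exec O τ κ ω P s s' t m`: with random tape `ω` and oracle `O`, the program `P`, started in
the memory `s`, halts in the memory `s'` after `t` parallel time steps, using `m` machines.
Each operation takes one step. An oracle query takes `τ` additional steps and occupies
`κ` machines for each querying processor. The program fails to execute
if two processors write to the same cell in one statement. -/
inductive Exec {n : ℕ} (O : Finset (Fin n) → Fin n → ℝ) (τ κ : ℕ) (ω : Tape) :
    Prog → Mem → Mem → ℕ → ℕ → Prop
  | setN {s : Mem} {a : ℕ} {width idx val : NExp}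
      (hex : Exclusive (width.eval s 0) (fun p => idx.eval s p)) :
      Exec O τ κ ω (.setN a width idx val) s
        (s.putNat a (width.eval s 0) (fun p => idx.eval s p) (fun p => val.eval s p))
        (width.size + idx.size + val.size + 1) (max 1 (width.eval s 0))
  | setR {s : Mem} {a : ℕ} {width idx : NExp} {val : RExp}
      (hex : Exclusive (width.eval s 0) (fun p => idx.eval s p)) :
      Exec O τ κ ω (.setR a width idx val) s
        (s.putReal a (width.eval s 0) (fun p => idx.eval s p) (fun p => val.eval ω s p))
        (width.size + idx.size + val.size + 1) (max 1 (width.eval s 0))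
  | setLt {s : Mem} {a : ℕ} {width idx : NExp} {x y : RExp}
      (hex : Exclusive (width.eval s 0) (fun p => idx.eval s p)) :
      Exec O τ κ ω (.setLt a width idx x y) s
        (s.putNat a (width.eval s 0) (fun p => idx.eval s p)
          (fun p => if x.eval ω s p < y.eval ω s p then 1 else 0))
        (width.size + idx.size + x.size + y.size + 1) (max 1 (width.eval s 0))
  | query {s : Mem} {a : ℕ} {width idx : NExp} {b : ℕ} {base elt : NExp}
      (hex : Exclusive (width.eval s 0) (fun p => idx.eval s p)) :
      Exec O τ κ ω (.query a width idx b base elt) s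
        (s.putReal a (width.eval s 0) (fun p => idx.eval s p)
          (fun p => answer O (s.readSet n b (base.eval s p)) (elt.eval s p)))
        (width.size + idx.size + base.size + elt.size + 1 + τ)
        (max 1 (width.eval s 0 * max 1 κ))
  | seq {P Q : Prog} {s s' s'' : Mem} {t t' m m' : ℕ}
      (hP : Exec O τ κ ω P s s' t m) (hQ : Exec O τ κ ω Q s' s'' t' m') :
      Exec O τ κ ω (.seq P Q) s s'' (t + t') (max m m')
  | cond_true {c : NExp} {P Q : Prog} {s s' : Mem} {t m : ℕ}
      (hc : c.eval s 0 ≠ 0) (hP : Exec O τ κ ω P s s' t m) :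
      Exec O τ κ ω (.cond c P Q) s s' (c.size + t) m
  | cond_false {c : NExp} {P Q : Prog} {s s' : Mem} {t m : ℕ}
      (hc : c.eval s 0 = 0) (hQ : Exec O τ κ ω Q s s' t m) :
      Exec O τ κ ω (.cond c P Q) s s' (c.size + t) m
  | loop_done {c : NExp} {P : Prog} {s : Mem} (hc : c.eval s 0 = 0) :
      Exec O τ κ ω (.loop c P) s s c.size 1
  | loop_step {c : NExp} {P : Prog} {s s' s'' : Mem} {t t' m m' : ℕ}
      (hc : c.eval s 0 ≠ 0) (hP : Exec O τ κ ω P s s' t m)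
      (hL : Exec O τ κ ω (.loop c P) s' s'' t' m') :
      Exec O τ κ ω (.loop c P) s s'' (c.size + t + t') (max m m')

/-- The initial memory holds the input `n`, `k`, `ε` in the first cells of the arrays number
`0`, and is zero elsewhere. -/
noncomputable def inputMem (n k : ℕ) (ε : ℝ) : Mem where
  nat a i := if a = 0 ∧ i = 0 then n else if a = 0 ∧ i = 1 then k else 0
  real a i := if a = 0 ∧ i = 0 then ε else 0

/-- On the input `n`, `k`, `ε`, with oracle `O` and random tape `ω`, the program halts in
parallel time at most `T` on at most `M` machines, and its output, the set whose indicator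
vector is stored in the array number `1` of naturals, is `S`. -/
def Outputs {n : ℕ} (O : Finset (Fin n) → Fin n → ℝ) (τ κ : ℕ) (P : Prog) (k : ℕ) (ε : ℝ)
    (T M : ℝ) (ω : Tape) (S : Finset (Fin n)) : Prop :=
  ∃ (s : Mem) (t m : ℕ), Exec O τ κ ω P (inputMem n k ε) s t m ∧
    (t : ℝ) ≤ T ∧ (m : ℝ) ≤ M ∧ s.readSet n 1 0 = S

/-- On the input `n`, `k`, `ε` and with oracle `O`, the program always halts in parallel time at
most `T` on at most `M` machines, and the law of its output is within total variation
distance `δ` of the density `μ`. -/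
def SamplesWithin {n : ℕ} (O : Finset (Fin n) → Fin n → ℝ) (τ κ : ℕ) (P : Prog) (k : ℕ) (ε : ℝ)
    (T M : ℝ) (μ : Finset (Fin n) → ℝ) (δ : ℝ) : Prop :=
  ∃ out : Tape → Finset (Fin n),
    (∀ ω, Outputs O τ κ P k ε T M ω (out ω)) ∧
    (∀ S, MeasurableSet (out ⁻¹' {S})) ∧
    tvDist (fun S => tapeLaw.real (out ⁻¹' {S})) μ ≤ δ

end ParSampling

open ParSampling

namespace ParSampling

section Chain

variable {n k : ℕ} {μ : Finset (Fin n) → ℝ}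

/-- The density of the next element when the elements of a random `k`-set `T ∼ μ` are revealed
in uniformly random order and those of `S` have been seen. -/
noncomputable def stepProb (k : ℕ) (μ : Finset (Fin n) → ℝ) (S : Finset (Fin n)) (i : Fin n) : ℝ :=
  if i ∈ S then 0 else condMarginal μ S i / ((k : ℝ) - S.card)

/-- The conditional expectation of `f T` given `S ⊆ T`, for `T ∼ μ`. -/
noncomputable def condMean (μ : Finset (Fin n) → ℝ) (S : Finset (Fin n))
    (f : Finset (Fin n) → ℝ) : ℝ :=
  (∑ T ∈ Finset.univ.filter (fun T => S ⊆ T), μ T * f T) / superWeight μ S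

theorem IsWeight.superWeight_nonneg (hμ : IsWeight n k μ) (S : Finset (Fin n)) :
    0 ≤ superWeight μ S :=
  Finset.sum_nonneg fun T _ => hμ.nonneg T

theorem IsWeight.superWeight_anti (hμ : IsWeight n k μ) {S S' : Finset (Fin n)} (h : S ⊆ S') :
    superWeight μ S' ≤ superWeight μ S := by
  refine Finset.sum_le_sum_of_subset_of_nonneg ?_ fun T _ _ => hμ.nonneg T
  intro T
  simp only [Finset.mem_filter, Finset.mem_univ, true_and]
  exact fun h' => h.trans h'

theorem IsWeight.superWeight_empty_pos (hμ : IsWeight n k μ) : 0 < superWeight μ ∅ := by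
  simpa [superWeight] using hμ.pos

theorem IsWeight.card_le (hμ : IsWeight n k μ) {S : Finset (Fin n)} (h : 0 < superWeight μ S) :
    S.card ≤ k := by
  obtain ⟨T, hT, hT'⟩ := Finset.exists_ne_zero_of_sum_ne_zero h.ne'
  simp only [Finset.mem_filter, Finset.mem_univ, true_and] at hT
  by_contra hk
  refine hT' (hμ.supp T ?_)
  have := Finset.card_le_card hT
  omega

theorem IsWeight.weight_eq_zero (hμ : IsWeight n k μ) {S T : Finset (Fin n)}
    (h : superWeight μ S = 0) (hT : S ⊆ T) : μ T = 0 :=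
  (Finset.sum_eq_zero_iff_of_nonneg fun T _ => hμ.nonneg T).1 h T (by simpa using hT)

theorem IsWeight.sum_insert (hμ : IsWeight n k μ) (S : Finset (Fin n))
    (f : Finset (Fin n) → ℝ) :
    ∑ i, (if i ∈ S then 0 else
        ∑ T ∈ Finset.univ.filter (fun T => insert i S ⊆ T), μ T * f T) =
      ((k : ℝ) - S.card) * ∑ T ∈ Finset.univ.filter (fun T => S ⊆ T), μ T * f T := by
  have h1 : ∀ i : Fin n, (if i ∈ S then 0 else
        ∑ T ∈ Finset.univ.filter (fun T => insert i S ⊆ T), μ T * f T) =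
      ∑ T ∈ Finset.univ.filter (fun T => S ⊆ T), if i ∈ T \ S then μ T * f T else 0 := by
    intro i
    by_cases hi : i ∈ S
    · simp [hi]
    · simp only [hi, if_false, Finset.sum_filter, Finset.mem_sdiff, not_false_eq_true, and_true]
      refine Finset.sum_congr rfl fun T _ => ?_
      by_cases h1 : S ⊆ T <;> by_cases h2 : i ∈ T <;> simp [Finset.insert_subset_iff, h1, h2]
  simp_rw [h1]
  rw [Finset.sum_comm, Finset.mul_sum]
  refine Finset.sum_congr rfl fun T hT => ?_
  have hT : S ⊆ T := by simpa using hT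
  rw [← Finset.sum_filter, Finset.sum_const, nsmul_eq_mul]
  by_cases hk : T.card = k
  · have : (Finset.univ.filter fun i => i ∈ T \ S) = T \ S := by ext; simp
    rw [this, Finset.card_sdiff_of_subset hT, Nat.cast_sub (Finset.card_le_card hT), hk]
  · simp [hμ.supp T hk]

theorem IsWeight.stepProb_mul_condMean (hμ : IsWeight n k μ) (S : Finset (Fin n)) (i : Fin n)
    (f : Finset (Fin n) → ℝ) :
    stepProb k μ S i * condMean μ (insert i S) f =
      (if i ∈ S then 0 else ∑ T ∈ Finset.univ.filter (fun T => insert i S ⊆ T), μ T * f T) /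
        (((k : ℝ) - S.card) * superWeight μ S) := by
  unfold stepProb condMean condMarginal
  by_cases hi : i ∈ S
  · simp [hi]
  simp only [hi, if_false]
  by_cases h0 : superWeight μ (insert i S) = 0
  · have : ∑ T ∈ Finset.univ.filter (fun T => insert i S ⊆ T), μ T * f T = 0 :=
      Finset.sum_eq_zero fun T hT => by
        rw [hμ.weight_eq_zero h0 (by simpa using hT), zero_mul]
    simp [h0, this]
  · rw [div_div, div_mul_div_comm, mul_comm (superWeight μ (insert i S)),
      mul_div_mul_right _ _ h0, mul_comm (superWeight μ S)]

theorem IsWeight.sum_stepProb_mul_condMean (hμ : IsWeight n k μ) {S : Finset (Fin n)}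
    (hS : S.card < k) (f : Finset (Fin n) → ℝ) :
    ∑ i, stepProb k μ S i * condMean μ (insert i S) f = condMean μ S f := by
  have hk : (k : ℝ) - S.card ≠ 0 := by
    have : (S.card : ℝ) < k := by exact_mod_cast hS
    linarith
  simp_rw [hμ.stepProb_mul_condMean, ← Finset.sum_div]
  rw [hμ.sum_insert, condMean, mul_div_mul_left _ _ hk]

theorem condMean_one {S : Finset (Fin n)} (h : superWeight μ S ≠ 0) :
    condMean μ S (fun _ => 1) = 1 := by
  simp only [condMean, mul_one]
  exact div_self h

theorem condMean_mono (hμ : IsWeight n k μ) {S : Finset (Fin n)} {f g : Finset (Fin n) → ℝ}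
    (h : ∀ T, S ⊆ T → f T ≤ g T) : condMean μ S f ≤ condMean μ S g := by
  refine div_le_div_of_nonneg_right (Finset.sum_le_sum fun T hT => ?_) (hμ.superWeight_nonneg S)
  exact mul_le_mul_of_nonneg_left (h T (by simpa using hT)) (hμ.nonneg T)

theorem IsWeight.stepProb_nonneg (hμ : IsWeight n k μ) {S : Finset (Fin n)} (i : Fin n) :
    0 ≤ stepProb k μ S i := by
  unfold stepProb
  split_ifs
  · exact le_rfl
  · rcases (hμ.superWeight_nonneg S).eq_or_lt' with h | h
    · simp [condMarginal, h]
    · have : (S.card : ℝ) ≤ k := by exact_mod_cast hμ.card_le h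
      exact div_nonneg (div_nonneg (hμ.superWeight_nonneg _) h.le) (by linarith)

theorem IsWeight.sum_stepProb (hμ : IsWeight n k μ) {S : Finset (Fin n)}
    (hS : S.card < k) (h : 0 < superWeight μ S) : ∑ i, stepProb k μ S i = 1 := by
  rw [← condMean_one h.ne', ← hμ.sum_stepProb_mul_condMean hS]
  refine Finset.sum_congr rfl fun i _ => ?_
  by_cases h0 : superWeight μ (insert i S) = 0
  · simp [stepProb, condMarginal, h0]
  · rw [condMean_one h0, mul_one]

theorem IsWeight.sum_stepProb_le (hμ : IsWeight n k μ) (S : Finset (Fin n)) :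
    ∑ i, stepProb k μ S i ≤ 1 := by
  rcases (hμ.superWeight_nonneg S).eq_or_lt' with h | h
  · simp [stepProb, condMarginal, h]
  rcases (hμ.card_le h).eq_or_lt with hk | hk
  · simp [stepProb, hk]
  · exact (hμ.sum_stepProb hk h).le

/-- The sequences of length `j`, newest element first. -/
def tuples (n : ℕ) : ℕ → Finset (List (Fin n))
  | 0 => {[]}
  | j + 1 => (Finset.univ ×ˢ tuples n j).image fun x => x.1 :: x.2

theorem mem_tuples {j : ℕ} {l : List (Fin n)} : l ∈ tuples n j ↔ l.length = j := by
  induction j generalizing l with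
  | zero => simp [tuples]
  | succ j ih => cases l <;> simp [tuples, ih]

theorem sum_tuples_succ (j : ℕ) (f : List (Fin n) → ℝ) :
    ∑ l ∈ tuples n (j + 1), f l = ∑ l ∈ tuples n j, ∑ i, f (i :: l) := by
  rw [tuples, Finset.sum_image, Finset.sum_product_right]
  rintro ⟨a, b⟩ _ ⟨c, d⟩ _ h
  simpa using h

theorem sum_tuples_zero (f : List (Fin n) → ℝ) : ∑ l ∈ tuples n 0, f l = f [] := by
  simp [tuples]

/-- The density of the first elements of a random set `T ∼ μ(· ∣ S)` in uniformly random
order. -/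
noncomputable def seqProb (k : ℕ) (μ : Finset (Fin n) → ℝ) (S : Finset (Fin n)) :
    List (Fin n) → ℝ
  | [] => 1
  | i :: l => seqProb k μ S l * stepProb k μ (S ∪ l.toFinset) i

/-- The density of independent elements drawn from the one-element marginal of `μ(· ∣ S)`. -/
noncomputable def prodProb (k : ℕ) (μ : Finset (Fin n) → ℝ) (S : Finset (Fin n)) :
    List (Fin n) → ℝ
  | [] => 1
  | i :: l => prodProb k μ S l * stepProb k μ S i

theorem IsWeight.seqProb_nonneg (hμ : IsWeight n k μ) {S : Finset (Fin n)} (l : List (Fin n)) :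
    0 ≤ seqProb k μ S l := by
  induction l with
  | nil => simp [seqProb]
  | cons i l ih => exact mul_nonneg ih (hμ.stepProb_nonneg i)

theorem IsWeight.prodProb_nonneg (hμ : IsWeight n k μ) {S : Finset (Fin n)} (l : List (Fin n)) :
    0 ≤ prodProb k μ S l := by
  induction l with
  | nil => simp [prodProb]
  | cons i l ih => exact mul_nonneg ih (hμ.stepProb_nonneg i)

theorem union_toFinset_cons (S : Finset (Fin n)) (i : Fin n) (l : List (Fin n)) :
    S ∪ (i :: l).toFinset = insert i (S ∪ l.toFinset) := by
  simp [Finset.union_insert]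

theorem IsWeight.seqProb_ne_zero (hμ : IsWeight n k μ) {S : Finset (Fin n)}
    (hS : 0 < superWeight μ S) {l : List (Fin n)} (h : seqProb k μ S l ≠ 0) :
    0 < superWeight μ (S ∪ l.toFinset) ∧ (S ∪ l.toFinset).card = S.card + l.length := by
  induction l with
  | nil => simpa using hS
  | cons i l ih =>
    have h1 := left_ne_zero_of_mul h
    have h2 := right_ne_zero_of_mul h
    obtain ⟨h3, h4⟩ := ih h1
    have hi : i ∉ S ∪ l.toFinset := by
      intro hi
      exact h2 (by simp [stepProb, hi])
    rw [union_toFinset_cons, Finset.card_insert_of_notMem hi, h4]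
    refine ⟨(hμ.superWeight_nonneg _).lt_of_ne' fun h0 => h2 ?_, by simp; ring⟩
    simp [stepProb, condMarginal, h0]

theorem IsWeight.sum_seqProb_mul_condMean (hμ : IsWeight n k μ) {S : Finset (Fin n)}
    (hS : 0 < superWeight μ S) (f : Finset (Fin n) → ℝ) (j : ℕ) (hj : S.card + j ≤ k) :
    ∑ l ∈ tuples n j, seqProb k μ S l * condMean μ (S ∪ l.toFinset) f = condMean μ S f := by
  induction j with
  | zero => simp [sum_tuples_zero, seqProb]
  | succ j ih =>
    rw [sum_tuples_succ, ← ih (by omega)]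
    refine Finset.sum_congr rfl fun l hl => ?_
    by_cases h0 : seqProb k μ S l = 0
    · simp [seqProb, h0]
    have h1 := (hμ.seqProb_ne_zero hS h0).2
    rw [mem_tuples] at hl
    simp only [seqProb, union_toFinset_cons, mul_assoc]
    rw [← Finset.mul_sum, hμ.sum_stepProb_mul_condMean (by omega)]

theorem IsWeight.sum_seqProb (hμ : IsWeight n k μ) {S : Finset (Fin n)}
    (hS : 0 < superWeight μ S) (j : ℕ) (hj : S.card + j ≤ k) :
    ∑ l ∈ tuples n j, seqProb k μ S l = 1 := by
  rw [← condMean_one hS.ne', ← hμ.sum_seqProb_mul_condMean hS _ j hj]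
  refine Finset.sum_congr rfl fun l _ => ?_
  by_cases h0 : seqProb k μ S l = 0
  · simp [h0]
  · rw [condMean_one (hμ.seqProb_ne_zero hS h0).1.ne', mul_one]

end Chain

section Entropy

variable {n k : ℕ} {μ : Finset (Fin n) → ℝ}

theorem sum_disjoint_union (S : Finset (Fin n)) (g : Finset (Fin n) → ℝ) :
    ∑ F, (if Disjoint F S then g (F ∪ S) else 0) =
      ∑ T ∈ Finset.univ.filter (fun T => S ⊆ T), g T := by
  rw [← Finset.sum_filter]
  refine Finset.sum_nbij' (fun F => F ∪ S) (fun T => T \ S) ?_ ?_ ?_ ?_ ?_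
  · intro F _
    simp
  · intro T _
    simpa using Finset.sdiff_disjoint
  · intro F hF
    simp only [Finset.mem_filter, Finset.mem_univ, true_and] at hF
    rw [Finset.union_sdiff_right, Finset.sdiff_eq_self_of_disjoint hF]
  · intro T hT
    simp only [Finset.mem_filter, Finset.mem_univ, true_and] at hT
    exact Finset.sdiff_union_of_subset hT
  · intro F _
    rfl

/-- The law of `T \ S` for `T ∼ μ(· ∣ S')`, where `S ⊆ S'`. -/
noncomputable def condDistOn (μ : Finset (Fin n) → ℝ) (S S' F : Finset (Fin n)) : ℝ :=
  if Disjoint F S then (if S' ⊆ F ∪ S then μ (F ∪ S) / superWeight μ S' else 0) else 0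

theorem condDistOn_self (μ : Finset (Fin n) → ℝ) (S : Finset (Fin n)) :
    condDistOn μ S S = condDist μ S := by
  ext F
  simp [condDistOn, condDist]

theorem sum_condDistOn_mul {S S' : Finset (Fin n)} (h : S ⊆ S') (g : Finset (Fin n) → ℝ) :
    ∑ F, condDistOn μ S S' F * g (F ∪ S) = condMean μ S' g := by
  have : ∀ F, condDistOn μ S S' F * g (F ∪ S) = if Disjoint F S then
      (fun T => if S' ⊆ T then μ T / superWeight μ S' * g T else 0) (F ∪ S) else 0 := by
    intro F
    unfold condDistOn
    split_ifs <;> simp_all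
  refine (Finset.sum_congr rfl fun F _ => this F).trans ((sum_disjoint_union S
    (fun T => if S' ⊆ T then μ T / superWeight μ S' * g T else 0)).trans ?_)
  rw [condMean, Finset.sum_div, Finset.sum_filter, Finset.sum_filter]
  refine Finset.sum_congr rfl fun T _ => ?_
  by_cases h' : S' ⊆ T
  · simp [h', h.trans h', div_mul_eq_mul_div]
  · simp [h']

theorem condMean_mem (μ : Finset (Fin n) → ℝ) (S : Finset (Fin n)) (i : Fin n) :
    condMean μ S (fun T => if i ∈ T then 1 else 0) = condMarginal μ S i := by
  unfold condMean condMarginal superWeight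
  congr 1
  simp only [mul_ite, mul_one, mul_zero, ← Finset.sum_filter, Finset.filter_filter]
  refine Finset.sum_congr ?_ fun _ _ => rfl
  ext T
  simp [Finset.insert_subset_iff, and_comm]

theorem isWeight_condDistOn (hμ : IsWeight n k μ) {S S' : Finset (Fin n)} (h : S ⊆ S')
    (hS' : 0 < superWeight μ S') : IsWeight n (k - S.card) (condDistOn μ S S') ∧
      ∑ F, condDistOn μ S S' F = 1 := by
  have h1 : ∑ F, condDistOn μ S S' F = 1 := by
    simpa [condMean_one hS'.ne'] using sum_condDistOn_mul (μ := μ) h (fun _ => 1)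
  refine ⟨⟨fun F => ?_, fun F hF => ?_, by rw [h1]; exact one_pos⟩, h1⟩
  · unfold condDistOn
    split_ifs
    · exact div_nonneg (hμ.nonneg _) hS'.le
    · exact le_rfl
    · exact le_rfl
  · unfold condDistOn
    split_ifs with hd
    · rw [hμ.supp, zero_div]
      rw [Finset.card_union_of_disjoint hd]
      omega
    · rfl
    · rfl

theorem downToOne_condDistOn {S S' : Finset (Fin n)} (h : S ⊆ S') (m : ℕ) (i : Fin n) :
    downToOne m (condDistOn μ S S') i = if i ∈ S then 0 else condMarginal μ S' i / m := by
  unfold downToOne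
  split_ifs with hi
  · refine Finset.sum_eq_zero fun F _ => ?_
    unfold condDistOn
    by_cases hd : Disjoint F S
    · simp [Finset.disjoint_right.1 hd hi]
    · simp [hd]
  · have : ∀ F, condDistOn μ S S' F * (if i ∈ F then 1 / (m : ℝ) else 0) =
        condDistOn μ S S' F * (fun T => if i ∈ T then (1 : ℝ) else 0) (F ∪ S) / m := by
      intro F
      by_cases hF : i ∈ F <;> simp [hF, hi, div_eq_mul_inv]
    refine (Finset.sum_congr rfl fun F _ => this F).trans ?_
    rw [← Finset.sum_div, sum_condDistOn_mul h (fun T => if i ∈ T then (1 : ℝ) else 0),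
      condMean_mem]

theorem klDivergence_condDistOn (hμ : IsWeight n k μ) {S S' : Finset (Fin n)} (h : S ⊆ S')
    (hS' : 0 < superWeight μ S') :
    klDivergence (condDistOn μ S S') (condDist μ S) =
      ((Real.log (superWeight μ S / superWeight μ S') : ℝ) : EReal) := by
  have hS : 0 < superWeight μ S := hS'.trans_le (hμ.superWeight_anti h)
  have hac : ∀ F, condDist μ S F = 0 → condDistOn μ S S' F = 0 := by
    intro F
    unfold condDist condDistOn
    by_cases hd : Disjoint F S
    · simp only [hd, if_true]
      intro h0
      rw [div_eq_zero_iff, or_iff_left hS.ne'] at h0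
      simp [h0]
    · simp [hd]
  rw [klDivergence, if_pos hac]
  congr 1
  rw [← one_mul (Real.log _), ← (isWeight_condDistOn hμ h hS').2, Finset.sum_mul]
  refine Finset.sum_congr rfl fun F _ => ?_
  by_cases h0 : condDistOn μ S S' F = 0
  · simp [h0]
  congr 2
  unfold condDistOn condDist at *
  split_ifs at * <;> try contradiction
  have h2 : μ (F ∪ S) ≠ 0 := fun h2 => h0 (by simp [h2])
  field_simp

theorem kl_le_of_entropicallyIndependent (hμ : IsWeight n k μ) {α : ℝ} {S S' : Finset (Fin n)}
    (h : S ⊆ S') (hS' : 0 < superWeight μ S')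
    (hE : EntropicallyIndependent α (k - S.card) (condDist μ S)) :
    ∑ i, (if i ∈ S then 0 else condMarginal μ S' i / ((k - S.card : ℕ) : ℝ) *
        Real.log ((condMarginal μ S' i / ((k - S.card : ℕ) : ℝ)) /
          (condMarginal μ S i / ((k - S.card : ℕ) : ℝ)))) ≤
      1 / (α * ((k - S.card : ℕ) : ℝ)) * Real.log (superWeight μ S / superWeight μ S') := by
  have h1 := hE (condDistOn μ S S') (isWeight_condDistOn hμ h hS').1 (isWeight_condDistOn hμ h hS').2
  rw [klDivergence_condDistOn hμ h hS', ← EReal.coe_mul] at h1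
  unfold klDivergence at h1
  split_ifs at h1 with hac
  · rw [EReal.coe_le_coe_iff] at h1
    refine le_of_eq_of_le (Finset.sum_congr rfl fun i _ => ?_) h1
    rw [downToOne_condDistOn h, ← condDistOn_self, downToOne_condDistOn subset_rfl]
    split_ifs <;> simp
  · rw [top_le_iff] at h1
    exact absurd h1 (EReal.coe_ne_top _)

/-- The relative entropy of the next element with respect to the initial marginals. -/
theorem sum_stepProb_mul_log_le (hμ : IsWeight n k μ) {α : ℝ} (hα : 0 < α)
    {S S' : Finset (Fin n)} (h : S ⊆ S') (hS' : 0 < superWeight μ S') {m j : ℕ}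
    (hm : S.card + m = k) (hj : S'.card = S.card + j) (hjm : 2 * j ≤ m) (hm0 : 0 < m)
    (hE : EntropicallyIndependent α m (condDist μ S)) :
    ∑ i, stepProb k μ S' i * Real.log (stepProb k μ S' i / stepProb k μ S i) ≤
      2 / (α * m) * Real.log (superWeight μ S / superWeight μ S') + 2 * j / m := by
  have hmk : m = k - S.card := by omega
  have hS : 0 < superWeight μ S := hS'.trans_le (hμ.superWeight_anti h)
  have hmR : (0 : ℝ) < m := by exact_mod_cast hm0
  have hjR : 2 * (j : ℝ) ≤ m := by exact_mod_cast hjm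
  have hmj : (0 : ℝ) < m - j := by linarith [(Nat.cast_nonneg j : (0 : ℝ) ≤ j)]
  have hk1 : (k : ℝ) - S.card = m := by rw [← hm]; push_cast; ring
  have hk2 : (k : ℝ) - S'.card = m - j := by rw [← hm, hj]; push_cast; ring
  set c := (m : ℝ) / (m - j) with hc
  have hc1 : 1 ≤ c := by rw [hc, le_div_iff₀ hmj]; linarith [(Nat.cast_nonneg j : (0 : ℝ) ≤ j)]
  have hc2 : c ≤ 2 := by rw [hc, div_le_iff₀ hmj]; linarith
  have hlogc : Real.log c ≤ 2 * j / m := by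
    refine (Real.log_le_sub_one_of_pos (by linarith)).trans ?_
    rw [hc, div_sub_one hmj.ne', div_le_div_iff₀ hmj hmR]
    nlinarith [(Nat.cast_nonneg j : (0 : ℝ) ≤ j)]
  have hKL := kl_le_of_entropicallyIndependent hμ h hS' (hmk ▸ hE)
  rw [← hmk] at hKL
  have hlog0 : 0 ≤ Real.log (superWeight μ S / superWeight μ S') :=
    Real.log_nonneg (by rw [le_div_iff₀ hS', one_mul]; exact hμ.superWeight_anti h)
  have key : ∀ i, stepProb k μ S' i * Real.log (stepProb k μ S' i / stepProb k μ S i) ≤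
      c * (if i ∈ S then 0 else condMarginal μ S' i / (m : ℝ) *
        Real.log ((condMarginal μ S' i / (m : ℝ)) / (condMarginal μ S i / (m : ℝ)))) +
      stepProb k μ S' i * Real.log c := by
    intro i
    unfold stepProb
    rw [hk1, hk2]
    have hM : ∀ S, 0 ≤ condMarginal μ S i := fun S =>
      div_nonneg (hμ.superWeight_nonneg _) (hμ.superWeight_nonneg _)
    by_cases hi' : i ∈ S'
    · simp only [hi', if_true, zero_mul, add_zero]
      refine mul_nonneg (by linarith) ?_
      split_ifs with hi
      · exact le_rfl
      refine mul_nonneg (div_nonneg (hM _) hmR.le) ?_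
      rw [div_div_div_cancel_right₀ hmR.ne']
      have h1 : condMarginal μ S' i = 1 := by
        unfold condMarginal
        rw [Finset.insert_eq_of_mem hi', div_self hS'.ne']
      have h2 : condMarginal μ S i ≤ 1 := by
        unfold condMarginal
        rw [div_le_one hS]
        exact hμ.superWeight_anti (Finset.subset_insert _ _)
      rw [h1, one_div, Real.log_inv]
      have := Real.log_nonpos (hM S) h2
      linarith
    · have hi : i ∉ S := fun hi => hi' (h hi)
      simp only [hi', hi, if_false]
      by_cases h0 : condMarginal μ S' i = 0
      · simp [h0]
      have h0' : condMarginal μ S i ≠ 0 := by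
        intro h1
        unfold condMarginal at h1 h0
        rw [div_eq_zero_iff, or_iff_left hS.ne'] at h1
        refine h0 ?_
        have : superWeight μ (insert i S') = 0 :=
          le_antisymm (h1 ▸ hμ.superWeight_anti (Finset.insert_subset_insert _ h))
            (hμ.superWeight_nonneg _)
        rw [this, zero_div]
      have e1 : condMarginal μ S' i / ((m : ℝ) - j) = c * (condMarginal μ S' i / m) := by
        rw [hc]; field_simp
      rw [e1, mul_div_assoc c, Real.log_mul (by linarith)
        (div_ne_zero (div_ne_zero h0 hmR.ne') (div_ne_zero h0' hmR.ne'))]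
      apply le_of_eq
      ring
  refine (Finset.sum_le_sum fun i _ => key i).trans ?_
  rw [Finset.sum_add_distrib, ← Finset.mul_sum, ← Finset.sum_mul,
    hμ.sum_stepProb (by omega) hS', one_mul]
  refine add_le_add ?_ hlogc
  refine (mul_le_mul_of_nonneg_left hKL (by linarith)).trans ?_
  rw [← mul_assoc]
  refine mul_le_mul_of_nonneg_right ?_ hlog0
  rw [mul_one_div]
  exact div_le_div_of_nonneg_right hc2 (by positivity)

end Entropy

theorem exp_mul_le_of_nonneg {l x : ℝ} (hl : 0 ≤ l) (hl1 : l ≤ 1) (hx : 0 ≤ x) :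
    Real.exp (l * x) ≤ 1 + l * x + l * Real.exp (l * x) * (x + Real.exp (-x) - 1) := by
  set u := l * x with hu
  have hu0 : 0 ≤ u := mul_nonneg hl hx
  have hE := Real.exp_pos u
  have hE1 : 1 ≤ Real.exp u := Real.one_le_exp hu0
  have h1 : 2 * Real.exp u - 2 ≤ u * (Real.exp u + 1) := by
    have := Real.le_log_one_add_of_nonneg (x := Real.exp u - 1) (by linarith)
    rw [add_sub_cancel, Real.log_exp, div_le_iff₀ (by linarith)] at this
    linarith
  have h2 : Real.exp (-u) ≤ 1 - l + l * Real.exp (-x) := by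
    have := convexOn_exp.2 (Set.mem_univ 0) (Set.mem_univ (-x)) (sub_nonneg.2 hl1) hl
      (by ring)
    simp only [smul_eq_mul, mul_zero, zero_add, Real.exp_zero, mul_one] at this
    rwa [mul_neg] at this
  have h3 : Real.exp u * Real.exp (-u) = 1 := by rw [← Real.exp_add]; simp
  have h4 : 1 ≤ Real.exp u * (1 - l + l * Real.exp (-x)) := by
    exact h3.symm.le.trans (mul_le_mul_of_nonneg_left h2 hE.le)
  have h5 : l * Real.exp u * (x + Real.exp (-x) - 1) =
      Real.exp u * u - Real.exp u + Real.exp u * (1 - l + l * Real.exp (-x)) := by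
    rw [hu]; ring
  rw [h5]
  nlinarith

theorem exp_mul_le_of_nonpos {l x : ℝ} (hl : 0 ≤ l) (hl1 : l ≤ 1) (hx : x ≤ 0) :
    Real.exp (l * x) ≤ 1 + l * x + l * (x + Real.exp (-x) - 1) := by
  have hz : 0 ≤ -x := by linarith
  have hu : 0 ≤ -(l * x) := by nlinarith
  have h1 := Real.quadratic_le_exp_of_nonneg hz
  have h2 := Real.quadratic_le_exp_of_nonneg hu
  have h3 : Real.exp (l * x) * Real.exp (-(l * x)) = 1 := by rw [← Real.exp_add]; simp
  have h4 : Real.exp (l * x) ≤ 1 + l * x + (l * x) ^ 2 / 2 := by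
    have hp : 0 < 1 + -(l * x) + (-(l * x)) ^ 2 / 2 := by positivity
    have h5 : Real.exp (l * x) * (1 + -(l * x) + (-(l * x)) ^ 2 / 2) ≤ 1 := by
      exact (mul_le_mul_of_nonneg_left h2 (Real.exp_pos _).le).trans h3.le
    refine le_of_mul_le_mul_right (h5.trans ?_) hp
    nlinarith [sq_nonneg ((l * x) ^ 2)]
  have h6 : l * (x ^ 2 / 2) ≤ l * (x + Real.exp (-x) - 1) :=
    mul_le_mul_of_nonneg_left (by nlinarith) hl
  nlinarith [mul_nonneg hl (mul_nonneg (sub_nonneg.2 hl1) (sq_nonneg x))]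

theorem rpow_le_of_rpow_le {l y Q : ℝ} (hl : 0 ≤ l) (hl1 : l ≤ 1) (hy : 0 < y) (hQ1 : 1 ≤ Q)
    (hQ : y ^ l ≤ Q) :
    y ^ l ≤ 1 + l * Real.log y + l * Q * (Real.log y + y⁻¹ - 1) := by
  have h1 : y ^ l = Real.exp (l * Real.log y) := by rw [Real.rpow_def_of_pos hy, mul_comm]
  have h2 : y⁻¹ = Real.exp (-Real.log y) := by rw [Real.exp_neg, Real.exp_log hy]
  have h3 : 0 ≤ Real.log y + y⁻¹ - 1 := by
    have := Real.log_le_sub_one_of_pos (inv_pos.2 hy)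
    rw [Real.log_inv] at this
    linarith
  rcases le_total 0 (Real.log y) with h | h
  · have := exp_mul_le_of_nonneg hl hl1 h
    rw [← h1, ← h2] at this
    refine this.trans (add_le_add_right (mul_le_mul_of_nonneg_right ?_ h3) _)
    exact mul_le_mul_of_nonneg_left hQ hl
  · have := exp_mul_le_of_nonpos hl hl1 h
    rw [← h1, ← h2] at this
    refine this.trans (add_le_add_right (mul_le_mul_of_nonneg_right ?_ h3) _)
    nlinarith

theorem linear_bound_nonneg {l y Q : ℝ} (hl : 0 ≤ l) (hl1 : l ≤ 1) (hy : 0 < y) (hQ1 : 1 ≤ Q) :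
    0 ≤ 1 + l * Real.log y + l * Q * (Real.log y + y⁻¹ - 1) := by
  by_cases h : y ^ l ≤ Q
  · exact (Real.rpow_nonneg hy.le _).trans (rpow_le_of_rpow_le hl hl1 hy hQ1 h)
  · have hy1 : 1 ≤ y := by
      by_contra hy1
      exact h ((Real.rpow_le_one hy.le (not_le.1 hy1).le hl).trans hQ1)
    have h3 : 0 ≤ Real.log y + y⁻¹ - 1 := by
      have := Real.log_le_sub_one_of_pos (inv_pos.2 hy)
      rw [Real.log_inv] at this
      linarith
    have := Real.log_nonneg hy1
    positivity

section Tail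

variable {n k : ℕ} {μ : Finset (Fin n) → ℝ}

theorem condMarginal_nonneg (hμ : IsWeight n k μ) (S : Finset (Fin n)) (i : Fin n) :
    0 ≤ condMarginal μ S i :=
  div_nonneg (hμ.superWeight_nonneg _) (hμ.superWeight_nonneg _)

theorem condMarginal_le_one (hμ : IsWeight n k μ) (S : Finset (Fin n)) (i : Fin n) :
    condMarginal μ S i ≤ 1 :=
  div_le_one_of_le₀ (hμ.superWeight_anti (Finset.subset_insert _ _)) (hμ.superWeight_nonneg _)

theorem IsWeight.stepProb_eq_zero_of_subset (hμ : IsWeight n k μ) {S S' : Finset (Fin n)}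
    (h : S ⊆ S') (hS : 0 < superWeight μ S) (hk : S.card < k) {i : Fin n}
    (h0 : stepProb k μ S i = 0) : stepProb k μ S' i = 0 := by
  have hkR : (S.card : ℝ) < k := by exact_mod_cast hk
  unfold stepProb at *
  by_cases hi : i ∈ S
  · simp [h hi]
  rw [if_neg hi, div_eq_zero_iff, or_iff_left (by linarith), condMarginal, div_eq_zero_iff,
    or_iff_left hS.ne'] at h0
  have : superWeight μ (insert i S') = 0 :=
    le_antisymm (h0 ▸ hμ.superWeight_anti (Finset.insert_subset_insert _ h))
      (hμ.superWeight_nonneg _)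
  simp [condMarginal, this]

theorem IsWeight.seqProb_eq_zero (hμ : IsWeight n k μ) {S : Finset (Fin n)}
    (hS : 0 < superWeight μ S) (hk : S.card < k) {l : List (Fin n)}
    (h0 : prodProb k μ S l = 0) : seqProb k μ S l = 0 := by
  induction l with
  | nil => simp [prodProb] at h0
  | cons i l ih =>
    rcases mul_eq_zero.1 h0 with h | h
    · simp [seqProb, ih h]
    · simp [seqProb, hμ.stepProb_eq_zero_of_subset Finset.subset_union_left hS hk h]

/-- One step of the exponential moment bound for the likelihood ratio. -/
theorem sum_step_moment_le (hμ : IsWeight n k μ) {S S' : Finset (Fin n)} (h : S ⊆ S')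
    (hS' : 0 < superWeight μ S') {m j : ℕ}
    (hm : S.card + m = k) (hj : S'.card = S.card + j) (hjm : 2 * j ≤ m) (hm0 : 0 < m)
    {l Q θ : ℝ} (hl : 0 ≤ l) (hl1 : l ≤ 1) (hQ1 : 1 ≤ Q) (hθ : 0 < θ) (hQ : (2 / θ) ^ l ≤ Q) :
    ∑ i, (if θ ≤ condMarginal μ S i then
      stepProb k μ S' i * (stepProb k μ S' i / stepProb k μ S i) ^ l else 0) ≤
    1 + l * (1 + Q) *
      ∑ i, stepProb k μ S' i * Real.log (stepProb k μ S' i / stepProb k μ S i) := by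
  have hS : 0 < superWeight μ S := hS'.trans_le (hμ.superWeight_anti h)
  have hk1 : (k : ℝ) - S.card = m := by rw [← hm]; push_cast; ring
  have hk2 : (k : ℝ) - S'.card = m - j := by rw [← hm, hj]; push_cast; ring
  have hmR : (0 : ℝ) < m := by exact_mod_cast hm0
  have hjR : 2 * (j : ℝ) ≤ m := by exact_mod_cast hjm
  have hmj : (0 : ℝ) < m - j := by linarith [(Nat.cast_nonneg j : (0 : ℝ) ≤ j)]
  have key : ∀ i, (if θ ≤ condMarginal μ S i then
      stepProb k μ S' i * (stepProb k μ S' i / stepProb k μ S i) ^ l else 0) ≤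
      stepProb k μ S' i + l * (1 + Q) *
        (stepProb k μ S' i * Real.log (stepProb k μ S' i / stepProb k μ S i)) +
      l * Q * (stepProb k μ S i - stepProb k μ S' i) := by
    intro i
    rcases (hμ.stepProb_nonneg (S := S') i).eq_or_lt' with h0 | h0
    · have := hμ.stepProb_nonneg (S := S) i
      simp only [h0, zero_mul, ite_self, mul_zero, add_zero, sub_zero, zero_add]
      positivity
    have hq : 0 < stepProb k μ S i :=
      (hμ.stepProb_nonneg i).lt_of_ne' fun hq =>
        h0.ne' (hμ.stepProb_eq_zero_of_subset h hS (by omega) hq)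
    set s := stepProb k μ S' i with hs
    set q := stepProb k μ S i with hqdef
    have hy : 0 < s / q := div_pos h0 hq
    have e : s + l * (1 + Q) * (s * Real.log (s / q)) + l * Q * (q - s) =
        s * (1 + l * Real.log (s / q) + l * Q * (Real.log (s / q) + (s / q)⁻¹ - 1)) := by
      rw [inv_div]; field_simp; ring
    rw [e]
    split_ifs with hg
    · refine mul_le_mul_of_nonneg_left ?_ h0.le
      refine rpow_le_of_rpow_le hl hl1 hy hQ1 (le_trans ?_ hQ)
      refine Real.rpow_le_rpow hy.le ?_ hl
      have hi : i ∉ S := fun hi => hq.ne' (by simp [hqdef, stepProb, hi])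
      have hq2 : θ / m ≤ q := by
        rw [hqdef, stepProb, if_neg hi, hk1]
        exact div_le_div_of_nonneg_right hg hmR.le
      have hs2 : s ≤ 2 / m := by
        rw [hs, stepProb]
        split_ifs
        · positivity
        rw [hk2, div_le_div_iff₀ hmj hmR]
        nlinarith [condMarginal_le_one hμ S' i, condMarginal_nonneg hμ S' i]
      calc s / q ≤ (2 / m) / (θ / m) := div_le_div₀ (by positivity) hs2 (by positivity) hq2
        _ = 2 / θ := by field_simp
    · exact mul_nonneg h0.le (linear_bound_nonneg hl hl1 hy hQ1)
  refine (Finset.sum_le_sum fun i _ => key i).trans ?_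
  rw [Finset.sum_add_distrib, Finset.sum_add_distrib, ← Finset.mul_sum, ← Finset.mul_sum,
    Finset.sum_sub_distrib, hμ.sum_stepProb (by omega) hS', hμ.sum_stepProb (by omega) hS]
  simp

/-- All conditional probabilities along the sequence are at least `θ`. -/
def Typical (μ : Finset (Fin n) → ℝ) (S : Finset (Fin n)) (θ : ℝ) : List (Fin n) → Prop
  | [] => True
  | i :: l => Typical μ S θ l ∧ θ ≤ condMarginal μ (S ∪ l.toFinset) i

open Classical in
/-- The contribution of the sequences with typical probabilities to the exponential moment of
the likelihood ratio. -/
noncomputable def typicalMoment (k : ℕ) (μ : Finset (Fin n) → ℝ) (S : Finset (Fin n))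
    (θ e : ℝ) (l : List (Fin n)) : ℝ :=
  if Typical μ S θ l ∧ ∀ i ∈ l, θ ≤ condMarginal μ S i then
    seqProb k μ S l * (seqProb k μ S l / prodProb k μ S l) ^ e else 0

theorem Typical.superWeight_ge {S : Finset (Fin n)}
    (hS : 0 < superWeight μ S) {θ : ℝ} (hθ : 0 < θ) {l : List (Fin n)} (hl : Typical μ S θ l) :
    θ ^ l.length * superWeight μ S ≤ superWeight μ (S ∪ l.toFinset) := by
  induction l with
  | nil => simp
  | cons i l ih =>
    have h1 := ih hl.1
    have h0 : 0 < superWeight μ (S ∪ l.toFinset) := lt_of_lt_of_le (by positivity) h1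
    have h2 := hl.2
    rw [condMarginal, le_div_iff₀ h0] at h2
    rw [union_toFinset_cons]
    refine le_trans ?_ h2
    rw [List.length_cons, pow_succ]
    nlinarith

theorem sum_typicalMoment_le (hμ : IsWeight n k μ) {α : ℝ} (hα : 0 < α) {S : Finset (Fin n)}
    (hS : 0 < superWeight μ S) {m : ℕ} (hm : S.card + m = k) (hm0 : 0 < m)
    (hE : EntropicallyIndependent α m (condDist μ S))
    {e Q θ : ℝ} (he : 0 ≤ e) (he1 : e ≤ 1) (hQ1 : 1 ≤ Q) (hθ : 0 < θ) (hθ1 : θ ≤ 1)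
    (hQ : (2 / θ) ^ e ≤ Q) (j : ℕ) (hj : 2 * (j - 1) ≤ m) :
    ∑ l ∈ tuples n j, typicalMoment k μ S θ e l ≤
      Real.exp (e * (1 + Q) * ((2 * Real.log θ⁻¹ / α + 2) / m) * ∑ i ∈ Finset.range j, (i : ℝ)) := by
  have hlogθ : 0 ≤ Real.log θ⁻¹ := Real.log_nonneg ((one_le_inv₀ hθ).2 hθ1)
  induction j with
  | zero => simp [sum_tuples_zero, typicalMoment, Typical, seqProb, prodProb]
  | succ j ih =>
    rw [sum_tuples_succ, Finset.sum_range_succ, mul_add, Real.exp_add]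
    refine le_trans ?_ (mul_le_mul_of_nonneg_right (ih (by omega)) (Real.exp_pos _).le)
    rw [Finset.sum_mul]
    refine Finset.sum_le_sum fun l hl => ?_
    rw [mem_tuples] at hl
    have hsplit : ∀ i, typicalMoment k μ S θ e (i :: l) ≤ typicalMoment k μ S θ e l *
        (if θ ≤ condMarginal μ S i then stepProb k μ (S ∪ l.toFinset) i *
          (stepProb k μ (S ∪ l.toFinset) i / stepProb k μ S i) ^ e else 0) := by
      intro i
      have hpos1 : 0 ≤ seqProb k μ S l * (seqProb k μ S l / prodProb k μ S l) ^ e :=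
        mul_nonneg (hμ.seqProb_nonneg l)
          (Real.rpow_nonneg (div_nonneg (hμ.seqProb_nonneg l) (hμ.prodProb_nonneg l)) _)
      have hpos2 : 0 ≤ stepProb k μ (S ∪ l.toFinset) i *
          (stepProb k μ (S ∪ l.toFinset) i / stepProb k μ S i) ^ e :=
        mul_nonneg (hμ.stepProb_nonneg i)
          (Real.rpow_nonneg (div_nonneg (hμ.stepProb_nonneg i) (hμ.stepProb_nonneg i)) _)
      by_cases hc : Typical μ S θ (i :: l) ∧ ∀ x ∈ i :: l, θ ≤ condMarginal μ S x
      · have hc1 : Typical μ S θ l ∧ ∀ x ∈ l, θ ≤ condMarginal μ S x :=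
          ⟨hc.1.1, fun x hx => hc.2 x (List.mem_cons_of_mem _ hx)⟩
        have hc2 : θ ≤ condMarginal μ S i := hc.2 i List.mem_cons_self
        rw [typicalMoment, if_pos hc, typicalMoment, if_pos hc1, if_pos hc2]
        simp only [seqProb, prodProb]
        rw [mul_div_mul_comm, Real.mul_rpow (div_nonneg (hμ.seqProb_nonneg l)
          (hμ.prodProb_nonneg l)) (div_nonneg (hμ.stepProb_nonneg i) (hμ.stepProb_nonneg i))]
        apply le_of_eq
        ring
      · rw [typicalMoment, if_neg hc]
        refine mul_nonneg ?_ ?_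
        · rw [typicalMoment]
          split_ifs
          · exact hpos1
          · exact le_rfl
        · split_ifs
          · exact hpos2
          · exact le_rfl
    refine (Finset.sum_le_sum fun i _ => hsplit i).trans ?_
    rw [← Finset.mul_sum]
    by_cases h0 : typicalMoment k μ S θ e l = 0
    · simp [h0]
    have hT : Typical μ S θ l := by
      by_contra hT
      exact h0 (by simp [typicalMoment, hT])
    have hseq : seqProb k μ S l ≠ 0 := by
      intro hz
      exact h0 (by simp [typicalMoment, hz])
    obtain ⟨hS', hcard⟩ := hμ.seqProb_ne_zero hS hseq
    rw [hl] at hcard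
    have hjm : 2 * j ≤ m := by simpa using hj
    refine mul_le_mul_of_nonneg_left ?_ ?_
    · refine (sum_step_moment_le hμ Finset.subset_union_left hS' hm hcard hjm hm0 he he1 hQ1 hθ
        hQ).trans ?_
      rw [add_comm]
      refine le_trans (add_le_add_left ?_ 1) (Real.add_one_le_exp _)
      rw [mul_assoc (e * (1 + Q))]
      refine mul_le_mul_of_nonneg_left ?_ (by positivity)
      refine (sum_stepProb_mul_log_le hμ hα Finset.subset_union_left hS' hm hcard hjm hm0
        hE).trans ?_
      have hlog : Real.log (superWeight μ S / superWeight μ (S ∪ l.toFinset)) ≤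
          j * Real.log θ⁻¹ := by
        rw [← Real.log_pow]
        refine Real.log_le_log (div_pos hS hS') ?_
        rw [div_le_iff₀ hS', inv_pow, ← div_eq_inv_mul, le_div_iff₀ (by positivity), mul_comm]
        have := hT.superWeight_ge hS hθ
        rwa [hl] at this
      have hmR : (0 : ℝ) < m := by exact_mod_cast hm0
      calc _ ≤ 2 / (α * m) * (j * Real.log θ⁻¹) + 2 * j / m := by
            gcongr
        _ = _ := by field_simp
    · rw [typicalMoment]
      split_ifs
      · exact mul_nonneg (hμ.seqProb_nonneg l)
          (Real.rpow_nonneg (div_nonneg (hμ.seqProb_nonneg l) (hμ.prodProb_nonneg l)) _)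
      · exact le_rfl

open Classical in
theorem sum_rare_marginal_le (hμ : IsWeight n k μ) {S : Finset (Fin n)}
    (hS : 0 < superWeight μ S) (θ : ℝ) (hθ : 0 ≤ θ) (j : ℕ) (hj : S.card + j ≤ k) :
    ∑ l ∈ tuples n j, (if ∀ i ∈ l, θ ≤ condMarginal μ S i then 0 else seqProb k μ S l) ≤
      n * θ := by
  set Φ : Finset (Fin n) → ℝ := fun T =>
    ∑ i, (if condMarginal μ S i < θ then 1 else 0) * (if i ∈ T then 1 else 0) with hΦ
  have h1 : condMean μ S Φ ≤ n * θ := by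
    have : condMean μ S Φ = ∑ i, (if condMarginal μ S i < θ then 1 else 0) * condMarginal μ S i := by
      simp_rw [condMean, hΦ, Finset.mul_sum]
      rw [Finset.sum_comm, Finset.sum_div]
      refine Finset.sum_congr rfl fun i _ => ?_
      generalize (if condMarginal μ S i < θ then (1 : ℝ) else 0) = c
      rw [← condMean_mem, condMean, ← mul_div_assoc, Finset.mul_sum]
      congr 1
      exact Finset.sum_congr rfl fun T _ => by ring
    rw [this]
    calc _ ≤ ∑ _i : Fin n, θ := Finset.sum_le_sum fun i _ => by
          split_ifs with h
          · linarith
          · linarith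
      _ = n * θ := by simp
  refine le_trans ?_ h1
  rw [← hμ.sum_seqProb_mul_condMean hS Φ j hj]
  refine Finset.sum_le_sum fun l _ => ?_
  have hΦ0 : ∀ T, 0 ≤ Φ T := fun T => Finset.sum_nonneg fun i _ => by positivity
  split_ifs with h
  · exact mul_nonneg (hμ.seqProb_nonneg l) (div_nonneg (Finset.sum_nonneg fun T _ =>
      mul_nonneg (hμ.nonneg T) (hΦ0 T)) (hμ.superWeight_nonneg _))
  · push Not at h
    obtain ⟨i, hi, hi'⟩ := h
    by_cases h0 : seqProb k μ S l = 0
    · simp [h0]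
    refine le_mul_of_one_le_right (hμ.seqProb_nonneg l) ?_
    rw [← condMean_one (hμ.seqProb_ne_zero hS h0).1.ne']
    refine condMean_mono hμ fun T hT => ?_
    have hiT : i ∈ T := hT (by simp [hi])
    calc (1 : ℝ) = (if condMarginal μ S i < θ then 1 else 0) * (if i ∈ T then 1 else 0) := by
          simp [hi', hiT]
      _ ≤ Φ T := Finset.single_le_sum (f := fun i => (if condMarginal μ S i < θ then (1 : ℝ) else 0)
          * (if i ∈ T then 1 else 0)) (fun i _ => by positivity) (Finset.mem_univ i)

open Classical in
theorem sum_not_typical_le (hμ : IsWeight n k μ) {S : Finset (Fin n)}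
    (hS : 0 < superWeight μ S) (θ : ℝ) (hθ : 0 ≤ θ) (j : ℕ) (hj : S.card + j ≤ k) :
    ∑ l ∈ tuples n j, (if Typical μ S θ l then 0 else seqProb k μ S l) ≤ j * (n * θ) := by
  induction j with
  | zero => simp [sum_tuples_zero, Typical]
  | succ j ih =>
    rw [sum_tuples_succ]
    have h1 : ∀ l ∈ tuples n j, ∑ i, (if Typical μ S θ (i :: l) then 0 else seqProb k μ S (i :: l)) ≤
        (if Typical μ S θ l then 0 else seqProb k μ S l) + seqProb k μ S l * (n * θ) := by
      intro l hl
      rw [mem_tuples] at hl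
      by_cases h0 : seqProb k μ S l = 0
      · simp [seqProb, h0]
      obtain ⟨hS', hcard⟩ := hμ.seqProb_ne_zero hS h0
      have hnn := hμ.seqProb_nonneg (S := S) l
      by_cases hT : Typical μ S θ l
      · simp only [hT, if_true, zero_add, Typical, true_and, seqProb]
        calc _ ≤ ∑ _i : Fin n, seqProb k μ S l * θ := Finset.sum_le_sum fun i _ => by
              split_ifs with h
              · positivity
              · refine mul_le_mul_of_nonneg_left ?_ hnn
                unfold stepProb
                split_ifs
                · exact hθ
                · have : (1 : ℝ) ≤ k - (S ∪ l.toFinset).card := by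
                    rw [hcard, hl, le_sub_iff_add_le, add_comm]
                    exact_mod_cast hj
                  exact (div_le_self (condMarginal_nonneg hμ _ _) this).trans (not_le.1 h).le
          _ = _ := by simp; ring
      · simp only [hT, if_false, Typical, false_and, seqProb]
        rw [← Finset.mul_sum]
        have := mul_le_mul_of_nonneg_left (hμ.sum_stepProb_le (S ∪ l.toFinset)) hnn
        have h3 : 0 ≤ seqProb k μ S l * (n * θ) := by positivity
        linarith
    refine (Finset.sum_le_sum h1).trans ?_
    rw [Finset.sum_add_distrib, ← Finset.sum_mul, hμ.sum_seqProb hS j (by omega)]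
    push_cast
    linarith [ih (by omega)]

/-- The likelihood ratio between the first `j` elements of a random set and independent
elements is at most `B`, up to the stated probability. -/
theorem sum_seqProb_sub_min_le (hμ : IsWeight n k μ) {α : ℝ} (hα : 0 < α) {S : Finset (Fin n)}
    (hS : 0 < superWeight μ S) {m : ℕ} (hm : S.card + m = k) (hm0 : 0 < m)
    (hE : EntropicallyIndependent α m (condDist μ S))
    {e Q θ : ℝ} (he : 0 ≤ e) (he1 : e ≤ 1) (hQ1 : 1 ≤ Q) (hθ : 0 < θ) (hθ1 : θ ≤ 1)
    (hQ : (2 / θ) ^ e ≤ Q) {B : ℝ} (hB : 0 < B) (j : ℕ) (hj : 2 * (j - 1) ≤ m) (hjm : j ≤ m) :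
    ∑ l ∈ tuples n j, (seqProb k μ S l - min (seqProb k μ S l) (B * prodProb k μ S l)) ≤
      n * θ + j * (n * θ) + B ^ (-e) *
      Real.exp (e * (1 + Q) * ((2 * Real.log θ⁻¹ / α + 2) / m) * ∑ i ∈ Finset.range j, (i : ℝ)) := by
  classical
  have key : ∀ l, seqProb k μ S l - min (seqProb k μ S l) (B * prodProb k μ S l) ≤
      (if ∀ i ∈ l, θ ≤ condMarginal μ S i then 0 else seqProb k μ S l) +
      (if Typical μ S θ l then 0 else seqProb k μ S l) +
      B ^ (-e) * typicalMoment k μ S θ e l := by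
    intro l
    have hs := hμ.seqProb_nonneg (S := S) l
    have hp := hμ.prodProb_nonneg (S := S) l
    have hBe : 0 ≤ B ^ (-e) := Real.rpow_nonneg hB.le _
    have hM : 0 ≤ seqProb k μ S l * (seqProb k μ S l / prodProb k μ S l) ^ e :=
      mul_nonneg hs (Real.rpow_nonneg (div_nonneg hs hp) _)
    have hM' : 0 ≤ B ^ (-e) * typicalMoment k μ S θ e l := by
      rw [typicalMoment]
      split_ifs
      · exact mul_nonneg hBe hM
      · simp
    rcases le_or_gt (seqProb k μ S l) (B * prodProb k μ S l) with h | h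
    · rw [min_eq_left h, sub_self]
      split_ifs <;> positivity
    have hsub : seqProb k μ S l - min (seqProb k μ S l) (B * prodProb k μ S l) ≤
        seqProb k μ S l := by
      rw [min_eq_right h.le]
      linarith [mul_nonneg hB.le hp]
    refine hsub.trans ?_
    by_cases h1 : ∀ i ∈ l, θ ≤ condMarginal μ S i
    · by_cases h2 : Typical μ S θ l
      · rw [if_pos h1, if_pos h2, zero_add, zero_add, typicalMoment, if_pos ⟨h2, h1⟩]
        have hs0 : 0 < seqProb k μ S l := lt_of_le_of_lt (mul_nonneg hB.le hp) h
        have hp0 : 0 < prodProb k μ S l := hp.lt_of_ne' fun h0 =>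
          hs0.ne' (hμ.seqProb_eq_zero hS (by omega) h0)
        rw [mul_left_comm]
        refine le_mul_of_one_le_right hs ?_
        rw [Real.rpow_neg hB.le, ← div_eq_inv_mul, le_div_iff₀ (Real.rpow_pos_of_pos hB _), one_mul]
        exact Real.rpow_le_rpow hB.le ((le_div_iff₀ hp0).2 h.le) he
      · rw [if_pos h1, if_neg h2]
        linarith
    · rw [if_neg h1]
      split_ifs <;> linarith
  refine (Finset.sum_le_sum fun l _ => key l).trans ?_
  rw [Finset.sum_add_distrib, Finset.sum_add_distrib, ← Finset.mul_sum]
  refine add_le_add (add_le_add (sum_rare_marginal_le hμ hS θ hθ.le j (by omega))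
    (sum_not_typical_le hμ hS θ hθ.le j (by omega))) ?_
  exact mul_le_mul_of_nonneg_left (sum_typicalMoment_le hμ hα hS hm hm0 hE he he1 hQ1 hθ hθ1 hQ j hj)
    (Real.rpow_nonneg hB.le _)

end Tail

section TapeIndependence

open ProbabilityTheory

/-- The events that depend only on the cells in `J` of the random tape. -/
@[reducible] def cellSigma (J : Set ℕ) : MeasurableSpace Tape :=
  ⨆ i ∈ J, MeasurableSpace.comap (fun ω : Tape => ω i) inferInstance

theorem measurable_cell {J : Set ℕ} {i : ℕ} (hi : i ∈ J) :
    Measurable[cellSigma J] (fun ω : Tape => ω i) :=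
  measurable_iff_comap_le.2 (le_iSup₂_of_le i hi le_rfl)

theorem cellSigma_le (J : Set ℕ) : cellSigma J ≤ (inferInstance : MeasurableSpace Tape) :=
  iSup₂_le fun i _ => (measurable_pi_apply i).comap_le

theorem cellSigma_mono {J J' : Set ℕ} (h : J ⊆ J') : cellSigma J ≤ cellSigma J' :=
  iSup₂_le fun i hi => le_iSup₂_of_le i (h hi) le_rfl

instance : IsProbabilityMeasure tapeLaw := by
  unfold tapeLaw
  infer_instance

theorem tapeLaw_real_inter {J J' : Set ℕ} (hJ : Disjoint J J') {A A' : Set Tape}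
    (hA : MeasurableSet[cellSigma J] A) (hA' : MeasurableSet[cellSigma J'] A') :
    tapeLaw.real (A ∩ A') = tapeLaw.real A * tapeLaw.real A' := by
  have h1 : iIndepFun (fun i (ω : Tape) => ω i) tapeLaw :=
    iIndepFun_infinitePi (P := fun _ : ℕ => (volume : Measure unitInterval))
      (X := fun _ u => u) fun _ => measurable_id
  have h2 := indep_iSup_of_disjoint (fun i => (measurable_pi_apply i).comap_le) h1.iIndep hJ
  rw [Measure.real, (Indep_iff _ _ _).1 h2 A A' hA hA', ENNReal.toReal_mul]
  rfl

theorem tapeLaw_real_cell (i : ℕ) {s : Set unitInterval} (hs : MeasurableSet s) :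
    tapeLaw.real {ω | ω i ∈ s} = (volume : Measure unitInterval).real s := by
  have := (measurePreserving_eval_infinitePi (fun _ : ℕ => (volume : Measure unitInterval)) i)
  exact this.measureReal_preimage hs.nullMeasurableSet

end TapeIndependence

section Pick

variable {n : ℕ}

/-- The oracle's answers, made nonnegative and set to zero on `S`. -/
noncomputable def clip (O : Finset (Fin n) → Fin n → ℝ) (S : Finset (Fin n)) (i : Fin n) : ℝ :=
  if i ∈ S ∨ O S i < 0 then 0 else O S i

theorem clip_nonneg (O : Finset (Fin n) → Fin n → ℝ) (S : Finset (Fin n)) (i : Fin n) :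
    0 ≤ clip O S i := by
  unfold clip
  split_ifs with h
  · exact le_rfl
  · exact not_lt.1 (not_or.1 h).2

/-- The cumulative sums of the clipped answers. -/
noncomputable def cumul (O : Finset (Fin n) → Fin n → ℝ) (S : Finset (Fin n)) (i : Fin n) : ℝ :=
  ∑ i' ∈ Finset.univ.filter (fun i' => i' ≤ i), clip O S i'

theorem cumul_mono (O : Finset (Fin n) → Fin n → ℝ) (S : Finset (Fin n)) {i j : Fin n}
    (h : i ≤ j) : cumul O S i ≤ cumul O S j :=
  Finset.sum_le_sum_of_subset_of_nonneg
    (fun x hx => by simp only [Finset.mem_filter, Finset.mem_univ, true_and] at *; exact hx.trans h)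
    fun x _ _ => clip_nonneg O S x

/-- `i` is the first index whose cumulative sum exceeds `u * m`. -/
def IsPick (O : Finset (Fin n) → Fin n → ℝ) (S : Finset (Fin n)) (m : ℕ) (u : ℝ) (i : Fin n) :
    Prop :=
  u * m < cumul O S i ∧ ∀ i' < i, cumul O S i' ≤ u * m

theorem IsPick.unique {O : Finset (Fin n) → Fin n → ℝ} {S : Finset (Fin n)} {m : ℕ} {u : ℝ}
    {i j : Fin n} (hi : IsPick O S m u i) (hj : IsPick O S m u j) : i = j := by
  rcases lt_trichotomy i j with h | h | h
  · exact absurd hi.1 (not_lt.2 (hj.2 i h))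
  · exact h
  · exact absurd hj.1 (not_lt.2 (hi.2 j h))

open Classical in
/-- The element of `{0, …, n - 1}` selected by the random number `u`. -/
noncomputable def pick [NeZero n] (O : Finset (Fin n) → Fin n → ℝ) (S : Finset (Fin n)) (m : ℕ)
    (u : ℝ) : Fin n :=
  if h : ∃ i, IsPick O S m u i then h.choose else 0

theorem IsPick.pick_eq [NeZero n] {O : Finset (Fin n) → Fin n → ℝ} {S : Finset (Fin n)} {m : ℕ}
    {u : ℝ} {i : Fin n} (hi : IsPick O S m u i) : pick O S m u = i := by
  have h : ∃ i, IsPick O S m u i := ⟨i, hi⟩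
  rw [pick, dif_pos h]
  exact h.choose_spec.unique hi

theorem measurableSet_isPick (O : Finset (Fin n) → Fin n → ℝ) (S : Finset (Fin n)) (m : ℕ)
    (i : Fin n) : MeasurableSet {u : unitInterval | IsPick O S m u i} := by
  have hm : Measurable fun u : unitInterval => (u : ℝ) * m :=
    measurable_subtype_coe.mul_const _
  simp only [IsPick, Set.ofPred_and, Set.ofPred_forall]
  exact (measurableSet_lt hm measurable_const).inter
    (MeasurableSet.iInter fun i' => MeasurableSet.iInter fun _ =>
      measurableSet_le measurable_const hm)

theorem measurableSet_pick [NeZero n] (O : Finset (Fin n) → Fin n → ℝ) (S : Finset (Fin n))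
    (m : ℕ) (i : Fin n) : MeasurableSet {u : unitInterval | pick O S m u = i} := by
  have : {u : unitInterval | pick O S m u = i} = {u : unitInterval | IsPick O S m u i} ∪
      ((⋂ i, {u : unitInterval | IsPick O S m u i}ᶜ) ∩ {_u : unitInterval | i = 0}) := by
    ext u
    simp only [Set.mem_ofPred_eq, Set.mem_union, Set.mem_inter_iff, Set.mem_iInter,
      Set.mem_compl_iff]
    constructor
    · intro h
      by_cases hex : ∃ i, IsPick O S m u i
      · left
        obtain ⟨j, hj⟩ := hex
        rw [hj.pick_eq] at h
        exact h ▸ hj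
      · right
        rw [pick, dif_neg hex] at h
        exact ⟨not_exists.1 hex, h.symm⟩
    · rintro (h | ⟨h, h'⟩)
      · exact h.pick_eq
      · rw [pick, dif_neg (not_exists.2 h), h']
  rw [this]
  exact (measurableSet_isPick O S m i).union ((MeasurableSet.iInter fun i =>
    (measurableSet_isPick O S m i).compl).inter (MeasurableSet.const _))

variable {k : ℕ} {μ : Finset (Fin n) → ℝ} {O : Finset (Fin n) → Fin n → ℝ}

theorem clip_eq (hμ : IsWeight n k μ) (hO : IsMarginalOracle μ O) {S : Finset (Fin n)}
    (hS : 0 < superWeight μ S) {m : ℕ} (hm : S.card + m = k) (hm0 : 0 < m) (i : Fin n) :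
    clip O S i = stepProb k μ S i * m := by
  have hk1 : (k : ℝ) - S.card = m := by rw [← hm]; push_cast; ring
  have hmR : (m : ℝ) ≠ 0 := by exact_mod_cast hm0.ne'
  unfold clip stepProb
  by_cases hi : i ∈ S
  · simp [hi]
  · have h0 := condMarginal_nonneg hμ S i
    rw [hO S i hi hS, if_neg (by simp [hi, h0]), if_neg hi, hk1, div_mul_cancel₀ _ hmR]

theorem volume_pick [NeZero n] (hμ : IsWeight n k μ) (hO : IsMarginalOracle μ O)
    {S : Finset (Fin n)} (hS : 0 < superWeight μ S) {m : ℕ} (hm : S.card + m = k) (hm0 : 0 < m)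
    (i : Fin n) :
    (volume : Measure unitInterval).real {u : unitInterval | pick O S m u = i} =
      stepProb k μ S i := by
  have hmR : (0 : ℝ) < m := by exact_mod_cast hm0
  have hcum : ∀ i, cumul O S i =
      (∑ i' ∈ Finset.univ.filter (fun i' => i' ≤ i), stepProb k μ S i') * m := by
    intro i
    rw [cumul, Finset.sum_mul]
    exact Finset.sum_congr rfl fun j _ => clip_eq hμ hO hS hm hm0 j
  have hnn : ∀ j ∈ (Finset.univ : Finset (Fin n)), 0 ≤ stepProb k μ S j :=
    fun j _ => hμ.stepProb_nonneg j
  have h1 := hμ.sum_stepProb (S := S) (by omega) hS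
  have hsub : ∀ s : Finset (Fin n), ∑ j ∈ s, stepProb k μ S j ∈ unitInterval := fun s =>
    ⟨Finset.sum_nonneg fun j _ => hμ.stepProb_nonneg j,
      h1 ▸ Finset.sum_le_sum_of_subset_of_nonneg (Finset.subset_univ s) fun j hj _ => hnn j hj⟩
  have hset : {u : unitInterval | IsPick O S m u i} =
      Set.Ico ⟨_, hsub (Finset.univ.filter (fun i' => i' < i))⟩
        ⟨_, hsub (Finset.univ.filter (fun i' => i' ≤ i))⟩ := by
    ext u
    rw [Set.mem_ofPred_eq, IsPick, Set.mem_Ico, hcum, mul_lt_mul_iff_left₀ hmR, and_comm]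
    refine and_congr ?_ Iff.rfl
    rw [← Subtype.coe_le_coe]
    constructor
    · intro h
      by_cases h0 : i = 0
      · have : (Finset.univ.filter (fun i' : Fin n => i' < i)) = ∅ := by
          ext j; simp [h0]
        simp only [this, Finset.sum_empty]
        exact u.2.1
      · have hi : 0 < (i : ℕ) := Nat.pos_of_ne_zero fun h => h0 (Fin.ext (by simpa using h))
        have hpred : (Finset.univ.filter (fun i' : Fin n => i' < i)) =
            Finset.univ.filter (fun i' : Fin n => i' ≤ ⟨i - 1, by omega⟩) := by
          ext j
          simp only [Finset.mem_filter, Finset.mem_univ, true_and, Fin.lt_def, Fin.le_def]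
          omega
        have := h ⟨i - 1, by omega⟩ (Fin.lt_def.2 (show (i : ℕ) - 1 < i by omega))
        rw [hcum, mul_le_mul_iff_left₀ hmR] at this
        simpa only [hpred] using this
    · intro h j hj
      rw [hcum, mul_le_mul_iff_left₀ hmR]
      have h' : ∑ i' ∈ Finset.univ.filter (fun i' => i' < i), stepProb k μ S i' ≤ (u : ℝ) := h
      refine le_trans ?_ h'
      refine Finset.sum_le_sum_of_subset_of_nonneg (fun x hx => ?_)
        fun j _ _ => hμ.stepProb_nonneg j
      simp only [Finset.mem_filter, Finset.mem_univ, true_and] at *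
      exact lt_of_le_of_lt hx hj
  have hae : {u : unitInterval | pick O S m u = i} =ᵐ[volume]
      {u : unitInterval | IsPick O S m u i} := by
    have hne : ∀ᵐ u : unitInterval, u ≠ 1 := by
      simp [ae_iff]
    filter_upwards [hne] with u hu
    have hu1 : (u : ℝ) < 1 := lt_of_le_of_ne u.2.2 fun h => hu (Subtype.ext h)
    have hex : ∃ j, IsPick O S m u j := by
      have hlast : (u : ℝ) * m < cumul O S ⊤ := by
        rw [hcum, mul_lt_mul_iff_left₀ hmR]
        have : (Finset.univ.filter (fun i' : Fin n => i' ≤ ⊤)) = Finset.univ := by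
          ext j; simp
        rw [this, h1]
        exact hu1
      obtain ⟨j, hj, hj'⟩ := WellFounded.has_min (wellFounded_lt (α := Fin n))
        {j | (u : ℝ) * m < cumul O S j} ⟨_, hlast⟩
      exact ⟨j, hj, fun i' hi' => not_lt.1 fun h => hj' i' h hi'⟩
    obtain ⟨j, hj⟩ := hex
    refine propext ⟨fun h => ?_, fun h => IsPick.pick_eq h⟩
    have h : pick O S m u = i := h
    rw [hj.pick_eq] at h
    exact h ▸ hj
  rw [Measure.real, measure_congr hae, hset, unitInterval.volume_Ico]
  have hle : (Finset.univ.filter (fun i' : Fin n => i' ≤ i)) =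
      insert i (Finset.univ.filter (fun i' : Fin n => i' < i)) := by
    ext j
    simp [le_iff_eq_or_lt]
  rw [ENNReal.toReal_ofReal]
  · simp only [hle]
    rw [Finset.sum_insert (by simp)]
    ring
  · simp only [hle]
    rw [Finset.sum_insert (by simp)]
    linarith [hμ.stepProb_nonneg (S := S) i]

theorem volume_mul_lt {B : ℝ} (hB : 0 < B) (R : ℝ) :
    (volume : Measure unitInterval).real {u : unitInterval | (u : ℝ) * B < R} =
      min 1 (max 0 (R / B)) := by
  simp_rw [← lt_div_iff₀ hB]
  generalize R / B = x
  rcases le_or_gt x 0 with h | h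
  · have : {u : unitInterval | (u : ℝ) < x} = ∅ := by
      ext u
      simpa using h.trans u.2.1
    simp [this, h]
  rcases le_or_gt x 1 with h' | h'
  · have : {u : unitInterval | (u : ℝ) < x} = Set.Iio ⟨x, h.le, h'⟩ := by
      ext u
      simp [← Subtype.coe_lt_coe]
    rw [this, Measure.real, unitInterval.volume_Iio, ENNReal.toReal_ofReal h.le, max_eq_right h.le,
      min_eq_right h']
  · have : {u : unitInterval | (u : ℝ) < x} = Set.univ := by
      ext u
      simpa using lt_of_le_of_lt u.2.2 h'
    simp [this, h.le, h'.le]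

end Pick

section Round

variable {n : ℕ}

/-- The likelihood ratio of a sequence, as computed from the oracle's answers. -/
noncomputable def ratio (O : Finset (Fin n) → Fin n → ℝ) (S : Finset (Fin n)) (m : ℕ) :
    List (Fin n) → ℝ
  | [] => 1
  | i :: l => ratio O S m l * (if i ∈ S ∪ l.toFinset then 0 else
      O (S ∪ l.toFinset) i * m / (((m : ℝ) - l.length) * clip O S i))

variable {k : ℕ} {μ : Finset (Fin n) → ℝ} {O : Finset (Fin n) → Fin n → ℝ}
  {S : Finset (Fin n)} {m j T W : ℕ} {B : ℝ}

theorem ratio_mul_prodProb (hμ : IsWeight n k μ) (hO : IsMarginalOracle μ O)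
    (hS : 0 < superWeight μ S) (hm : S.card + m = k) {l : List (Fin n)}
    (hl : l.length ≤ m) : ratio O S m l * prodProb k μ S l = seqProb k μ S l := by
  induction l with
  | nil => simp [ratio, prodProb, seqProb]
  | cons i l ih =>
    rw [List.length_cons] at hl
    simp only [ratio, prodProb, seqProb]
    rw [mul_mul_mul_comm, ih (by omega)]
    by_cases h0 : seqProb k μ S l = 0
    · simp [h0]
    congr 1
    obtain ⟨hS', hcard⟩ := hμ.seqProb_ne_zero hS h0
    by_cases hi : i ∈ S ∪ l.toFinset
    · simp [hi, stepProb]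
    have hm0 : 0 < m := by omega
    have hmR : (m : ℝ) ≠ 0 := by exact_mod_cast hm0.ne'
    have hmj : (m : ℝ) - l.length ≠ 0 := by
      have : (l.length : ℝ) + 1 ≤ m := by exact_mod_cast hl
      linarith
    rw [if_neg hi, hO _ _ hi hS', clip_eq hμ hO hS hm hm0]
    by_cases hq : stepProb k μ S i = 0
    · rw [hq, hμ.stepProb_eq_zero_of_subset Finset.subset_union_left hS (by omega) hq]
      simp
    · have e : stepProb k μ (S ∪ l.toFinset) i =
          condMarginal μ (S ∪ l.toFinset) i / ((k : ℝ) - (S ∪ l.toFinset).card) := if_neg hi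
      rw [e, hcard, ← hm]
      rw [← hm] at hq
      push_cast
      have : (S.card : ℝ) + m - (S.card + l.length) = m - l.length := by ring
      rw [this]
      field_simp

variable [NeZero n]

/-- The first `j` elements proposed with the random numbers from the cell `b` on. -/
noncomputable def draws (O : Finset (Fin n) → Fin n → ℝ) (S : Finset (Fin n)) (m : ℕ)
    (ω : Tape) (b : ℕ) : ℕ → List (Fin n)
  | 0 => []
  | j + 1 => pick O S m (ω (b + j)) :: draws O S m ω b j

theorem length_draws (O : Finset (Fin n) → Fin n → ℝ) (S : Finset (Fin n)) (m : ℕ)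
    (ω : Tape) (b j : ℕ) : (draws O S m ω b j).length = j := by
  induction j with
  | zero => rfl
  | succ j ih => simp [draws, ih]

/-- The proposal of length `j` at the cell `b` is accepted. -/
def Accepted (O : Finset (Fin n) → Fin n → ℝ) (S : Finset (Fin n)) (m j : ℕ) (B : ℝ)
    (ω : Tape) (b : ℕ) : Prop :=
  (ω (b + j) : ℝ) * B < ratio O S m (draws O S m ω b j)

open Classical in
/-- One round of rejection sampling with `T` proposals, each of length `j` and using `W` cells:
the first accepted proposal is added to `S`. -/
noncomputable def round (O : Finset (Fin n) → Fin n → ℝ) (m j T W : ℕ) (B : ℝ)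
    (ω : Tape) (b : ℕ) (S : Finset (Fin n)) : Finset (Fin n) :=
  if h : ∃ t, t < T ∧ Accepted O S m j B ω (b + t * W) then
    S ∪ (draws O S m ω (b + Nat.find h * W) j).toFinset else S

/-- At most `F` rounds of rejection sampling, until no elements remain to be chosen. -/
noncomputable def rounds (O : Finset (Fin n) → Fin n → ℝ) (ell : ℕ → ℕ) (T W : ℕ) (B : ℝ)
    (ω : Tape) : ℕ → ℕ → ℕ → Finset (Fin n) → Finset (Fin n)
  | 0, _, _, S => S
  | F + 1, m, b, S => if m = 0 then S else
      rounds O ell T W B ω F (m - ell m) (b + T * W) (round O m (ell m) T W B ω b S)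

theorem measurableSet_draws {J : Set ℕ} {b : ℕ} (hJ : ∀ i < j, b + i ∈ J) (l : List (Fin n)) :
    MeasurableSet[cellSigma J] {ω | draws O S m ω b j = l} := by
  induction j generalizing l with
  | zero => exact @MeasurableSet.const _ (cellSigma J) ([] = l)
  | succ j ih =>
    cases l with
    | nil => simp only [draws, reduceCtorEq]; exact MeasurableSet.const _
    | cons i l =>
      simp only [draws, List.cons.injEq, Set.ofPred_and]
      refine MeasurableSet.inter ?_ (ih (fun i hi => hJ i (by omega)) l)
      exact measurable_cell (hJ j (by omega)) (measurableSet_pick O S m i)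

theorem measurableSet_cell_mul_lt {J : Set ℕ} {i : ℕ} (hi : i ∈ J) (R : ℝ) :
    MeasurableSet[cellSigma J] {ω : Tape | (ω i : ℝ) * B < R} := by
  have : MeasurableSet {u : unitInterval | (u : ℝ) * B < R} :=
    measurableSet_lt (measurable_subtype_coe.mul_const _) measurable_const
  exact measurable_cell hi this

/-- The `t`-th proposal is `l` and it is accepted. -/
def AcceptedAs (O : Finset (Fin n) → Fin n → ℝ) (S : Finset (Fin n)) (m j : ℕ) (B : ℝ)
    (b : ℕ) (l : List (Fin n)) : Set Tape :=
  {ω | draws O S m ω b j = l} ∩ {ω | (ω (b + j) : ℝ) * B < ratio O S m l}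

theorem measurableSet_acceptedAs {J : Set ℕ} {b : ℕ} (hJ : ∀ i < j + 1, b + i ∈ J)
    (l : List (Fin n)) : MeasurableSet[cellSigma J] (AcceptedAs O S m j B b l) :=
  (measurableSet_draws (fun i hi => hJ i (by omega)) l).inter
    (measurableSet_cell_mul_lt (hJ j (by omega)) _)

theorem setOf_accepted (b : ℕ) :
    {ω | Accepted O S m j B ω b} = ⋃ l ∈ tuples n j, AcceptedAs O S m j B b l := by
  ext ω
  simp only [Set.mem_ofPred_eq, AcceptedAs, Set.mem_iUnion, Set.mem_inter_iff, mem_tuples]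
  constructor
  · intro h
    exact ⟨_, length_draws O S m ω b j, rfl, h⟩
  · rintro ⟨l, _, rfl, h⟩
    exact h

theorem measurableSet_accepted {J : Set ℕ} {b : ℕ} (hJ : ∀ i < j + 1, b + i ∈ J) :
    MeasurableSet[cellSigma J] {ω | Accepted O S m j B ω b} := by
  rw [setOf_accepted]
  exact Finset.measurableSet_biUnion _ fun l _ => measurableSet_acceptedAs hJ l

/-- None of the first `t` proposals is accepted. -/
def NoneAccepted (O : Finset (Fin n) → Fin n → ℝ) (S : Finset (Fin n)) (m j W : ℕ) (B : ℝ)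
    (b t : ℕ) : Set Tape :=
  ⋂ t' ∈ Finset.range t, {ω | Accepted O S m j B ω (b + t' * W)}ᶜ

theorem mul_add_lt_of_lt {t' t W i : ℕ} (h : t' < t) (hi : i < W) : t' * W + i < t * W := by
  calc t' * W + i < (t' + 1) * W := by rw [Nat.succ_mul]; omega
    _ ≤ t * W := Nat.mul_le_mul_right _ h

theorem measurableSet_noneAccepted {J : Set ℕ} {b t : ℕ} (hW : j < W)
    (hJ : ∀ i < t * W, b + i ∈ J) :
    MeasurableSet[cellSigma J] (NoneAccepted O S m j W B b t) := by
  refine Finset.measurableSet_biInter _ fun t' ht' => (measurableSet_accepted fun i hi => ?_).compl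
  have := mul_add_lt_of_lt (Finset.mem_range.1 ht') (show i < W by omega)
  rw [add_assoc]
  exact hJ _ this

theorem round_eq_of_first {ω : Tape} {b t : ℕ} (ht : t < T) {l : List (Fin n)}
    (h1 : ω ∈ NoneAccepted O S m j W B b t) (h2 : ω ∈ AcceptedAs O S m j B (b + t * W) l) :
    round O m j T W B ω b S = S ∪ l.toFinset := by
  classical
  have hl : draws O S m ω (b + t * W) j = l := h2.1
  have hacc : Accepted O S m j B ω (b + t * W) := by
    have := h2.2
    rw [← hl] at this
    exact this
  have hex : ∃ t, t < T ∧ Accepted O S m j B ω (b + t * W) := ⟨t, ht, hacc⟩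
  have hfind : Nat.find hex = t := by
    rw [Nat.find_eq_iff]
    refine ⟨⟨ht, hacc⟩, fun t' ht' h => ?_⟩
    simp only [NoneAccepted, Set.mem_iInter, Finset.mem_range, Set.mem_compl_iff] at h1
    exact h1 t' ht' h.2
  rw [round, dif_pos hex, hfind, hl]

theorem measurableSet_round {J : Set ℕ} {b : ℕ} (hW : j < W) (hJ : ∀ i < T * W, b + i ∈ J)
    (S' : Finset (Fin n)) :
    MeasurableSet[cellSigma J] {ω | round O m j T W B ω b S = S'} := by
  classical
  have : {ω | round O m j T W B ω b S = S'} =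
      (⋃ t ∈ Finset.range T, ⋃ l ∈ tuples n j, ((NoneAccepted O S m j W B b t ∩
        AcceptedAs O S m j B (b + t * W) l) ∩ {_ω : Tape | S ∪ l.toFinset = S'})) ∪
      (NoneAccepted O S m j W B b T ∩ {_ω : Tape | S = S'}) := by
    ext ω
    by_cases hex : ∃ t, t < T ∧ Accepted O S m j B ω (b + t * W)
    · have hN : ω ∉ NoneAccepted O S m j W B b T := by
        obtain ⟨t, ht, h⟩ := hex
        simp only [NoneAccepted, Set.mem_iInter, Finset.mem_range, Set.mem_compl_iff]
        exact fun h' => h' t ht h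
      constructor
      · intro h
        left
        have hsp := Nat.find_spec hex
        have h1 : ω ∈ NoneAccepted O S m j W B b (Nat.find hex) := by
          simp only [NoneAccepted, Set.mem_iInter, Finset.mem_range, Set.mem_compl_iff]
          exact fun t' ht' h' => Nat.find_min hex ht' ⟨ht'.trans hsp.1, h'⟩
        have h2 : ω ∈ AcceptedAs O S m j B (b + Nat.find hex * W)
            (draws O S m ω (b + Nat.find hex * W) j) := ⟨rfl, hsp.2⟩
        simp only [Set.mem_iUnion, Finset.mem_range]
        refine ⟨_, hsp.1, _, mem_tuples.2 (length_draws O S m ω _ j), ⟨h1, h2⟩, ?_⟩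
        rw [Set.mem_ofPred_eq, round_eq_of_first hsp.1 h1 h2] at h
        exact h
      · rintro (h | h)
        · simp only [Set.mem_iUnion, Finset.mem_range] at h
          obtain ⟨t, ht, l, _, ⟨h1, h2⟩, h3⟩ := h
          rw [Set.mem_ofPred_eq, round_eq_of_first ht h1 h2]
          exact h3
        · exact absurd h.1 hN
    · have hr : round O m j T W B ω b S = S := by rw [round, dif_neg hex]
      have hN : ω ∈ NoneAccepted O S m j W B b T := by
        simp only [NoneAccepted, Set.mem_iInter, Finset.mem_range, Set.mem_compl_iff]
        exact fun t ht h => hex ⟨t, ht, h⟩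
      constructor
      · intro h
        right
        rw [Set.mem_ofPred_eq, hr] at h
        exact ⟨hN, h⟩
      · rintro (h | h)
        · simp only [Set.mem_iUnion, Finset.mem_range] at h
          obtain ⟨t, ht, l, hl, ⟨h1, h2⟩, h3⟩ := h
          refine absurd ⟨t, ht, ?_⟩ hex
          have : ω ∈ {ω | Accepted O S m j B ω (b + t * W)} := by
            rw [setOf_accepted]
            exact Set.mem_biUnion hl h2
          exact this
        · rw [Set.mem_ofPred_eq, hr]
          exact h.2
  rw [this]
  refine MeasurableSet.union (Finset.measurableSet_biUnion _ fun t ht =>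
    Finset.measurableSet_biUnion _ fun l _ => ?_) ?_
  · have ht := Finset.mem_range.1 ht
    refine MeasurableSet.inter (MeasurableSet.inter ?_ ?_) (MeasurableSet.const _)
    · exact measurableSet_noneAccepted hW fun i hi =>
        hJ i (hi.trans_le (Nat.mul_le_mul_right _ ht.le))
    · refine measurableSet_acceptedAs (fun i hi => ?_) l
      rw [add_assoc]
      exact hJ _ (mul_add_lt_of_lt ht (by omega))
  · exact (measurableSet_noneAccepted hW hJ).inter (MeasurableSet.const _)

theorem measurableSet_rounds {ell : ℕ → ℕ} (hW : ∀ m, ell m ≤ m) (F : ℕ) (hm : m < W) (b : ℕ)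
    (S T' : Finset (Fin n)) :
    MeasurableSet[cellSigma (Set.Ici b)] {ω | rounds O ell T W B ω F m b S = T'} := by
  induction F generalizing m b S with
  | zero => exact @MeasurableSet.const _ (cellSigma (Set.Ici b)) (S = T')
  | succ F ih =>
    by_cases hm0 : m = 0
    · simp only [rounds, hm0, if_true]
      exact MeasurableSet.const _
    · have : {ω | rounds O ell T W B ω (F + 1) m b S = T'} = ⋃ S' : Finset (Fin n),
          {ω | round O m (ell m) T W B ω b S = S'} ∩
            {ω | rounds O ell T W B ω F (m - ell m) (b + T * W) S' = T'} := by
        ext ω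
        simp only [rounds, hm0, if_false, Set.mem_ofPred_eq, Set.mem_iUnion, Set.mem_inter_iff,
          exists_eq_left']
      rw [this]
      refine MeasurableSet.iUnion fun S' => MeasurableSet.inter ?_ ?_
      · exact measurableSet_round (by have := hW m; omega) (fun i _ => by simp) S'
      · exact cellSigma_mono (Set.Ici_subset_Ici.2 (by omega)) _ (ih (by omega) _ _)

end Round

section RoundLaw

variable {n : ℕ} [NeZero n] {k : ℕ} {μ : Finset (Fin n) → ℝ} {O : Finset (Fin n) → Fin n → ℝ}
  {S : Finset (Fin n)} {m j T W : ℕ} {B : ℝ}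

theorem disjoint_Iio_Ici (b : ℕ) : Disjoint (Set.Iio b) (Set.Ici b) :=
  Set.disjoint_left.2 fun _ h h' => (not_le.2 (Set.mem_Iio.1 h)) h'

theorem tapeLaw_real_draws (hμ : IsWeight n k μ) (hO : IsMarginalOracle μ O)
    (hS : 0 < superWeight μ S) (hm : S.card + m = k) (hm0 : 0 < m) {b : ℕ} {A : Set Tape}
    (hA : MeasurableSet[cellSigma (Set.Iio b)] A) {l : List (Fin n)} (hl : l.length = j) :
    tapeLaw.real (A ∩ {ω | draws O S m ω b j = l}) = tapeLaw.real A * prodProb k μ S l := by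
  induction j generalizing l with
  | zero =>
    rw [List.length_eq_zero_iff] at hl
    simp [hl, draws, prodProb]
  | succ j ih =>
    cases l with
    | nil => simp at hl
    | cons i l =>
      have e : A ∩ {ω | draws O S m ω b (j + 1) = i :: l} =
          (A ∩ {ω | draws O S m ω b j = l}) ∩ {ω | ω (b + j) ∈
            {u : unitInterval | pick O S m u = i}} := by
        ext ω
        simp only [draws, List.cons.injEq, Set.mem_inter_iff, Set.mem_ofPred_eq]
        tauto
      rw [e, tapeLaw_real_inter (disjoint_Iio_Ici (b + j)), ih (by simpa using hl),
        tapeLaw_real_cell _ (measurableSet_pick O S m i), volume_pick hμ hO hS hm hm0, prodProb,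
        mul_assoc]
      · exact (cellSigma_mono (Set.Iio_subset_Iio (by omega)) _ hA).inter
          (measurableSet_draws (fun i hi => by simp [hi]) l)
      · exact measurable_cell (by simp) (measurableSet_pick O S m i)

theorem tapeLaw_real_acceptedAs (hμ : IsWeight n k μ) (hO : IsMarginalOracle μ O)
    (hS : 0 < superWeight μ S) (hm : S.card + m = k) (hm0 : 0 < m) (hB : 0 < B) (hj : j ≤ m)
    {b : ℕ} {A : Set Tape} (hA : MeasurableSet[cellSigma (Set.Iio b)] A) {l : List (Fin n)}
    (hl : l.length = j) :
    tapeLaw.real (A ∩ AcceptedAs O S m j B b l) =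
      tapeLaw.real A * min (prodProb k μ S l) (seqProb k μ S l / B) := by
  have hms : MeasurableSet {u : unitInterval | (u : ℝ) * B < ratio O S m l} :=
    measurableSet_lt (measurable_subtype_coe.mul_const _) measurable_const
  have e : A ∩ AcceptedAs O S m j B b l = (A ∩ {ω | draws O S m ω b j = l}) ∩
      {ω | ω (b + j) ∈ {u : unitInterval | (u : ℝ) * B < ratio O S m l}} := by
    rw [AcceptedAs, Set.inter_assoc]
    rfl
  rw [e, tapeLaw_real_inter (disjoint_Iio_Ici (b + j)),
    tapeLaw_real_draws hμ hO hS hm hm0 hA hl, tapeLaw_real_cell _ hms, volume_mul_lt hB, mul_assoc]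
  · congr 1
    have h1 := ratio_mul_prodProb hμ hO hS hm (l := l) (by omega)
    have hp := hμ.prodProb_nonneg (S := S) l
    rw [mul_min_of_nonneg _ _ hp, mul_one, mul_max_of_nonneg _ _ hp, mul_zero, ← h1, mul_div_assoc',
      mul_comm (ratio O S m l)]
    rw [max_eq_right]
    rw [mul_comm, h1]
    exact div_nonneg (hμ.seqProb_nonneg l) hB.le
  · exact (cellSigma_mono (Set.Iio_subset_Iio (by omega)) _ hA).inter
      (measurableSet_draws (fun i hi => by simp [hi]) l)
  · exact measurable_cell (by simp) hms

theorem le_tapeLaw_real_noneAccepted (hμ : IsWeight n k μ) (hO : IsMarginalOracle μ O)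
    (hS : 0 < superWeight μ S) (hm : S.card + m = k) (hm0 : 0 < m) (hB : 1 ≤ B) (hj : j ≤ m)
    (hW : j < W) (b t : ℕ) :
    (1 - 1 / B) ^ t ≤ tapeLaw.real (NoneAccepted O S m j W B b t) := by
  have hB0 : 0 < B := by linarith
  induction t with
  | zero => simp [NoneAccepted]
  | succ t ih =>
    have hN : MeasurableSet[cellSigma (Set.Iio (b + t * W))] (NoneAccepted O S m j W B b t) :=
      measurableSet_noneAccepted hW fun i hi => by simp [hi]
    have hcov : NoneAccepted O S m j W B b t ⊆ NoneAccepted O S m j W B b (t + 1) ∪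
        ⋃ l ∈ tuples n j, (NoneAccepted O S m j W B b t ∩
          AcceptedAs O S m j B (b + t * W) l) := by
      intro ω hω
      by_cases h : Accepted O S m j B ω (b + t * W)
      · right
        have : ω ∈ {ω | Accepted O S m j B ω (b + t * W)} := h
        rw [setOf_accepted] at this
        simp only [Set.mem_iUnion] at this ⊢
        obtain ⟨l, hl, h'⟩ := this
        exact ⟨l, hl, hω, h'⟩
      · left
        simp only [NoneAccepted, Set.mem_iInter, Finset.mem_range, Set.mem_compl_iff] at hω ⊢
        intro t' ht'
        rcases Nat.lt_succ_iff_lt_or_eq.1 ht' with h' | rfl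
        · exact hω t' h'
        · exact h
    have h1 := (measureReal_mono (μ := tapeLaw) hcov).trans (measureReal_union_le _ _)
    have h2 := measureReal_biUnion_finset_le (μ := tapeLaw) (tuples n j) (fun l =>
      NoneAccepted O S m j W B b t ∩ AcceptedAs O S m j B (b + t * W) l)
    have h3 : ∑ l ∈ tuples n j, tapeLaw.real (NoneAccepted O S m j W B b t ∩
        AcceptedAs O S m j B (b + t * W) l) ≤ tapeLaw.real (NoneAccepted O S m j W B b t) / B := by
      calc _ = ∑ l ∈ tuples n j, tapeLaw.real (NoneAccepted O S m j W B b t) *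
            min (prodProb k μ S l) (seqProb k μ S l / B) :=
            Finset.sum_congr rfl fun l hl => tapeLaw_real_acceptedAs hμ hO hS hm hm0 hB0 hj hN
              (mem_tuples.1 hl)
        _ ≤ ∑ l ∈ tuples n j, tapeLaw.real (NoneAccepted O S m j W B b t) *
            (seqProb k μ S l / B) := Finset.sum_le_sum fun l _ =>
              mul_le_mul_of_nonneg_left (min_le_right _ _) measureReal_nonneg
        _ = _ := by
            rw [← Finset.mul_sum, ← Finset.sum_div, hμ.sum_seqProb hS j (by omega)]
            ring
    have hB1 : 0 ≤ 1 - 1 / B := sub_nonneg.2 ((div_le_one hB0).2 hB)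
    rw [pow_succ]
    have := mul_le_mul_of_nonneg_right ih hB1
    have e : tapeLaw.real (NoneAccepted O S m j W B b t) * (1 - 1 / B) =
      tapeLaw.real (NoneAccepted O S m j W B b t) -
        tapeLaw.real (NoneAccepted O S m j W B b t) / B := by ring
    linarith

/-- The probability with which a round is guaranteed to add the sequence `l`. -/
noncomputable def addProb (k : ℕ) (μ : Finset (Fin n) → ℝ) (S : Finset (Fin n)) (B : ℝ) (T : ℕ)
    (l : List (Fin n)) : ℝ :=
  min (seqProb k μ S l) (B * prodProb k μ S l) * (1 - (1 - 1 / B) ^ T)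

theorem sum_addProb_mul_le (hμ : IsWeight n k μ) (hO : IsMarginalOracle μ O)
    (hS : 0 < superWeight μ S) (hm : S.card + m = k) (hm0 : 0 < m) (hB : 1 ≤ B) (hj : j ≤ m)
    (hW : j < W) (b : ℕ) (E : Finset (Fin n) → Set Tape)
    (hE : ∀ S, MeasurableSet[cellSigma (Set.Ici (b + T * W))] (E S)) :
    ∑ l ∈ tuples n j, addProb k μ S B T l * tapeLaw.real (E (S ∪ l.toFinset)) ≤
      tapeLaw.real {ω | ω ∈ E (round O m j T W B ω b S)} := by
  have hB0 : 0 < B := by linarith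
  have hN : ∀ t, MeasurableSet[cellSigma (Set.Iio (b + t * W))] (NoneAccepted O S m j W B b t) :=
    fun t => measurableSet_noneAccepted hW fun i hi => by simp [hi]
  set G : ℕ × List (Fin n) → Set Tape := fun x => (NoneAccepted O S m j W B b x.1 ∩
    AcceptedAs O S m j B (b + x.1 * W) x.2) ∩ E (S ∪ x.2.toFinset) with hG
  have hGpast : ∀ x ∈ Finset.range T ×ˢ tuples n j, MeasurableSet[cellSigma (Set.Iio (b + T * W))]
      (NoneAccepted O S m j W B b x.1 ∩ AcceptedAs O S m j B (b + x.1 * W) x.2) := by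
    intro x hx
    have ht := Finset.mem_range.1 (Finset.mem_product.1 hx).1
    have := Nat.mul_le_mul_right W ht.le
    refine (cellSigma_mono (Set.Iio_subset_Iio (by omega)) _ (hN x.1)).inter
      (measurableSet_acceptedAs (fun i hi => ?_) _)
    have := mul_add_lt_of_lt ht (show i < W by omega)
    simp only [Set.mem_Iio]
    omega
  have hGm : ∀ x ∈ Finset.range T ×ˢ tuples n j, MeasurableSet (G x) := fun x hx =>
    (cellSigma_le _ _ (hGpast x hx)).inter (cellSigma_le _ _ (hE _))
  have hdisj : Set.PairwiseDisjoint (↑(Finset.range T ×ˢ tuples n j)) G := by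
    have aux : ∀ x y : ℕ × List (Fin n), y ∈ Finset.range T ×ˢ tuples n j → ∀ ω, ω ∈ G x →
        ω ∈ G y → ¬ y.1 < x.1 := by
      intro x y hy ω hx hy' hlt
      have h1 := hx.1.1
      simp only [NoneAccepted, Set.mem_iInter, Finset.mem_range, Set.mem_compl_iff] at h1
      refine h1 y.1 hlt ?_
      rw [setOf_accepted]
      exact Set.mem_biUnion (Finset.mem_product.1 hy).2 hy'.1.2
    intro x hx y hy hxy
    refine Set.disjoint_left.2 fun ω h1 h2 => hxy ?_
    have e1 : x.1 = y.1 := le_antisymm (not_lt.1 (aux x y hy ω h1 h2))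
      (not_lt.1 (aux y x hx ω h2 h1))
    refine Prod.ext e1 ?_
    have e2 : draws O S m ω (b + x.1 * W) j = x.2 := h1.1.2.1
    have e3 : draws O S m ω (b + y.1 * W) j = y.2 := h2.1.2.1
    rw [← e2, ← e3, e1]
  have hsub : (⋃ x ∈ Finset.range T ×ˢ tuples n j, G x) ⊆
      {ω | ω ∈ E (round O m j T W B ω b S)} := by
    intro ω hω
    simp only [Set.mem_iUnion] at hω
    obtain ⟨x, hx, hω⟩ := hω
    rw [Set.mem_ofPred_eq, round_eq_of_first (Finset.mem_range.1 (Finset.mem_product.1 hx).1)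
      hω.1.1 hω.1.2]
    exact hω.2
  refine le_trans ?_ (measureReal_mono hsub)
  rw [measureReal_biUnion_finset hdisj hGm, Finset.sum_product_right]
  refine Finset.sum_le_sum fun l hl => ?_
  have hterm : ∀ t ∈ Finset.range T, (1 - 1 / B) ^ t * min (prodProb k μ S l) (seqProb k μ S l / B) *
      tapeLaw.real (E (S ∪ l.toFinset)) ≤ tapeLaw.real (G (t, l)) := by
    intro t ht
    rw [hG]
    simp only
    rw [tapeLaw_real_inter (disjoint_Iio_Ici (b + T * W)) (hGpast (t, l)
      (Finset.mem_product.2 ⟨ht, hl⟩)) (hE _),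
      tapeLaw_real_acceptedAs hμ hO hS hm hm0 hB0 hj (hN t) (mem_tuples.1 hl)]
    refine mul_le_mul_of_nonneg_right (mul_le_mul_of_nonneg_right
      (le_tapeLaw_real_noneAccepted hμ hO hS hm hm0 hB hj hW b t) ?_) measureReal_nonneg
    exact le_min (hμ.prodProb_nonneg l) (div_nonneg (hμ.seqProb_nonneg l) hB0.le)
  refine le_trans (le_of_eq ?_) (Finset.sum_le_sum hterm)
  rw [← Finset.sum_mul, ← Finset.sum_mul, addProb]
  congr 1
  have hgeom : ∑ t ∈ Finset.range T, (1 - 1 / B) ^ t = B * (1 - (1 - 1 / B) ^ T) := by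
    have := mul_neg_geom_sum (1 - 1 / B) T
    rw [sub_sub_cancel] at this
    rw [← this]
    field_simp
  rw [hgeom]
  have : min (seqProb k μ S l) (B * prodProb k μ S l) =
      B * min (prodProb k μ S l) (seqProb k μ S l / B) := by
    rw [mul_min_of_nonneg _ _ hB0.le, mul_div_cancel₀ _ hB0.ne', min_comm]
  rw [this]
  ring

end RoundLaw

section TotalVariation

theorem tvDist_le_of_sum_eq {ι : Type*} [Fintype ι] {p q : ι → ℝ} {δ : ℝ}
    (hp : ∑ i, p i = 1) (hq : ∑ i, q i = 1) (h : ∑ i, max 0 (q i - p i) ≤ δ) :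
    tvDist p q ≤ δ := by
  unfold tvDist
  have : ∀ i, |p i - q i| = 2 * max 0 (q i - p i) + (p i - q i) := by
    intro i
    rcases le_total (q i) (p i) with h | h
    · rw [abs_of_nonneg (by linarith), max_eq_left (by linarith)]
      ring
    · rw [abs_of_nonpos (by linarith), max_eq_right (by linarith)]
      ring
  simp_rw [this]
  rw [Finset.sum_add_distrib, ← Finset.mul_sum, Finset.sum_sub_distrib, hp, hq]
  linarith

variable {n : ℕ} {k : ℕ} {μ : Finset (Fin n) → ℝ} {O : Finset (Fin n) → Fin n → ℝ}
  {T W : ℕ} {B : ℝ}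

/-- The conditional probability of `T' = T` given `S ⊆ T`. -/
noncomputable def condProb (μ : Finset (Fin n) → ℝ) (S T' : Finset (Fin n)) : ℝ :=
  condMean μ S fun T => if T = T' then 1 else 0

theorem condProb_eq (μ : Finset (Fin n) → ℝ) (S T' : Finset (Fin n)) :
    condProb μ S T' = if S ⊆ T' then μ T' / superWeight μ S else 0 := by
  unfold condProb condMean
  simp [ite_div]

theorem condProb_nonneg (hμ : IsWeight n k μ) (S T' : Finset (Fin n)) : 0 ≤ condProb μ S T' := by
  rw [condProb_eq]
  split_ifs
  · exact div_nonneg (hμ.nonneg _) (hμ.superWeight_nonneg _)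
  · exact le_rfl

theorem sum_condProb {S : Finset (Fin n)} (hS : 0 < superWeight μ S) :
    ∑ T', condProb μ S T' = 1 := by
  simp_rw [condProb_eq]
  rw [← Finset.sum_filter, ← Finset.sum_div]
  exact div_self hS.ne'

theorem condProb_full (hμ : IsWeight n k μ) {S : Finset (Fin n)} (hS : 0 < superWeight μ S)
    (hk : S.card = k) (T' : Finset (Fin n)) : condProb μ S T' = if S = T' then 1 else 0 := by
  have h0 : ∀ T', S ≠ T' → condProb μ S T' = 0 := by
    intro T' hT
    rw [condProb_eq]
    split_ifs with h
    · have : T'.card ≠ k := by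
        have := Finset.card_lt_card (h.ssubset_of_ne hT)
        omega
      rw [hμ.supp _ this, zero_div]
    · rfl
  split_ifs with h
  · subst h
    rw [← sum_condProb hS, Finset.sum_eq_single S (fun T' _ h => h0 T' h.symm) (by simp)]
  · exact h0 T' h

variable [NeZero n]

/-- The law of the set produced by the rounds, if each round is accurate up to `δ`. -/
theorem sum_max_condProb_sub_le (hμ : IsWeight n k μ) (hO : IsMarginalOracle μ O) (hB : 1 ≤ B)
    {ell : ℕ → ℕ} (hell : ∀ m, ell m ≤ m) (hell1 : ∀ m, 0 < m → 1 ≤ ell m) (hW : k < W) {δ : ℝ}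
    (hδ : ∀ S m, S.card + m = k → 0 < m → 0 < superWeight μ S →
      ∑ l ∈ tuples n (ell m), (seqProb k μ S l - addProb k μ S B T l) ≤ δ)
    (F m b : ℕ) (hF : m ≤ F) (S : Finset (Fin n)) (hm : S.card + m = k)
    (hS : 0 < superWeight μ S) :
    ∑ T', max 0 (condProb μ S T' - tapeLaw.real {ω | rounds O ell T W B ω F m b S = T'}) ≤
      m * δ := by
  induction F generalizing m b S with
  | zero =>
    obtain rfl : m = 0 := by omega
    simp only [rounds, Nat.cast_zero, zero_mul]
    refine (Finset.sum_eq_zero fun T' _ => ?_).le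
    rw [condProb_full hμ hS (by omega)]
    by_cases h : S = T' <;> simp [h]
  | succ F ih =>
    rcases Nat.eq_zero_or_pos m with rfl | hm0
    · simp only [rounds, if_true, Nat.cast_zero, zero_mul]
      refine (Finset.sum_eq_zero fun T' _ => ?_).le
      rw [condProb_full hμ hS (by omega)]
      by_cases h : S = T' <;> simp [h]
    set j := ell m with hj
    have hjm : j ≤ m := hell m
    have hj1 : 1 ≤ j := hell1 m hm0
    set p : Finset (Fin n) → Finset (Fin n) → ℝ := fun S' T' =>
      tapeLaw.real {ω | rounds O ell T W B ω F (m - j) (b + T * W) S' = T'} with hp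
    have hstep : ∀ T', ∑ l ∈ tuples n j, addProb k μ S B T l * p (S ∪ l.toFinset) T' ≤
        tapeLaw.real {ω | rounds O ell T W B ω (F + 1) m b S = T'} := by
      intro T'
      have h1 := sum_addProb_mul_le hμ hO hS hm hm0 hB hjm (T := T) (W := W) (by omega) b
        (fun S' => {ω | rounds O ell T W B ω F (m - j) (b + T * W) S' = T'})
        (fun S' => measurableSet_rounds hell F (by omega) _ _ _)
      refine h1.trans (le_of_eq ?_)
      simp only [rounds, hm0.ne', if_false]
      rfl
    have hpow : 0 ≤ (1 - 1 / B) ^ T ∧ (1 - 1 / B) ^ T ≤ 1 := by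
      have h0 : 0 ≤ 1 - 1 / B := sub_nonneg.2 ((div_le_one (by linarith)).2 hB)
      have h1 : 1 - 1 / B ≤ 1 := by
        have : 0 ≤ 1 / B := by positivity
        linarith
      exact ⟨pow_nonneg h0 _, pow_le_one₀ h0 h1⟩
    have hg : ∀ l, 0 ≤ addProb k μ S B T l ∧ addProb k μ S B T l ≤ seqProb k μ S l := by
      intro l
      have h0 : 0 ≤ min (seqProb k μ S l) (B * prodProb k μ S l) :=
        le_min (hμ.seqProb_nonneg l) (mul_nonneg (by linarith) (hμ.prodProb_nonneg l))
      refine ⟨mul_nonneg h0 (by linarith), ?_⟩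
      exact (mul_le_of_le_one_right h0 (by linarith)).trans (min_le_left _ _)
    have key : ∀ T', max 0 (condProb μ S T' -
        tapeLaw.real {ω | rounds O ell T W B ω (F + 1) m b S = T'}) ≤
        ∑ l ∈ tuples n j, ((seqProb k μ S l - addProb k μ S B T l) *
          condProb μ (S ∪ l.toFinset) T' + seqProb k μ S l *
          max 0 (condProb μ (S ∪ l.toFinset) T' - p (S ∪ l.toFinset) T')) := by
      intro T'
      refine max_le (Finset.sum_nonneg fun l _ => add_nonneg (mul_nonneg (sub_nonneg.2 (hg l).2)
        (condProb_nonneg hμ _ _)) (mul_nonneg (hμ.seqProb_nonneg l) (le_max_left _ _))) ?_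
      have h1 := hstep T'
      have h2 : condProb μ S T' =
          ∑ l ∈ tuples n j, seqProb k μ S l * condProb μ (S ∪ l.toFinset) T' :=
        (hμ.sum_seqProb_mul_condMean hS _ j (by omega)).symm
      rw [h2]
      refine (sub_le_sub_left h1 _).trans ?_
      rw [← Finset.sum_sub_distrib]
      refine Finset.sum_le_sum fun l _ => ?_
      have h3 : addProb k μ S B T l * (condProb μ (S ∪ l.toFinset) T' - p (S ∪ l.toFinset) T') ≤
          seqProb k μ S l * max 0 (condProb μ (S ∪ l.toFinset) T' - p (S ∪ l.toFinset) T') :=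
        (mul_le_mul_of_nonneg_left (le_max_right _ _) (hg l).1).trans
          (mul_le_mul_of_nonneg_right (hg l).2 (le_max_left _ _))
      linarith
    refine (Finset.sum_le_sum fun T' _ => key T').trans ?_
    rw [Finset.sum_comm]
    have hterm : ∀ l ∈ tuples n j, ∑ T', ((seqProb k μ S l - addProb k μ S B T l) *
          condProb μ (S ∪ l.toFinset) T' + seqProb k μ S l *
          max 0 (condProb μ (S ∪ l.toFinset) T' - p (S ∪ l.toFinset) T')) ≤
        (seqProb k μ S l - addProb k μ S B T l) + seqProb k μ S l * (((m - j : ℕ) : ℝ) * δ) := by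
      intro l hl
      rw [mem_tuples] at hl
      by_cases h0 : seqProb k μ S l = 0
      · have : addProb k μ S B T l = 0 := le_antisymm (h0 ▸ (hg l).2) (hg l).1
        simp [h0, this]
      obtain ⟨hS', hcard⟩ := hμ.seqProb_ne_zero hS h0
      rw [Finset.sum_add_distrib, ← Finset.mul_sum, ← Finset.mul_sum, sum_condProb hS', mul_one]
      exact add_le_add_right (mul_le_mul_of_nonneg_left (ih (m - j) (b + T * W) (by omega) _
        (by omega) hS') (hμ.seqProb_nonneg l)) _
    refine (Finset.sum_le_sum hterm).trans ?_
    rw [Finset.sum_add_distrib, ← Finset.sum_mul, hμ.sum_seqProb hS j (by omega), one_mul]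
    have h1 := hδ S m hm hm0 hS
    have hδ0 : 0 ≤ δ := (Finset.sum_nonneg fun l _ => sub_nonneg.2 (hg l).2).trans h1
    rw [Nat.cast_sub hjm]
    have : (1 : ℝ) ≤ j := by exact_mod_cast hj1
    nlinarith

theorem tvDist_rounds_le (hμ : IsWeight n k μ) (hO : IsMarginalOracle μ O) (hB : 1 ≤ B)
    {ell : ℕ → ℕ} (hell : ∀ m, ell m ≤ m) (hell1 : ∀ m, 0 < m → 1 ≤ ell m) (hW : k < W) {δ : ℝ}
    (hδ : ∀ S m, S.card + m = k → 0 < m → 0 < superWeight μ S →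
      ∑ l ∈ tuples n (ell m), (seqProb k μ S l - addProb k μ S B T l) ≤ δ) (b : ℕ) :
    tvDist (fun S => tapeLaw.real ((fun ω => rounds O ell T W B ω k k b ∅) ⁻¹' {S}))
      (condDist μ ∅) ≤ k * δ := by
  have hcond : ∀ T', condDist μ ∅ T' = condProb μ ∅ T' := by
    intro T'
    simp [condDist, condProb_eq]
  have hmeas : ∀ S, MeasurableSet ((fun ω => rounds O ell T W B ω k k b ∅) ⁻¹' {S}) := fun S =>
    cellSigma_le _ _ (measurableSet_rounds hell k hW b ∅ S)
  refine tvDist_le_of_sum_eq ?_ ?_ ?_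
  · have := measureReal_biUnion_finset (μ := tapeLaw) (s := (Finset.univ : Finset (Finset (Fin n))))
      (f := fun S => (fun ω => rounds O ell T W B ω k k b ∅) ⁻¹' {S}) ?_ fun S _ => hmeas S
    · rw [← this]
      have hu : (⋃ S ∈ (Finset.univ : Finset (Finset (Fin n))),
          (fun ω => rounds O ell T W B ω k k b ∅) ⁻¹' {S}) = Set.univ := by
        ext ω
        simp
      rw [hu]
      exact probReal_univ
    · intro S _ S' _ h
      exact Set.disjoint_left.2 fun ω h1 h2 => h (h1.symm.trans h2)
  · simp_rw [hcond]
    exact sum_condProb hμ.superWeight_empty_pos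
  · simp_rw [hcond]
    exact sum_max_condProb_sub_le hμ hO hB hell hell1 hW hδ k k b le_rfl ∅ (by simp)
      hμ.superWeight_empty_pos

end TotalVariation

section Parameters

variable {n k : ℕ} {μ : Finset (Fin n) → ℝ}

theorem one_sub_inv_pow_le {B : ℝ} (hB : 1 ≤ B) (T : ℕ) {x : ℝ} (hx : 0 < x) (hT : B * x ≤ T) :
    (1 - 1 / B) ^ T ≤ x⁻¹ := by
  have hB0 : 0 < B := by linarith
  have h1 : 1 - 1 / B ≤ Real.exp (-(1 / B)) := Real.one_sub_le_exp_neg _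
  have h0 : 0 ≤ 1 - 1 / B := sub_nonneg.2 ((div_le_one hB0).2 hB)
  calc (1 - 1 / B) ^ T ≤ Real.exp (-(1 / B)) ^ T := pow_le_pow_left₀ h0 h1 T
    _ = (Real.exp (T / B))⁻¹ := by rw [← Real.exp_nat_mul, ← Real.exp_neg]; ring_nf
    _ ≤ x⁻¹ := by
      refine inv_anti₀ hx ?_
      have h2 : x ≤ T / B := by rw [le_div_iff₀ hB0]; linarith
      linarith [Real.add_one_le_exp (T / B : ℝ)]

theorem two_mul_le_of_sq_le {g f m : ℕ} (hg : 1 ≤ g) (h : (2 * g * f) ^ 2 ≤ m) : 2 * f ≤ m := by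
  refine le_trans ?_ h
  calc 2 * f ≤ 2 * g * f := Nat.mul_le_mul_right _ (by omega)
    _ ≤ (2 * g * f) ^ 2 := Nat.le_self_pow two_ne_zero _

theorem succ_le_of_sq_le {g f m : ℕ} (hg : 1 ≤ g) (hm : 0 < m) (h : (2 * g * f) ^ 2 ≤ m) :
    f + 1 ≤ m := by
  have := two_mul_le_of_sq_le hg h
  omega

theorem exponent_le {α e q Λ m f L : ℝ} (hα : 0 < α) (hα1 : α ≤ 1) (he : 0 ≤ e) (hq : 2 ≤ q)
    (hΛ : 1 ≤ Λ) (hm : 0 < m) (hL : L ≤ 6 * Λ)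
    (hfm : (2 * (q * Λ) * f) ^ 2 ≤ m) {s : ℝ} (hs : s ≤ f ^ 2) (hs0 : 0 ≤ s) :
    e * (1 + q) * ((2 * L / α + 2) / m) * s ≤ 4 / α * e := by
  have h1 : 2 * L / α + 2 ≤ 14 * Λ / α := by
    rw [div_add' _ _ _ hα.ne']
    refine div_le_div_of_nonneg_right ?_ hα.le
    nlinarith
  have h2 : f ^ 2 ≤ m / (4 * q ^ 2 * Λ ^ 2) := by
    rw [le_div_iff₀ (by positivity)]
    linarith [show (2 * (q * Λ) * f) ^ 2 = f ^ 2 * (4 * q ^ 2 * Λ ^ 2) by ring]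
  have h3 : (2 * L / α + 2) / m * s ≤ (14 * Λ / α) / m * (m / (4 * q ^ 2 * Λ ^ 2)) := by
    refine (mul_le_mul_of_nonneg_right (div_le_div_of_nonneg_right h1 hm.le) hs0).trans ?_
    exact mul_le_mul_of_nonneg_left (hs.trans h2) (by positivity)
  have h4 : (14 * Λ / α) / m * (m / (4 * q ^ 2 * Λ ^ 2)) = 7 / (2 * α * q ^ 2 * Λ) := by
    field_simp
    norm_num
  rw [mul_assoc, mul_assoc, mul_comm (4 / α)]
  refine mul_le_mul_of_nonneg_left ?_ he
  rw [h4] at h3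
  refine (mul_le_mul_of_nonneg_left h3 (by linarith)).trans ?_
  rw [mul_div_assoc', div_le_div_iff₀ (by positivity) hα]
  have h5 : q ^ 2 ≤ q ^ 2 * Λ := le_mul_of_one_le_right (by positivity) hΛ
  have h6 : (1 + q) * 7 ≤ 8 * (q ^ 2 * Λ) := by nlinarith
  nlinarith

set_option maxHeartbeats 1000000 in
/-- A round is accurate up to `ε / k` for the parameters used by the algorithm. -/
theorem sum_seqProb_sub_addProb_le (hμ : IsWeight n k μ) {α ε : ℝ} (hα : 0 < α) (hα1 : α ≤ 1)
    (hE : AllCondEntropicallyIndependent α k μ) (hk : 1 ≤ k) (hε : 0 < ε) (hε1 : ε < 1)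
    {w Λ q N A f m : ℕ} (hw : w = 2 ^ Λ) (hΛ : 1 ≤ Λ) (hq : 2 ≤ q) (hqw : q ≤ w)
    (hqN : (k : ℝ) ≤ (q : ℝ) ^ N * ε) (hnw : (n : ℝ) ≤ w * ε) (hA : Real.exp (4 / α) ≤ A)
    (hf : (2 * (q * Λ) * f) ^ 2 ≤ m) {S : Finset (Fin n)} (hm : S.card + m = k) (hm0 : 0 < m)
    (hS : 0 < superWeight μ S) :
    ∑ l ∈ tuples n (f + 1), (seqProb k μ S l -
      addProb k μ S ((A * w ^ (7 * (N + 2)) : ℕ) : ℝ) (A * w ^ (7 * (N + 2)) * w ^ 3) l) ≤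
      ε / k := by
  have hqΛ : 1 ≤ q * Λ := Nat.one_le_iff_ne_zero.2 (by positivity)
  have h2f := two_mul_le_of_sq_le hqΛ hf
  have hfm := succ_le_of_sq_le hqΛ hm0 hf
  have hw2 : 2 ≤ w := by
    rw [hw]
    calc 2 = 2 ^ 1 := rfl
      _ ≤ 2 ^ Λ := Nat.pow_le_pow_right two_pos hΛ
  have hwR : (2 : ℝ) ≤ w := by exact_mod_cast hw2
  have hw0 : (0 : ℝ) < w := by linarith
  have hqR : (2 : ℝ) ≤ q := by exact_mod_cast hq
  have hq0 : (0 : ℝ) < q := by linarith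
  have hqwR : (q : ℝ) ≤ w := by exact_mod_cast hqw
  have hΛR : (1 : ℝ) ≤ Λ := by exact_mod_cast hΛ
  have hkR : (1 : ℝ) ≤ k := by exact_mod_cast hk
  have hkn : (k : ℝ) ≤ n := by
    have := hμ.card_le hS
    obtain ⟨T, hT, hT'⟩ := Finset.exists_ne_zero_of_sum_ne_zero hS.ne'
    have hc : T.card = k := by
      by_contra hc
      exact hT' (hμ.supp T hc)
    have := Finset.card_le_univ T
    rw [hc, Fintype.card_fin] at this
    exact_mod_cast this
  have hkw : (k : ℝ) ≤ w := by nlinarith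
  have hlogw : 0 < Real.log w := Real.log_pos (by linarith)
  have hlogw' : Real.log w ≤ Λ := by
    rw [hw]
    push_cast
    rw [Real.log_pow]
    nlinarith [Real.log_two_lt_d9]
  have hA1 : (1 : ℝ) ≤ A := (Real.one_le_exp (by positivity)).trans hA
  set B : ℝ := ((A * w ^ (7 * (N + 2)) : ℕ) : ℝ) with hBdef
  have hBe : B = A * (w : ℝ) ^ (7 * (N + 2)) := by rw [hBdef]; push_cast; rfl
  have hB1 : 1 ≤ B := by
    rw [hBe]
    exact one_le_mul_of_one_le_of_one_le hA1 (one_le_pow₀ (by linarith))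
  set e : ℝ := Real.log q / (7 * Real.log w) with he
  have hlogq : 0 ≤ Real.log q := Real.log_nonneg (by linarith)
  have he0 : 0 ≤ e := by positivity
  have he1 : e ≤ 1 := by
    rw [he, div_le_one (by positivity)]
    have := Real.log_le_log hq0 hqwR
    linarith
  have hwe : ((w : ℝ) ^ 7) ^ e = q := by
    rw [Real.rpow_def_of_pos (by positivity), Real.log_pow, he]
    push_cast
    rw [mul_div_cancel₀ _ (by positivity), Real.exp_log hq0]
  set θ : ℝ := ((w : ℝ) ^ 6)⁻¹ with hθ
  have hθ0 : 0 < θ := by positivity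
  have hθ1 : θ ≤ 1 := inv_le_one_of_one_le₀ (one_le_pow₀ (by linarith))
  have hQ : (2 / θ) ^ e ≤ q := by
    rw [← hwe]
    refine Real.rpow_le_rpow (by positivity) ?_ he0
    rw [hθ, div_inv_eq_mul, pow_succ' (w : ℝ) 6]
    exact mul_le_mul_of_nonneg_right hwR (by positivity)
  have htail := sum_seqProb_sub_min_le hμ hα hS hm hm0
    (by have := hE S (by omega) hS; rwa [show k - S.card = m by omega] at this)
    he0 he1 (show (1 : ℝ) ≤ q by linarith) hθ0 hθ1 hQ (show 0 < B by linarith) (f + 1)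
    (by omega) hfm
  have hT : (1 - 1 / B) ^ (A * w ^ (7 * (N + 2)) * w ^ 3) ≤ ((w : ℝ) ^ 3)⁻¹ := by
    refine one_sub_inv_pow_le hB1 _ (by positivity) (le_of_eq ?_)
    rw [hBdef]
    push_cast
    rfl
  have hpow0 : 0 ≤ (1 - 1 / B) ^ (A * w ^ (7 * (N + 2)) * w ^ 3) :=
    pow_nonneg (sub_nonneg.2 ((div_le_one (by linarith)).2 hB1)) _
  have hsplit : ∀ l, seqProb k μ S l - addProb k μ S B (A * w ^ (7 * (N + 2)) * w ^ 3) l ≤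
      (seqProb k μ S l - min (seqProb k μ S l) (B * prodProb k μ S l)) +
        seqProb k μ S l * ((w : ℝ) ^ 3)⁻¹ := by
    intro l
    have h1 : min (seqProb k μ S l) (B * prodProb k μ S l) *
        (1 - 1 / B) ^ (A * w ^ (7 * (N + 2)) * w ^ 3) ≤ seqProb k μ S l * ((w : ℝ) ^ 3)⁻¹ :=
      mul_le_mul (min_le_left _ _) hT hpow0 (hμ.seqProb_nonneg l)
    unfold addProb
    linarith
  refine (Finset.sum_le_sum fun l _ => hsplit l).trans ?_
  rw [Finset.sum_add_distrib, ← Finset.sum_mul, hμ.sum_seqProb hS (f + 1) (by omega), one_mul]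
  have hexp : B ^ (-e) * Real.exp (e * (1 + q) * ((2 * Real.log θ⁻¹ / α + 2) / m) *
      ∑ i ∈ Finset.range (f + 1), (i : ℝ)) ≤ ((q : ℝ) ^ (N + 2))⁻¹ := by
    have hsum : ∑ i ∈ Finset.range (f + 1), (i : ℝ) ≤ (f : ℝ) ^ 2 := by
      have := Finset.sum_range_id_mul_two (f + 1)
      rw [Nat.add_sub_cancel] at this
      have h2 : (∑ i ∈ Finset.range (f + 1), (i : ℝ)) * 2 = (f + 1) * f := by
        rw [← Nat.cast_sum]
        exact_mod_cast this
      have h3 : (f : ℝ) ≤ (f : ℝ) ^ 2 := by exact_mod_cast Nat.le_self_pow two_ne_zero f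
      nlinarith
    have hL : Real.log θ⁻¹ ≤ 6 * Λ := by
      rw [hθ, inv_inv, Real.log_pow]
      push_cast
      linarith
    have h1 := exponent_le hα hα1 he0 hqR hΛR (show (0 : ℝ) < m by exact_mod_cast hm0)
      hL (by exact_mod_cast hf) hsum
      (Finset.sum_nonneg fun i _ => Nat.cast_nonneg i)
    have h2 : B ^ (-e) * Real.exp (4 / α * e) ≤ ((q : ℝ) ^ (N + 2))⁻¹ := by
      have h3 : Real.exp (4 / α * e) ≤ (A : ℝ) ^ e := by
        rw [Real.exp_mul]
        exact Real.rpow_le_rpow (Real.exp_pos _).le hA he0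
      have h4 : B ^ (-e) = ((A : ℝ) ^ e)⁻¹ * ((q : ℝ) ^ (N + 2))⁻¹ := by
        rw [Real.rpow_neg (by linarith), hBe, Real.mul_rpow (by linarith) (by positivity), mul_inv,
          pow_mul, ← Real.rpow_natCast _ (N + 2), ← Real.rpow_mul (by positivity), mul_comm _ e,
          Real.rpow_mul (by positivity), hwe, Real.rpow_natCast]
      rw [h4, mul_right_comm]
      have hAe : 0 < (A : ℝ) ^ e := Real.rpow_pos_of_pos (by linarith) _
      refine mul_le_of_le_one_left (by positivity) ?_
      rw [← div_eq_inv_mul]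
      exact (div_le_one hAe).2 h3
    exact (mul_le_mul_of_nonneg_left (Real.exp_le_exp.2 h1)
      (Real.rpow_nonneg (by linarith) _)).trans h2
  have hq1 : ((q : ℝ) ^ (N + 2))⁻¹ ≤ ε / (4 * k) := by
    rw [inv_eq_one_div, div_le_div_iff₀ (by positivity) (by positivity), one_mul, pow_add]
    have h4 : (4 : ℝ) ≤ (q : ℝ) ^ 2 := by nlinarith
    have := mul_le_mul hqN h4 (by norm_num) (by positivity)
    linarith
  have hw1 : ((w : ℝ) ^ 3)⁻¹ ≤ ε / (4 * k) := by
    rw [inv_eq_one_div, div_le_div_iff₀ (by positivity) (by positivity), one_mul]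
    have h1 : (k : ℝ) ≤ w * ε := hkn.trans hnw
    have h2 : (w * ε) * 4 ≤ (w * ε) * (w : ℝ) ^ 2 :=
      mul_le_mul_of_nonneg_left (by nlinarith) (by positivity)
    calc 4 * (k : ℝ) ≤ w * ε * 4 := by linarith
      _ ≤ w * ε * (w : ℝ) ^ 2 := h2
      _ = ε * (w : ℝ) ^ 3 := by ring
  have hθ2 : n * θ + ((f + 1 : ℕ) : ℝ) * (n * θ) ≤ ε / (4 * k) := by
    have h1 : ((f + 1 : ℕ) : ℝ) ≤ k := by exact_mod_cast (hfm.trans (by omega))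
    have h2 : n * θ + ((f + 1 : ℕ) : ℝ) * (n * θ) ≤ 2 * k * (n * θ) := by
      have : 0 ≤ n * θ := by positivity
      nlinarith
    refine h2.trans ?_
    rw [le_div_iff₀ (by positivity), hθ]
    have h3 : (2 * k * (n * ((w : ℝ) ^ 6)⁻¹)) * (4 * k) = (8 * k * k * n) / (w : ℝ) ^ 6 := by
      field_simp; ring
    rw [h3, div_le_iff₀ (by positivity)]
    have h4 : (8 : ℝ) ≤ w ^ 3 := by
      calc (8 : ℝ) = 2 ^ 3 := by norm_num
        _ ≤ w ^ 3 := pow_le_pow_left₀ (by norm_num) hwR 3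
    calc (8 * k * k * n : ℝ) ≤ w ^ 3 * w * w * (w * ε) := by gcongr
      _ = ε * w ^ 6 := by ring
  have hfin : ε / (4 * k) + ε / (4 * k) + ε / (4 * k) ≤ ε / k := by
    have : ε / (4 * k) = ε / k / 4 := by rw [mul_comm, div_mul_eq_div_div]
    rw [this]
    have : 0 ≤ ε / k := by positivity
    linarith
  linarith

end Parameters

namespace NExp

/-- The first cell of an array. -/
abbrev cell (a : ℕ) : NExp := load a (const 0)

/-- Nonzero if and only if `x ≤ y`. -/
def le (x y : NExp) : NExp := sub (add y (const 1)) x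

/-- Nonzero if and only if `x < y`. -/
def lt (x y : NExp) : NExp := sub y x

/-- The power with a constant exponent. -/
def pow (x : NExp) : ℕ → NExp
  | 0 => const 1
  | e + 1 => mul (pow x e) x

@[simp] theorem eval_const (s : Mem) (p c : ℕ) : (const c).eval s p = c := rfl
@[simp] theorem eval_pid (s : Mem) (p : ℕ) : pid.eval s p = p := rfl
@[simp] theorem eval_load (s : Mem) (p a : ℕ) (i : NExp) :
    (load a i).eval s p = s.nat a (i.eval s p) := rfl
@[simp] theorem eval_add (s : Mem) (p : ℕ) (x y : NExp) :
    (add x y).eval s p = x.eval s p + y.eval s p := rfl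
@[simp] theorem eval_sub (s : Mem) (p : ℕ) (x y : NExp) :
    (sub x y).eval s p = x.eval s p - y.eval s p := rfl
@[simp] theorem eval_mul (s : Mem) (p : ℕ) (x y : NExp) :
    (mul x y).eval s p = x.eval s p * y.eval s p := rfl
@[simp] theorem eval_div (s : Mem) (p : ℕ) (x y : NExp) :
    (div x y).eval s p = x.eval s p / y.eval s p := rfl
@[simp] theorem eval_mod (s : Mem) (p : ℕ) (x y : NExp) :
    (mod x y).eval s p = x.eval s p % y.eval s p := rfl
theorem eval_ite (s : Mem) (p : ℕ) (c x y : NExp) :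
    (ite c x y).eval s p = if c.eval s p ≠ 0 then x.eval s p else y.eval s p := rfl

theorem eval_le_ne_zero (s : Mem) (p : ℕ) (x y : NExp) :
    (le x y).eval s p ≠ 0 ↔ x.eval s p ≤ y.eval s p := by
  simp only [le, eval_sub, eval_add, eval_const]
  omega

theorem eval_lt_ne_zero (s : Mem) (p : ℕ) (x y : NExp) :
    (lt x y).eval s p ≠ 0 ↔ x.eval s p < y.eval s p := by
  simp only [lt, eval_sub]
  omega

theorem eval_mul_ne_zero (s : Mem) (p : ℕ) (x y : NExp) :
    (mul x y).eval s p ≠ 0 ↔ x.eval s p ≠ 0 ∧ y.eval s p ≠ 0 := by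
  simp

@[simp] theorem eval_pow (s : Mem) (p : ℕ) (x : NExp) (e : ℕ) :
    (pow x e).eval s p = x.eval s p ^ e := by
  induction e with
  | zero => rfl
  | succ e ih => simp [pow, ih, pow_succ]

end NExp

namespace RExp

@[simp] theorem eval_ofNat (ω : Tape) (s : Mem) (p : ℕ) (x : NExp) :
    (ofNat x).eval ω s p = (x.eval s p : ℝ) := rfl
@[simp] theorem eval_load (ω : Tape) (s : Mem) (p a : ℕ) (i : NExp) :
    (load a i).eval ω s p = s.real a (i.eval s p) := rfl
@[simp] theorem eval_rand (ω : Tape) (s : Mem) (p : ℕ) (i : NExp) :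
    (rand i).eval ω s p = (ω (i.eval s p) : ℝ) := rfl
@[simp] theorem eval_add (ω : Tape) (s : Mem) (p : ℕ) (x y : RExp) :
    (add x y).eval ω s p = x.eval ω s p + y.eval ω s p := rfl
@[simp] theorem eval_sub (ω : Tape) (s : Mem) (p : ℕ) (x y : RExp) :
    (sub x y).eval ω s p = x.eval ω s p - y.eval ω s p := rfl
@[simp] theorem eval_mul (ω : Tape) (s : Mem) (p : ℕ) (x y : RExp) :
    (mul x y).eval ω s p = x.eval ω s p * y.eval ω s p := rfl
@[simp] theorem eval_div (ω : Tape) (s : Mem) (p : ℕ) (x y : RExp) :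
    (div x y).eval ω s p = x.eval ω s p / y.eval ω s p := rfl
theorem eval_ite (ω : Tape) (s : Mem) (p : ℕ) (c : NExp) (x y : RExp) :
    (ite c x y).eval ω s p = if c.eval s p ≠ 0 then x.eval ω s p else y.eval ω s p := rfl

end RExp

section Scatter

variable {β : Type}

theorem scatter_of_exclusive {w : ℕ} {idx : ℕ → ℕ} (h : Exclusive w idx) (f val : ℕ → β) {p : ℕ}
    (hp : p < w) : scatter f w idx val (idx p) = val p := by
  classical
  have hex : ∃ p', p' < w ∧ idx p' = idx p := ⟨p, hp, rfl⟩
  rw [scatter, dif_pos hex]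
  congr 1
  exact h _ _ (Nat.find_spec hex).1 hp (Nat.find_spec hex).2

theorem scatter_of_forall_ne {w : ℕ} {idx : ℕ → ℕ} (f val : ℕ → β) {i : ℕ}
    (h : ∀ p < w, idx p ≠ i) : scatter f w idx val i = f i := by
  classical
  rw [scatter, dif_neg]
  rintro ⟨p, hp, hi⟩
  exact h p hp hi

theorem exclusive_id (w : ℕ) : Exclusive w fun p => p := fun _ _ _ _ h => h

theorem exclusive_cell : Exclusive 1 fun _ => 0 := fun _ _ h h' _ => by omega

theorem scatter_id (w : ℕ) (f val : ℕ → β) :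
    scatter f w (fun p => p) val = fun i => if i < w then val i else f i := by
  funext i
  split_ifs with h
  · exact scatter_of_exclusive (exclusive_id w) f val h
  · exact scatter_of_forall_ne f val fun p hp hpi => h (hpi ▸ hp)

theorem scatter_cell (f val : ℕ → β) :
    scatter f 1 (fun _ => 0) val = Function.update f 0 (val 0) := by
  funext i
  by_cases h : i = 0
  · subst h
    rw [Function.update_self]
    exact scatter_of_exclusive exclusive_cell f val one_pos
  · rw [Function.update_of_ne h]
    exact scatter_of_forall_ne f val fun p _ hp => h hp.symm

end Scatter

/-- The setting of an execution: the oracle with its cost, the random tape, a bound `it` for the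
number of iterations of loops and a bound `mach` for the number of machines. -/
structure Setting (n : ℕ) where
  oracle : Finset (Fin n) → Fin n → ℝ
  tau : ℕ
  kappa : ℕ
  tape : Tape
  it : ℕ
  mach : ℕ

/-- An upper bound for the running time if every loop has at most `it` iterations. -/
def Prog.cost (tau it : ℕ) : Prog → ℕ
  | .setN _ width idx val => width.size + idx.size + val.size + 1
  | .setR _ width idx val => width.size + idx.size + val.size + 1
  | .setLt _ width idx x y => width.size + idx.size + x.size + y.size + 1
  | .query _ width idx _ base elt => width.size + idx.size + base.size + elt.size + 1 + tau
  | .seq P Q => P.cost tau it + Q.cost tau it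
  | .cond c P Q => c.size + (P.cost tau it + Q.cost tau it)
  | .loop c P => it * (c.size + P.cost tau it) + c.size

/-- The nesting depth of loops. -/
def Prog.depth : Prog → ℕ
  | .setN _ _ _ _ => 0
  | .setR _ _ _ _ => 0
  | .setLt _ _ _ _ _ => 0
  | .query _ _ _ _ _ _ => 0
  | .seq P Q => max P.depth Q.depth
  | .cond _ P Q => max P.depth Q.depth
  | .loop _ P => P.depth + 1

theorem Prog.exists_cost_le (P : Prog) :
    ∃ C : ℕ, ∀ tau it : ℕ, P.cost tau it ≤ C * (1 + tau) * (1 + it) ^ P.depth := by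
  induction P with
  | setN _ width idx val =>
    exact ⟨_, fun tau it => by
      simp only [cost, depth, pow_zero, mul_one]; exact Nat.le_mul_of_pos_right _ (by omega)⟩
  | setR _ width idx val =>
    exact ⟨_, fun tau it => by
      simp only [cost, depth, pow_zero, mul_one]; exact Nat.le_mul_of_pos_right _ (by omega)⟩
  | setLt _ width idx x y =>
    exact ⟨_, fun tau it => by
      simp only [cost, depth, pow_zero, mul_one]; exact Nat.le_mul_of_pos_right _ (by omega)⟩
  | query _ width idx _ base elt =>
    refine ⟨width.size + idx.size + base.size + elt.size + 1, fun tau it => ?_⟩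
    simp only [cost, depth, pow_zero, mul_one]
    nlinarith
  | seq P Q ihP ihQ =>
    obtain ⟨C, hC⟩ := ihP
    obtain ⟨C', hC'⟩ := ihQ
    refine ⟨C + C', fun tau it => ?_⟩
    have h1 : (1 + it) ^ P.depth ≤ (1 + it) ^ (max P.depth Q.depth) :=
      Nat.pow_le_pow_right (by omega) (le_max_left _ _)
    have h2 : (1 + it) ^ Q.depth ≤ (1 + it) ^ (max P.depth Q.depth) :=
      Nat.pow_le_pow_right (by omega) (le_max_right _ _)
    calc _ ≤ C * (1 + tau) * (1 + it) ^ (max P.depth Q.depth) +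
          C' * (1 + tau) * (1 + it) ^ (max P.depth Q.depth) :=
          add_le_add ((hC tau it).trans (Nat.mul_le_mul_left _ h1))
            ((hC' tau it).trans (Nat.mul_le_mul_left _ h2))
      _ = _ := by simp only [depth]; ring
  | cond c P Q ihP ihQ =>
    obtain ⟨C, hC⟩ := ihP
    obtain ⟨C', hC'⟩ := ihQ
    refine ⟨c.size + (C + C'), fun tau it => ?_⟩
    have h1 : (1 + it) ^ P.depth ≤ (1 + it) ^ (max P.depth Q.depth) :=
      Nat.pow_le_pow_right (by omega) (le_max_left _ _)
    have h2 : (1 + it) ^ Q.depth ≤ (1 + it) ^ (max P.depth Q.depth) :=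
      Nat.pow_le_pow_right (by omega) (le_max_right _ _)
    have h3 : 1 ≤ (1 + tau) * (1 + it) ^ (max P.depth Q.depth) :=
      Nat.one_le_iff_ne_zero.2 (by positivity)
    calc _ ≤ c.size * ((1 + tau) * (1 + it) ^ (max P.depth Q.depth)) +
          (C * (1 + tau) * (1 + it) ^ (max P.depth Q.depth) +
          C' * (1 + tau) * (1 + it) ^ (max P.depth Q.depth)) :=
          add_le_add (Nat.le_mul_of_pos_right _ h3)
            (add_le_add ((hC tau it).trans (Nat.mul_le_mul_left _ h1))
              ((hC' tau it).trans (Nat.mul_le_mul_left _ h2)))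
      _ = _ := by simp only [depth]; ring
  | loop c P ih =>
    obtain ⟨C, hC⟩ := ih
    refine ⟨c.size + C, fun tau it => ?_⟩
    have h3 : 1 ≤ (1 + tau) * (1 + it) ^ P.depth := Nat.one_le_iff_ne_zero.2 (by positivity)
    calc it * (c.size + P.cost tau it) + c.size
        ≤ (1 + it) * (c.size + P.cost tau it) := by nlinarith
      _ ≤ (1 + it) * (c.size * ((1 + tau) * (1 + it) ^ P.depth) +
          C * (1 + tau) * (1 + it) ^ P.depth) :=
          Nat.mul_le_mul_left _ (add_le_add (Nat.le_mul_of_pos_right _ h3) (hC tau it))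
      _ = _ := by simp only [depth]; ring

/-- The program halts in a memory with the property `Post`, within the time `P.cost` and on the
available machines. -/
def Runs {n : ℕ} (c : Setting n) (P : Prog) (s : Mem) (Post : Mem → Prop) : Prop :=
  ∃ s' t m, Exec c.oracle c.tau c.kappa c.tape P s s' t m ∧ t ≤ P.cost c.tau c.it ∧
    m ≤ c.mach ∧ Post s'

namespace Runs

variable {n : ℕ} {c : Setting n} {s : Mem} {Post : Mem → Prop}

theorem seq {P Q : Prog} (h : Runs c P s fun s' => Runs c Q s' Post) :
    Runs c (.seq P Q) s Post := by
  obtain ⟨s', t, m, h1, h2, h3, s'', t', m', h1', h2', h3', h4⟩ := h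
  exact ⟨s'', _, _, .seq h1 h1', add_le_add h2 h2', max_le h3 h3', h4⟩

theorem setN {a w : ℕ} {width idx val : NExp} (hw : width.eval s 0 = w) (hM : 1 ≤ c.mach)
    (hwM : w ≤ c.mach) (hex : Exclusive w (fun p => idx.eval s p))
    (h : ∀ s' : Mem, s'.nat = Function.update s.nat a (scatter (s.nat a) w
      (fun p => idx.eval s p) (fun p => val.eval s p)) → s'.real = s.real → Post s') :
    Runs c (.setN a width idx val) s Post := by
  subst hw
  exact ⟨_, _, _, .setN hex, le_rfl, max_le hM hwM, h _ rfl rfl⟩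

theorem setN_array {a w : ℕ} {width val : NExp} (hw : width.eval s 0 = w) (hM : 1 ≤ c.mach)
    (hwM : w ≤ c.mach)
    (h : ∀ s' : Mem, s'.nat = Function.update s.nat a
      (fun i => if i < w then val.eval s i else s.nat a i) → s'.real = s.real → Post s') :
    Runs c (.setN a width .pid val) s Post := by
  refine setN hw hM hwM (exclusive_id w) fun s' h1 h2 => h s' ?_ h2
  rw [h1, ← scatter_id]
  rfl

theorem setN_cell {a : ℕ} {val : NExp} (hM : 1 ≤ c.mach)
    (h : ∀ s' : Mem, s'.nat = Function.update s.nat a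
      (Function.update (s.nat a) 0 (val.eval s 0)) → s'.real = s.real → Post s') :
    Runs c (.setN a (.const 1) (.const 0) val) s Post := by
  refine setN rfl hM hM exclusive_cell fun s' h1 h2 => h s' ?_ h2
  rw [h1, ← scatter_cell (s.nat a) (fun p => val.eval s p)]
  rfl

theorem setR_array {a w : ℕ} {width : NExp} {val : RExp} (hw : width.eval s 0 = w)
    (hM : 1 ≤ c.mach) (hwM : w ≤ c.mach)
    (h : ∀ s' : Mem, s'.nat = s.nat → s'.real = Function.update s.real a
      (fun i => if i < w then val.eval c.tape s i else s.real a i) → Post s') :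
    Runs c (.setR a width .pid val) s Post := by
  subst hw
  refine ⟨_, _, _, .setR (exclusive_id _), le_rfl, max_le hM hwM, h _ rfl ?_⟩
  rw [← scatter_id]
  rfl

open Classical in
theorem setLt_array {a w : ℕ} {width : NExp} {x y : RExp} (hw : width.eval s 0 = w)
    (hM : 1 ≤ c.mach) (hwM : w ≤ c.mach)
    (h : ∀ s' : Mem, s'.nat = Function.update s.nat a
      (fun i => if i < w then if x.eval c.tape s i < y.eval c.tape s i then 1 else 0
        else s.nat a i) → s'.real = s.real → Post s') :
    Runs c (.setLt a width .pid x y) s Post := by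
  subst hw
  refine ⟨_, _, _, .setLt (exclusive_id _), le_rfl, max_le hM hwM, h _ ?_ rfl⟩
  rw [← scatter_id]
  simp only [Mem.putNat, NExp.eval_pid]

open Classical in
theorem setLt_cell {a : ℕ} {x y : RExp} (hM : 1 ≤ c.mach)
    (h : ∀ s' : Mem, s'.nat = Function.update s.nat a (Function.update (s.nat a) 0
      (if x.eval c.tape s 0 < y.eval c.tape s 0 then 1 else 0)) → s'.real = s.real → Post s') :
    Runs c (.setLt a (.const 1) (.const 0) x y) s Post := by
  refine ⟨_, _, _, .setLt exclusive_cell, le_rfl, max_le hM hM, h _ ?_ rfl⟩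
  rw [← scatter_cell (s.nat a) (fun p => if x.eval c.tape s p < y.eval c.tape s p then 1 else 0)]
  simp only [Mem.putNat, NExp.eval_const]

theorem query_array {a w b : ℕ} {width base elt : NExp} (hw : width.eval s 0 = w)
    (hM : 1 ≤ c.mach) (hwM : w * max 1 c.kappa ≤ c.mach)
    (h : ∀ s' : Mem, s'.nat = s.nat → s'.real = Function.update s.real a
      (fun i => if i < w then answer c.oracle (s.readSet n b (base.eval s i)) (elt.eval s i)
        else s.real a i) → Post s') :
    Runs c (.query a width .pid b base elt) s Post := by
  subst hw
  refine ⟨_, _, _, .query (exclusive_id _), le_rfl, max_le hM hwM, h _ rfl ?_⟩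
  rw [← scatter_id]
  rfl

theorem loop {e : NExp} {P : Prog} (Inv : ℕ → Mem → Prop)
    (hstep : ∀ j s, Inv j s → e.eval s 0 ≠ 0 → Runs c P s fun s' => ∃ j' < j, Inv j' s')
    (hdone : ∀ j s, Inv j s → e.eval s 0 = 0 → Post s) (hM : 1 ≤ c.mach)
    {j : ℕ} (hj : j ≤ c.it) (h0 : Inv j s) : Runs c (.loop e P) s Post := by
  have key : ∀ j s, Inv j s → ∃ s' t m, Exec c.oracle c.tau c.kappa c.tape (.loop e P) s s' t m ∧
      t ≤ j * (e.size + P.cost c.tau c.it) + e.size ∧ m ≤ c.mach ∧ Post s' := by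
    intro j
    induction j using Nat.strong_induction_on with
    | _ j ih =>
      intro s hs
      by_cases he : e.eval s 0 = 0
      · exact ⟨s, _, _, .loop_done he, by omega, hM, hdone j s hs he⟩
      · obtain ⟨s', t, m, h1, h2, h3, j', hj', h4⟩ := hstep j s hs he
        obtain ⟨s'', t', m', h1', h2', h3', h4'⟩ := ih j' hj' s' h4
        refine ⟨s'', _, _, .loop_step he h1 h1', ?_, max_le h3 h3', h4'⟩
        have : (j' + 1) * (e.size + P.cost c.tau c.it) ≤ j * (e.size + P.cost c.tau c.it) :=
          Nat.mul_le_mul_right _ hj'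
        rw [Nat.succ_mul] at this
        omega
  obtain ⟨s', t, m, h1, h2, h3, h4⟩ := key j s h0
  exact ⟨s', t, m, h1, h2.trans (Nat.add_le_add_right (Nat.mul_le_mul_right _ hj) _), h3, h4⟩

end Runs

section Scan

/-- The doubling step of a prefix computation in blocks of length `L` with stride `D`. -/
theorem scan_step {β : Type} (op : β → β → β) (big : (ℕ → β) → ℕ → β)
    (hbig : ∀ f a b, big f (a + b) = op (big f a) (big (fun i => f (a + i)) b))
    (f : ℕ → β) (D L r p : ℕ) :
    (if r ≤ p / D % L then
      op (big (fun i => f (p - i * D)) (min r (p / D % L + 1)))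
        (big (fun i => f (p - r * D - i * D)) (min r ((p - r * D) / D % L + 1)))
      else big (fun i => f (p - i * D)) (min r (p / D % L + 1))) =
    big (fun i => f (p - i * D)) (min (2 * r) (p / D % L + 1)) := by
  split_ifs with h
  · have h1 : (p - r * D) / D % L = p / D % L - r := by
      rw [mul_comm, Nat.sub_mul_div]
      have h2 : p / D - r = L * (p / D / L) + (p / D % L - r) := by
        have := Nat.div_add_mod (p / D) L
        omega
      rw [h2, Nat.mul_add_mod]
      rcases Nat.eq_zero_or_pos L with rfl | hL
      · simp
      · exact Nat.mod_eq_of_lt (lt_of_le_of_lt (Nat.sub_le _ _) (Nat.mod_lt _ hL))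
    have h2 : min (2 * r) (p / D % L + 1) = r + min r (p / D % L - r + 1) := by omega
    rw [h1, min_eq_left (by omega : r ≤ p / D % L + 1), h2, hbig]
    congr 2
    funext i
    rw [Nat.sub_sub, Nat.add_mul]
  · congr 1
    omega

variable {n : ℕ} {c : Setting n} {s : Mem} {Post : Mem → Prop}

/-- The position of a processor in its block. -/
def NExp.blockPos (stride len : NExp) : NExp := .mod (.div .pid stride) len

/-- Prefix sums in blocks of length `len` with the given stride. -/
def scanNat (a st : ℕ) (width stride len : NExp) : Prog :=
  .seq (.setN st (.const 1) (.const 0) (.const 1))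
    (.loop (.lt (.cell st) len)
      (.seq
        (.setN a width .pid (.ite (.le (.cell st) (.blockPos stride len))
          (.add (.load a .pid) (.load a (.sub .pid (.mul (.cell st) stride)))) (.load a .pid)))
        (.setN st (.const 1) (.const 0) (.mul (.const 2) (.cell st)))))

/-- Prefix computations with the operation `op` in blocks of length `len`. -/
def scanReal (op : RExp → RExp → RExp) (a st : ℕ) (width stride len : NExp) : Prog :=
  .seq (.setN st (.const 1) (.const 0) (.const 1))
    (.loop (.lt (.cell st) len)
      (.seq
        (.setR a width .pid (.ite (.le (.cell st) (.blockPos stride len))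
          (op (.load a .pid) (.load a (.sub .pid (.mul (.cell st) stride)))) (.load a .pid)))
        (.setN st (.const 1) (.const 0) (.mul (.const 2) (.cell st)))))

theorem runs_scanNat {a st W D L : ℕ} {width stride len : NExp} (hast : a ≠ st)
    (hexp : ∀ s' : Mem, (∀ b, b ≠ a → b ≠ st → s'.nat b = s.nat b) → ∀ p,
      width.eval s' p = W ∧ stride.eval s' p = D ∧ len.eval s' p = L)
    (hL0 : 0 < L) (hL : L ≤ 2 ^ c.it) (hM : 1 ≤ c.mach) (hW : W ≤ c.mach)
    (h : ∀ s' : Mem, s'.real = s.real → (∀ b, b ≠ a → b ≠ st → s'.nat b = s.nat b) →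
      (∀ p < W, s'.nat a p = ∑ i ∈ Finset.range (p / D % L + 1), s.nat a (p - i * D)) → Post s') :
    Runs c (scanNat a st width stride len) s Post := by
  refine .seq (.setN_cell hM fun s1 h1 h1' => ?_)
  refine Runs.loop (fun j s' => ∃ x, x + j = c.it ∧ s'.real = s.real ∧
    (∀ b, b ≠ a → b ≠ st → s'.nat b = s.nat b) ∧ s'.nat st 0 = 2 ^ x ∧
    ∀ p < W, s'.nat a p = ∑ i ∈ Finset.range (min (2 ^ x) (p / D % L + 1)), s.nat a (p - i * D))
    ?_ ?_ hM le_rfl ?_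
  · rintro j s2 ⟨x, hx, hr, hfr, hst, hval⟩ hlt
    rw [NExp.eval_lt_ne_zero, (hexp s2 hfr 0).2.2] at hlt
    simp only [NExp.eval_load, NExp.eval_const, hst] at hlt
    have hxit : x < c.it := by
      by_contra hge
      have := Nat.pow_le_pow_right two_pos (not_lt.1 hge)
      omega
    refine .seq (.setN_array (hexp s2 hfr 0).1 hM hW fun s3 h3 h3' => ?_)
    refine .setN_cell hM fun s4 h4 h4' => ?_
    refine ⟨j - 1, by omega, x + 1, by omega, by rw [h4', h3', hr], ?_, ?_, ?_⟩
    · intro b hb hb'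
      simp [h4, h3, Function.update_of_ne hb, Function.update_of_ne hb', hfr b hb hb']
    · simp [h4, h3, Function.update_of_ne hast.symm, hst, pow_succ, mul_comm]
    · intro p hp
      simp only [h4, h3, Function.update_of_ne hast, Function.update_self, hp, if_true,
        NExp.eval_ite, NExp.eval_le_ne_zero]
      simp only [NExp.eval_load, NExp.eval_add, NExp.eval_sub, NExp.eval_pid, NExp.eval_mul,
        NExp.blockPos, NExp.eval_mod, NExp.eval_div, NExp.eval_const, (hexp s2 hfr p).2.1,
        (hexp s2 hfr p).2.2, hst]
      rw [hval p hp, hval (p - 2 ^ x * D) (by omega), pow_succ', ← scan_step (· + ·)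
        (fun f a => ∑ i ∈ Finset.range a, f i) (fun f a b => Finset.sum_range_add f a b)
        (s.nat a)]
  · rintro j s2 ⟨x, hx, hr, hfr, hst, hval⟩ hlt
    have hlt' : L ≤ 2 ^ x := by
      by_contra hlt'
      refine (NExp.eval_lt_ne_zero s2 0 _ _).2 ?_ hlt
      rw [(hexp s2 hfr 0).2.2]
      simpa [hst] using hlt'
    refine h s2 hr hfr fun p hp => ?_
    rw [hval p hp]
    have := Nat.mod_lt (p / D) hL0
    congr 2
    omega
  · refine ⟨0, by omega, h1', ?_, by simp [h1], ?_⟩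
    · intro b hb hb'
      simp [h1, Function.update_of_ne hb']
    · intro p hp
      simp [h1, Function.update_of_ne hast]

theorem runs_scanReal {op : RExp → RExp → RExp} (op' : ℝ → ℝ → ℝ) (big : (ℕ → ℝ) → ℕ → ℝ)
    (hbig : ∀ f a b, big f (a + b) = op' (big f a) (big (fun i => f (a + i)) b))
    (hone : ∀ f, big f 1 = f 0)
    (hop : ∀ x y s p, (op x y).eval c.tape s p = op' (x.eval c.tape s p) (y.eval c.tape s p))
    {a st W D L : ℕ} {width stride len : NExp}
    (hexp : ∀ s' : Mem, (∀ b, b ≠ st → s'.nat b = s.nat b) → ∀ p,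
      width.eval s' p = W ∧ stride.eval s' p = D ∧ len.eval s' p = L)
    (hL0 : 0 < L) (hL : L ≤ 2 ^ c.it) (hM : 1 ≤ c.mach) (hW : W ≤ c.mach)
    (h : ∀ s' : Mem, (∀ b, b ≠ a → s'.real b = s.real b) → (∀ b, b ≠ st → s'.nat b = s.nat b) →
      (∀ p < W, s'.real a p = big (fun i => s.real a (p - i * D)) (p / D % L + 1)) → Post s') :
    Runs c (scanReal op a st width stride len) s Post := by
  refine .seq (.setN_cell hM fun s1 h1 h1' => ?_)
  refine Runs.loop (fun j s' => ∃ x, x + j = c.it ∧ (∀ b, b ≠ a → s'.real b = s.real b) ∧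
    (∀ b, b ≠ st → s'.nat b = s.nat b) ∧ s'.nat st 0 = 2 ^ x ∧
    ∀ p < W, s'.real a p = big (fun i => s.real a (p - i * D)) (min (2 ^ x) (p / D % L + 1)))
    ?_ ?_ hM le_rfl ?_
  · rintro j s2 ⟨x, hx, hr, hfr, hst, hval⟩ hlt
    rw [NExp.eval_lt_ne_zero, (hexp s2 hfr 0).2.2] at hlt
    simp only [NExp.eval_load, NExp.eval_const, hst] at hlt
    have hxit : x < c.it := by
      by_contra hge
      have := Nat.pow_le_pow_right two_pos (not_lt.1 hge)
      omega
    refine .seq (.setR_array (hexp s2 hfr 0).1 hM hW fun s3 h3 h3' => ?_)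
    refine .setN_cell hM fun s4 h4 h4' => ?_
    refine ⟨j - 1, by omega, x + 1, by omega, fun b hb => by simp [h4', h3', Function.update_of_ne hb, hr b hb], ?_, ?_, ?_⟩
    · intro b hb'
      simp [h4, h3, Function.update_of_ne hb', hfr b hb']
    · simp [h4, h3, hst, pow_succ, mul_comm]
    · intro p hp
      simp only [h4', h3', Function.update_self, hp, if_true, RExp.eval_ite,
        NExp.eval_le_ne_zero, hop, RExp.eval_load]
      simp only [NExp.eval_load, NExp.eval_sub, NExp.eval_pid, NExp.eval_mul,
        NExp.blockPos, NExp.eval_mod, NExp.eval_div, NExp.eval_const, (hexp s2 hfr p).2.1,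
        (hexp s2 hfr p).2.2, hst]
      rw [hval p hp, hval (p - 2 ^ x * D) (by omega), pow_succ', ← scan_step op' big hbig
        (s.real a)]
  · rintro j s2 ⟨x, hx, hr, hfr, hst, hval⟩ hlt
    have hlt' : L ≤ 2 ^ x := by
      by_contra hlt'
      refine (NExp.eval_lt_ne_zero s2 0 _ _).2 ?_ hlt
      rw [(hexp s2 hfr 0).2.2]
      simpa [hst] using hlt'
    refine h s2 hr hfr fun p hp => ?_
    rw [hval p hp]
    have := Nat.mod_lt (p / D) hL0
    congr 2
    omega
  · refine ⟨0, by omega, fun b _ => by rw [h1'], ?_, by simp [h1], ?_⟩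
    · intro b hb'
      simp [h1, Function.update_of_ne hb']
    · intro p hp
      simp [h1', hone]

end Scan

/-- The arrays of naturals below `i` and the arrays of reals below `r` agree. -/
structure Mem.SameBelow (i r : ℕ) (s s' : Mem) : Prop where
  nat : ∀ b < i, s'.nat b = s.nat b
  real : ∀ b < r, s'.real b = s.real b

section Blocks

theorem block_pos {D L r j : ℕ} (x : ℕ) (hj : j < L) (hr : r < D) :
    ((x * L + j) * D + r) / D % L = j := by
  rw [mul_comm (x * L + j), Nat.mul_add_div (by omega), Nat.div_eq_of_lt hr, add_zero, mul_comm x,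
    Nat.mul_add_mod, Nat.mod_eq_of_lt hj]

theorem block_index {i j : ℕ} (D L r x : ℕ) (hi : i ≤ j) :
    (x * L + j) * D + r - (j - i) * D = (x * L + i) * D + r := by
  rw [show x * L + j = (x * L + i) + (j - i) by omega, Nat.add_mul]
  omega

theorem block_sum {β : Type} [AddCommMonoid β] (f : ℕ → β) (D L r j x : ℕ) :
    ∑ i ∈ Finset.range (j + 1), f ((x * L + j) * D + r - i * D) =
      ∑ i ∈ Finset.range (j + 1), f ((x * L + i) * D + r) := by
  rw [← Finset.sum_range_reflect]
  refine Finset.sum_congr rfl fun i hi => ?_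
  rw [Nat.add_sub_cancel, block_index D L r x (Nat.lt_succ_iff.1 (Finset.mem_range.1 hi))]

theorem block_prod {β : Type} [CommMonoid β] (f : ℕ → β) (D L r j x : ℕ) :
    ∏ i ∈ Finset.range (j + 1), f ((x * L + j) * D + r - i * D) =
      ∏ i ∈ Finset.range (j + 1), f ((x * L + i) * D + r) := by
  rw [← Finset.prod_range_reflect]
  refine Finset.prod_congr rfl fun i hi => ?_
  rw [Nat.add_sub_cancel, block_index D L r x (Nat.lt_succ_iff.1 (Finset.mem_range.1 hi))]

theorem block_lt {a b c d : ℕ} (h : a < b) (h' : c < d) : a * d + c < b * d := by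
  calc a * d + c < (a + 1) * d := by rw [Nat.succ_mul]; omega
    _ ≤ b * d := Nat.mul_le_mul_right _ h

theorem block_div {c d : ℕ} (a : ℕ) (h : c < d) : (a * d + c) / d = a := by
  rw [mul_comm, Nat.mul_add_div (by omega), Nat.div_eq_of_lt h, add_zero]

theorem block_mod {c d : ℕ} (a : ℕ) (h : c < d) : (a * d + c) % d = c := by
  rw [mul_comm, Nat.mul_add_mod, Nat.mod_eq_of_lt h]

theorem sum_filter_le_eq {n : ℕ} {g : Fin n → ℝ} {f : ℕ → ℝ} (h : ∀ i : Fin n, f i = g i)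
    (i : Fin n) : ∑ i' ∈ Finset.univ.filter (fun i' => i' ≤ i), g i' =
      ∑ x ∈ Finset.range (i + 1), f x := by
  refine Finset.sum_nbij (fun i' => (i' : ℕ)) ?_ ?_ ?_ fun i' _ => (h i').symm
  · intro i' hi'
    simp only [Finset.mem_filter, Finset.mem_univ, true_and, Fin.le_def] at hi'
    exact Finset.mem_range.2 (by omega)
  · intro a _ b _ hab
    exact Fin.ext hab
  · intro x hx
    simp only [Finset.coe_range, Set.mem_Iio] at hx
    refine ⟨⟨x, by omega⟩, ?_, rfl⟩
    simp only [Finset.coe_filter, Finset.mem_univ, true_and, Set.mem_ofPred_eq, Fin.le_def]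
    omega

end Blocks

section Segments

variable {n : ℕ} {c : Setting n} {s : Mem} {Post : Mem → Prop}

/-- Number of elements, number of elements to choose. -/
abbrev nExp : NExp := .load 0 (.const 0)
abbrev kExp : NExp := .load 0 (.const 1)

/-- The variables at the beginning of a round: `m` elements remain to be chosen, `ell` are chosen
in this round with `T` proposals and acceptance constant `B`, with random numbers from the cell
`b` on; the elements of `S` have been chosen. -/
structure RoundState (k m ell b T B : ℕ) (S : Finset (Fin n)) (s : Mem) : Prop where
  hn : s.nat 0 0 = n
  hk : s.nat 0 1 = k
  hm : s.nat 5 0 = m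
  hell : s.nat 6 0 = ell
  hb : s.nat 7 0 = b
  hT : s.nat 8 0 = T
  hB : s.nat 9 0 = B
  hS : ∀ i : Fin n, s.nat 1 i ≠ 0 ↔ i ∈ S

/-- The resources needed for a round. -/
structure Enough (c : Setting n) (ell T : ℕ) : Prop where
  hn : 0 < n
  hell : 0 < ell
  hT : 0 < T
  mach : T * (ell + 1) * n * max 1 c.kappa ≤ c.mach
  n_le : n ≤ 2 ^ c.it
  ell_le : ell + 1 ≤ 2 ^ c.it
  T_le : T ≤ 2 ^ c.it

namespace Enough

variable {ell T : ℕ}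

theorem width (h : Enough c ell T) : T * (ell + 1) * n ≤ c.mach :=
  (Nat.le_mul_of_pos_right _ (by simp)).trans h.mach

theorem one_le (h : Enough c ell T) : 1 ≤ c.mach :=
  le_trans (Nat.one_le_iff_ne_zero.2 (by have := h.hn; have := h.hT; positivity)) h.width

theorem width_query (h : Enough c ell T) : T * ell * max 1 c.kappa ≤ c.mach := by
  refine le_trans (Nat.mul_le_mul_right _ ?_) h.mach
  exact (Nat.mul_le_mul_left _ (Nat.le_succ _)).trans (Nat.le_mul_of_pos_right _ h.hn)

theorem width_pick (h : Enough c ell T) : T * ell * n ≤ c.mach :=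
  le_trans (Nat.mul_le_mul_right _ (Nat.mul_le_mul_left _ (Nat.le_succ _))) h.width

theorem width_tuple (h : Enough c ell T) : T * ell ≤ c.mach :=
  (Nat.le_mul_of_pos_right _ h.hn).trans h.width_pick

theorem width_trial (h : Enough c ell T) : T ≤ c.mach :=
  (Nat.le_mul_of_pos_right _ h.hell).trans h.width_tuple

theorem width_n_query (h : Enough c ell T) : n * max 1 c.kappa ≤ c.mach := by
  refine le_trans (Nat.mul_le_mul_right _ ?_) h.mach
  exact Nat.le_mul_of_pos_left _ (Nat.mul_pos h.hT (Nat.succ_pos _))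

theorem width_n (h : Enough c ell T) : n ≤ c.mach :=
  (Nat.le_mul_of_pos_right _ (by simp)).trans h.width_n_query

end Enough

/-- Query the marginals given the current set and compute their cumulative sums. -/
def marginalsProg : Prog :=
  .seq (.query 1 nExp .pid 1 (.const 0) .pid)
  (.seq (.setLt 12 nExp .pid (.load 1 .pid) (.ofNat (.const 0)))
  (.seq (.setR 2 nExp .pid (.ite (.load 1 .pid) (.ofNat (.const 0))
    (.ite (.load 12 .pid) (.ofNat (.const 0)) (.load 1 .pid))))
  (.seq (.setR 3 nExp .pid (.load 2 .pid))
    (scanReal .add 3 19 nExp (.const 1) nExp))))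

theorem runs_marginalsProg {k m ell b T B : ℕ} {S : Finset (Fin n)}
    (hs : RoundState k m ell b T B S s) (hc : Enough c ell T)
    (h : ∀ s' : Mem, s.SameBelow 12 1 s' → (∀ i : Fin n, s'.real 2 i = clip c.oracle S i) →
      (∀ i : Fin n, s'.real 3 i = cumul c.oracle S i) → Post s') :
    Runs c marginalsProg s Post := by
  have hM := hc.one_le
  refine .seq (.query_array hs.hn hM hc.width_n_query fun s1 h1 h1' => ?_)
  refine .seq (.setLt_array (by simp [h1, hs.hn]) hM hc.width_n fun s2 h2 h2' => ?_)
  refine .seq (.setR_array (by simp [h1, h2, hs.hn]) hM hc.width_n fun s3 h3 h3' => ?_)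
  refine .seq (.setR_array (by simp [h1, h2, h3, hs.hn]) hM hc.width_n fun s4 h4 h4' => ?_)
  have hread : s.readSet n 1 0 = S := by
    ext i
    simpa [Mem.readSet] using hs.hS i
  have hraw : ∀ i : Fin n, s2.real 1 i = c.oracle S i := by
    intro i
    simp [h2', h1', hread, answer]
  have hneg : ∀ i : Fin n, s2.nat 12 i ≠ 0 ↔ c.oracle S i < 0 := by
    intro i
    simp only [h2, Function.update_self, i.2, if_true, RExp.eval_load, NExp.eval_pid,
      RExp.eval_ofNat, NExp.eval_const, Nat.cast_zero, ← h2', hraw]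
    split_ifs with h0 <;> simp [h0]
  have hset : ∀ i : Fin n, s2.nat 1 i ≠ 0 ↔ i ∈ S := by
    intro i
    simpa [h2, h1] using hs.hS i
  have hclip : ∀ i : Fin n, s3.real 2 i = clip c.oracle S i := by
    intro i
    simp only [h3', Function.update_self, i.2, if_true, RExp.eval_ite, RExp.eval_load,
      NExp.eval_load, NExp.eval_pid, RExp.eval_ofNat, NExp.eval_const, Nat.cast_zero, hset, hneg,
      hraw, clip]
    by_cases h1 : i ∈ S <;> by_cases h2 : c.oracle S i < 0 <;> simp [h1, h2]
  have hcopy : ∀ i : Fin n, s4.real 3 i = clip c.oracle S i := by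
    intro i
    simp [h4', hclip]
  refine runs_scanReal (W := n) (D := 1) (L := n) (· + ·) (fun f a => ∑ i ∈ Finset.range a, f i)
    (fun f a b => Finset.sum_range_add f a b) (fun f => by simp) (fun _ _ _ _ => rfl)
    ?_ hc.hn hc.n_le hM hc.width_n ?_
  · intro s' hs' p
    have := hs' 0 (by decide)
    simp [this, h4, h3, h2, h1, hs.hn]
  · intro s5 h5' h5 h5v
    refine h s5 ⟨fun b hb => ?_, fun b hb => ?_⟩ ?_ ?_
    · have hb1 : b ≠ 19 := by omega
      have hb2 : b ≠ 12 := by omega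
      simp [h5 b hb1, h4, h3, h2, h1, Function.update_of_ne hb2]
    · have hb1 : b ≠ 3 := by omega
      have hb2 : b ≠ 2 := by omega
      have hb3 : b ≠ 1 := by omega
      simp [h5' b hb1, h4', h3', h2', h1', Function.update_of_ne hb1, Function.update_of_ne hb2,
        Function.update_of_ne hb3]
    · intro i
      rw [h5' 2 (by decide), ← hclip i, h4', Function.update_of_ne (by decide)]
    · intro i
      rw [h5v i i.2, cumul, sum_filter_le_eq hcopy i, Nat.div_one, Nat.mod_eq_of_lt i.2]
      have := block_sum (s4.real 3) 1 (i + 1) 0 i 0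
      simpa using this

/-- Draw `T` proposals of `ell` elements each. -/
def proposeProg : Prog :=
  .seq (.setN 13 (.mul (.cell 8) (.cell 6)) .pid (.const 0))
  (.seq (.setLt 14 (.mul (.mul (.cell 8) (.cell 6)) nExp) .pid
    (.mul (.rand (.add (.add (.cell 7) (.mul (.div (.div .pid nExp) (.cell 6))
      (.add kExp (.const 1)))) (.mod (.div .pid nExp) (.cell 6)))) (.ofNat (.cell 5)))
    (.load 3 (.mod .pid nExp)))
  (.setN 13 (.mul (.mul (.cell 8) (.cell 6)) nExp)
    (.ite (.mul (.load 14 .pid) (.ite (.mod .pid nExp)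
      (.sub (.const 1) (.load 14 (.sub .pid (.const 1)))) (.const 1)))
      (.div .pid nExp) (.add (.mul (.cell 8) (.cell 6)) .pid))
    (.mod .pid nExp)))

theorem isPick_iff_of_pos {O : Finset (Fin n) → Fin n → ℝ} {S : Finset (Fin n)} {m : ℕ} {u : ℝ}
    {i i₀ : Fin n} (h : (i₀ : ℕ) + 1 = i) :
    IsPick O S m u i ↔ u * m < cumul O S i ∧ ¬ u * m < cumul O S i₀ := by
  refine and_congr_right fun _ => ⟨fun h' => not_lt.2 (h' i₀ (Fin.lt_def.2 (by omega))),
    fun h' i' hi' => ?_⟩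
  exact (cumul_mono O S (Fin.le_def.2 (by have := Fin.lt_def.1 hi'; omega))).trans (not_lt.1 h')

theorem runs_proposeProg [NeZero n] {k m ell b T B : ℕ} {S : Finset (Fin n)}
    (hs : RoundState k m ell b T B S s) (hc : Enough c ell T)
    (hcum : ∀ i : Fin n, s.real 3 i = cumul c.oracle S i)
    (h : ∀ s' : Mem, s.SameBelow 13 6 s' → (∀ t < T, ∀ j < ell, s'.nat 13 (t * ell + j) =
      (pick c.oracle S m (c.tape (b + t * (k + 1) + j)) : ℕ)) → Post s') :
    Runs c proposeProg s Post := by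
  have hM := hc.one_le
  have hn := hc.hn
  refine .seq (.setN_array (w := T * ell) (by simp [hs.hT, hs.hell]) hM hc.width_tuple
    fun s1 h1 h1' => ?_)
  refine .seq (.setLt_array (w := T * ell * n) (by simp [h1, hs.hT, hs.hell, hs.hn]) hM
    hc.width_pick fun s2 h2 h2' => ?_)
  set u : ℕ → ℝ := fun x => c.tape (b + x / ell * (k + 1) + x % ell) with hu
  have hflag : ∀ x < T * ell, ∀ i : Fin n,
      s2.nat 14 (x * n + i) ≠ 0 ↔ u x * m < cumul c.oracle S i := by
    intro x hx i
    have hlt : x * n + i < T * ell * n := block_lt hx i.2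
    simp only [h2, Function.update_self, hlt, if_true, RExp.eval_mul, RExp.eval_rand,
      RExp.eval_load, RExp.eval_ofNat, NExp.eval_add, NExp.eval_load, NExp.eval_mul, NExp.eval_div,
      NExp.eval_mod, NExp.eval_pid, NExp.eval_const, h1', h1,
      Function.update_of_ne (show (7 : ℕ) ≠ 13 by decide),
      Function.update_of_ne (show (6 : ℕ) ≠ 13 by decide),
      Function.update_of_ne (show (5 : ℕ) ≠ 13 by decide),
      Function.update_of_ne (show (0 : ℕ) ≠ 13 by decide), hs.hn, hs.hk, hs.hb, hs.hell, hs.hm,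
      block_div x i.2, block_mod x i.2, hcum]
    split_ifs with h0 <;> simpa [hu] using h0
  set cnd : NExp := .mul (.load 14 .pid) (.ite (.mod .pid nExp)
      (.sub (.const 1) (.load 14 (.sub .pid (.const 1)))) (.const 1)) with hcnd
  have hn2 : s2.nat 0 0 = n := by simp [h2, h1, hs.hn]
  have hsel : ∀ x < T * ell, ∀ i : Fin n,
      cnd.eval s2 (x * n + i) ≠ 0 ↔ IsPick c.oracle S m (u x) i := by
    intro x hx i
    rw [hcnd, NExp.eval_mul_ne_zero]
    simp only [NExp.eval_load, NExp.eval_pid, NExp.eval_ite, NExp.eval_mod, NExp.eval_sub,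
      NExp.eval_const, hn2, block_mod x i.2]
    by_cases hi : (i : ℕ) = 0
    · rw [if_neg (by simpa using hi), hflag x hx i]
      refine and_congr_right fun _ => ⟨fun _ i' hi' => ?_, fun _ => one_ne_zero⟩
      exact absurd (Fin.lt_def.1 hi') (by omega)
    · have hi₀ : (i : ℕ) - 1 < n := by omega
      have e : x * n + i - 1 = x * n + (⟨i - 1, hi₀⟩ : Fin n) := by
        show x * n + i - 1 = x * n + (i - 1)
        omega
      rw [if_pos hi, e, hflag x hx i,
        isPick_iff_of_pos (i₀ := ⟨i - 1, hi₀⟩) (show (i : ℕ) - 1 + 1 = i by omega),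
        ← hflag x hx ⟨i - 1, hi₀⟩]
      refine and_congr_right fun _ => ?_
      omega
  have hidx : ∀ p, (NExp.ite cnd (.div .pid nExp) (.add (.mul (.cell 8) (.cell 6)) .pid)).eval s2 p
      = if cnd.eval s2 p ≠ 0 then p / n else T * ell + p := by
    intro p
    rw [NExp.eval_ite]
    simp [h2, h1, hs.hT, hs.hell, hs.hn]
  have hex : Exclusive (T * ell * n) fun p =>
      if cnd.eval s2 p ≠ 0 then p / n else T * ell + p := by
    intro p p' hp hp' heq
    have hd : p / n < T * ell := Nat.div_lt_of_lt_mul (by rwa [mul_comm])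
    have hd' : p' / n < T * ell := Nat.div_lt_of_lt_mul (by rwa [mul_comm])
    by_cases h3 : cnd.eval s2 p ≠ 0 <;> by_cases h4 : cnd.eval s2 p' ≠ 0
    · simp only [h3, h4, ne_eq, not_false_eq_true, if_true] at heq
      have e1 := Nat.div_add_mod' p n
      have e2 := Nat.div_add_mod' p' n
      rw [← e1] at h3
      rw [← e2] at h4
      have h5 := (hsel _ hd ⟨p % n, Nat.mod_lt _ hn⟩).1 h3
      have h6 := (hsel _ hd' ⟨p' % n, Nat.mod_lt _ hn⟩).1 h4
      rw [← heq] at h6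
      have h7 := congrArg Fin.val (h5.unique h6)
      simp only at h7
      rw [← e1, ← e2, heq, h7]
    · beta_reduce at heq
      rw [if_pos h3, if_neg h4] at heq
      omega
    · beta_reduce at heq
      rw [if_neg h3, if_pos h4] at heq
      omega
    · beta_reduce at heq
      rw [if_neg h3, if_neg h4] at heq
      omega
  refine .setN (w := T * ell * n) (by simp [h2, h1, hs.hT, hs.hell, hs.hn]) hM hc.width_pick
    (by simpa only [hidx] using hex) fun s3 h3 h3' => ?_
  simp only [hidx] at h3
  refine h s3 ⟨fun b hb => ?_, fun b _ => by rw [h3', h2', h1']⟩ fun t ht j hj => ?_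
  · have hb1 : b ≠ 13 := by omega
    have hb2 : b ≠ 14 := by omega
    simp [h3, h2, h1, Function.update_of_ne hb1, Function.update_of_ne hb2]
  · have hx : t * ell + j < T * ell := block_lt ht hj
    have hux : u (t * ell + j) = c.tape (b + t * (k + 1) + j) := by
      simp only [hu, block_div t hj, block_mod t hj]
    rw [← hux, h3, Function.update_self]
    by_cases hexi : ∃ i, IsPick c.oracle S m (u (t * ell + j)) i
    · obtain ⟨i, hi⟩ := hexi
      have h4 := (hsel _ hx i).2 hi
      have h5 := scatter_of_exclusive hex (s2.nat 13) (fun p => (NExp.mod .pid nExp).eval s2 p)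
        (block_lt hx i.2)
      simp only [h4, ne_eq, not_false_eq_true, if_true, block_div _ i.2] at h5
      rw [h5, hi.pick_eq]
      simp [hn2, block_mod _ i.2]
    · rw [scatter_of_forall_ne, pick, dif_neg hexi]
      · have hx' := hx
        simp [h2, h1, hx']
      · intro p hp heq
        split_ifs at heq with h4
        · refine hexi ⟨⟨p % n, Nat.mod_lt _ hn⟩, ?_⟩
          refine (hsel _ hx _).1 ?_
          rw [← heq]
          rw [Nat.div_add_mod' p n]
          exact h4
        · omega

end Segments

section Segments

variable {n : ℕ} {c : Setting n} {s : Mem} {Post : Mem → Prop}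

theorem RoundState.sameBelow {k m ell b T B : ℕ} {S : Finset (Fin n)} {s s' : Mem}
    (hs : RoundState k m ell b T B S s) {i r : ℕ} (h : s.SameBelow i r s') (hi : 10 ≤ i) :
    RoundState k m ell b T B S s' :=
  ⟨by rw [h.nat 0 (by omega), hs.hn], by rw [h.nat 0 (by omega), hs.hk],
    by rw [h.nat 5 (by omega), hs.hm], by rw [h.nat 6 (by omega), hs.hell],
    by rw [h.nat 7 (by omega), hs.hb], by rw [h.nat 8 (by omega), hs.hT],
    by rw [h.nat 9 (by omega), hs.hB], fun j => by rw [h.nat 1 (by omega), hs.hS]⟩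

/-- Equality test. -/
def NExp.eq (x y : NExp) : NExp := .sub (.const 1) (.add (.sub x y) (.sub y x))

theorem NExp.eval_eq_ne_zero (s : Mem) (p : ℕ) (x y : NExp) :
    (NExp.eq x y).eval s p ≠ 0 ↔ x.eval s p = y.eval s p := by
  simp only [NExp.eq, NExp.eval_sub, NExp.eval_add, NExp.eval_const]
  omega

/-- For each proposal and each of its prefixes, the multiplicities of the elements in the current
set and the prefix. -/
def prefixProg : Prog :=
  .seq (.setN 15 (.mul (.mul (.cell 8) (.add (.cell 6) (.const 1))) nExp) .pid
    (.ite (.mod (.div .pid nExp) (.add (.cell 6) (.const 1)))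
      (.eq (.load 13 (.sub (.add (.mul (.div (.div .pid nExp) (.add (.cell 6) (.const 1))) (.cell 6))
        (.mod (.div .pid nExp) (.add (.cell 6) (.const 1)))) (.const 1))) (.mod .pid nExp))
      (.load 1 (.mod .pid nExp))))
    (scanNat 15 19 (.mul (.mul (.cell 8) (.add (.cell 6) (.const 1))) nExp) nExp
      (.add (.cell 6) (.const 1)))

theorem runs_prefixProg [NeZero n] {k m ell b T B : ℕ} {S : Finset (Fin n)}
    (hs : RoundState k m ell b T B S s) (hc : Enough c ell T)
    (hX : ∀ t < T, ∀ j < ell, s.nat 13 (t * ell + j) =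
      (pick c.oracle S m (c.tape (b + t * (k + 1) + j)) : ℕ))
    (h : ∀ s' : Mem, s.SameBelow 15 6 s' → (∀ t < T, ∀ j ≤ ell, ∀ i : Fin n,
      s'.nat 15 ((t * (ell + 1) + j) * n + i) ≠ 0 ↔
        i ∈ S ∪ (draws c.oracle S m c.tape (b + t * (k + 1)) j).toFinset) → Post s') :
    Runs c prefixProg s Post := by
  have hM := hc.one_le
  refine .seq (.setN_array (w := T * (ell + 1) * n) (by simp [hs.hT, hs.hell, hs.hn]) hM hc.width
    fun s1 h1 h1' => ?_)
  have hinit : ∀ t < T, ∀ j < ell + 1, ∀ i : Fin n,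
      s1.nat 15 ((t * (ell + 1) + j) * n + i) ≠ 0 ↔
        if j = 0 then i ∈ S else
          pick c.oracle S m (c.tape (b + t * (k + 1) + (j - 1))) = i := by
    intro t ht j hj i
    have hlt : (t * (ell + 1) + j) * n + i < T * (ell + 1) * n := block_lt (block_lt ht hj) i.2
    simp only [h1, Function.update_self, hlt, if_true, NExp.eval_ite]
    simp only [NExp.eval_mod, NExp.eval_div, NExp.eval_pid, NExp.eval_load, NExp.eval_const,
      NExp.eval_add, hs.hn, hs.hell, block_div _ i.2, block_mod _ hj]
    by_cases hj0 : j = 0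
    · rw [if_neg (by simpa using hj0), if_pos hj0, block_mod _ i.2, hs.hS]
    · rw [if_pos hj0, if_neg hj0, NExp.eval_eq_ne_zero]
      simp only [NExp.eval_mod, NExp.eval_div, NExp.eval_pid, NExp.eval_load, NExp.eval_const,
        NExp.eval_add, NExp.eval_sub, NExp.eval_mul, hs.hn, hs.hell, block_div _ i.2,
        block_mod _ hj, block_mod _ i.2, block_div _ hj]
      rw [show t * ell + j - 1 = t * ell + (j - 1) by omega, hX t ht (j - 1) (by omega)]
      exact Fin.ext_iff.symm
  refine runs_scanNat (W := T * (ell + 1) * n) (D := n) (L := ell + 1) (by decide) ?_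
    (Nat.succ_pos _) hc.ell_le hM hc.width ?_
  · intro s' hs' p
    simp [hs' 0 (by decide) (by decide), hs' 6 (by decide) (by decide),
      hs' 8 (by decide) (by decide), h1, hs.hn, hs.hT, hs.hell]
  · intro s2 h2' h2 h2v
    refine h s2 ⟨fun b hb => ?_, fun b _ => by rw [h2', h1']⟩ fun t ht j hj i => ?_
    · have hb1 : b ≠ 15 := by omega
      have hb2 : b ≠ 19 := by omega
      simp [h2 b hb1 hb2, h1, Function.update_of_ne hb1]
    · have hj' : j < ell + 1 := Nat.lt_succ_of_le hj
      rw [h2v _ (block_lt (block_lt ht hj') i.2), block_pos _ hj' i.2, block_sum]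
      clear h2v hj
      induction j with
      | zero =>
        have := hinit t ht 0 hj' i
        simpa [draws] using this
      | succ j ih =>
        have h3 := hinit t ht (j + 1) hj' i
        rw [if_neg (Nat.succ_ne_zero _), Nat.add_sub_cancel] at h3
        rw [Finset.sum_range_succ, ne_eq, Nat.add_eq_zero_iff, not_and_or, draws,
          union_toFinset_cons, Finset.mem_insert, or_comm (a := i = _)]
        exact or_congr (ih (by omega)) (h3.trans eq_comm)

/-- The position of the set seen before the drawing of an element of a proposal. -/
def rowExp : NExp :=
  .mul (.add (.mul (.div .pid (.cell 6)) (.add (.cell 6) (.const 1))) (.mod .pid (.cell 6))) nExp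

/-- The likelihood ratios of all prefixes of all proposals. -/
def ratioProg : Prog :=
  .seq (.query 4 (.mul (.cell 8) (.cell 6)) .pid 15 rowExp (.load 13 .pid))
  (.seq (.setR 5 (.mul (.cell 8) (.cell 6)) .pid
    (.ite (.load 15 (.add rowExp (.load 13 .pid))) (.ofNat (.const 0))
      (.div (.mul (.load 4 .pid) (.ofNat (.cell 5)))
        (.mul (.sub (.ofNat (.cell 5)) (.ofNat (.mod .pid (.cell 6)))) (.load 2 (.load 13 .pid))))))
    (scanReal .mul 5 19 (.mul (.cell 8) (.cell 6)) (.const 1) (.cell 6)))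

theorem runs_ratioProg [NeZero n] {k m ell b T B : ℕ} {S : Finset (Fin n)}
    (hs : RoundState k m ell b T B S s) (hc : Enough c ell T)
    (hclip : ∀ i : Fin n, s.real 2 i = clip c.oracle S i)
    (hX : ∀ t < T, ∀ j < ell, s.nat 13 (t * ell + j) =
      (pick c.oracle S m (c.tape (b + t * (k + 1) + j)) : ℕ))
    (hP : ∀ t < T, ∀ j ≤ ell, ∀ i : Fin n, s.nat 15 ((t * (ell + 1) + j) * n + i) ≠ 0 ↔
        i ∈ S ∪ (draws c.oracle S m c.tape (b + t * (k + 1)) j).toFinset)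
    (h : ∀ s' : Mem, s.SameBelow 19 4 s' → (∀ t < T, ∀ j < ell, s'.real 5 (t * ell + j) =
      ratio c.oracle S m (draws c.oracle S m c.tape (b + t * (k + 1)) (j + 1))) → Post s') :
    Runs c ratioProg s Post := by
  have hM := hc.one_le
  refine .seq (.query_array (w := T * ell) (by simp [hs.hT, hs.hell]) hM hc.width_query
    fun s1 h1 h1' => ?_)
  refine .seq (.setR_array (w := T * ell) (by simp [h1, hs.hT, hs.hell]) hM hc.width_tuple
    fun s2 h2 h2' => ?_)
  have hrow : ∀ t, ∀ j < ell, rowExp.eval s (t * ell + j) = (t * (ell + 1) + j) * n := by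
    intro t j hj
    simp [rowExp, hs.hell, hs.hn, block_div _ hj, block_mod _ hj]
  have hrow1 : ∀ t, ∀ j < ell, rowExp.eval s1 (t * ell + j) = (t * (ell + 1) + j) * n := by
    intro t j hj
    simp [rowExp, h1, hs.hell, hs.hn, block_div _ hj, block_mod _ hj]
  have hfac : ∀ t < T, ∀ j < ell, s2.real 5 (t * ell + j) =
      if pick c.oracle S m (c.tape (b + t * (k + 1) + j)) ∈
        S ∪ (draws c.oracle S m c.tape (b + t * (k + 1)) j).toFinset then 0 else
      c.oracle (S ∪ (draws c.oracle S m c.tape (b + t * (k + 1)) j).toFinset)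
        (pick c.oracle S m (c.tape (b + t * (k + 1) + j))) * m /
        (((m : ℝ) - j) * clip c.oracle S (pick c.oracle S m (c.tape (b + t * (k + 1) + j)))) := by
    intro t ht j hj
    have hread : s.readSet n 15 ((t * (ell + 1) + j) * n) =
        S ∪ (draws c.oracle S m c.tape (b + t * (k + 1)) j).toFinset := by
      ext i
      rw [← hP t ht j hj.le i]
      simp [Mem.readSet]
    have hans : s1.real 4 (t * ell + j) =
        c.oracle (S ∪ (draws c.oracle S m c.tape (b + t * (k + 1)) j).toFinset)
          (pick c.oracle S m (c.tape (b + t * (k + 1) + j))) := by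
      rw [h1', Function.update_self]
      simp only [block_lt ht hj, if_true, hrow t j hj, hread, NExp.eval_load, NExp.eval_pid,
        hX t ht j hj, answer, Fin.is_lt, dite_true, Fin.eta]
    have hcl : s1.real 2 (pick c.oracle S m (c.tape (b + t * (k + 1) + j)) : ℕ) =
        clip c.oracle S (pick c.oracle S m (c.tape (b + t * (k + 1) + j))) := by
      rw [h1', Function.update_of_ne (by decide), hclip]
    rw [h2', Function.update_self]
    simp only [block_lt ht hj, if_true, RExp.eval_ite, RExp.eval_div, RExp.eval_mul, RExp.eval_sub,
      RExp.eval_load, RExp.eval_ofNat, NExp.eval_load, NExp.eval_add, NExp.eval_mod, NExp.eval_pid,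
      NExp.eval_const, hrow1 t j hj, hans]
    simp only [h1, hX t ht j hj, hs.hm, hs.hell, block_mod _ hj, hcl, hP t ht j hj.le, Nat.cast_zero]
  refine runs_scanReal (W := T * ell) (D := 1) (L := ell) (· * ·)
    (fun f a => ∏ i ∈ Finset.range a, f i) (fun f a b => Finset.prod_range_add f a b)
    (fun f => by simp) (fun _ _ _ _ => rfl) ?_ hc.hell ((Nat.le_succ _).trans hc.ell_le) hM
    hc.width_tuple ?_
  · intro s' hs' p
    simp [hs' 6 (by decide), hs' 8 (by decide), h2, h1, hs.hT, hs.hell]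
  · intro s3 h3' h3 h3v
    refine h s3 ⟨fun b hb => ?_, fun b hb => ?_⟩ fun t ht j hj => ?_
    · rw [h3 b (by omega), h2, h1]
    · rw [h3' b (by omega), h2', Function.update_of_ne (by omega), h1',
        Function.update_of_ne (by omega)]
    · have hp := block_pos t hj (Nat.zero_lt_one)
      have hpr := block_prod (s2.real 5) 1 ell 0 j t
      simp only [mul_one, add_zero] at hp hpr
      rw [h3v _ (block_lt ht hj), hp]
      simp only [mul_one]
      rw [hpr]
      clear hp hpr h3v
      induction j with
      | zero =>
        rw [Finset.prod_range_one, hfac t ht 0 hj]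
        simp [draws, ratio]
      | succ j ih =>
        rw [Finset.prod_range_succ, ih (by omega), hfac t ht (j + 1) hj]
        conv_rhs => rw [draws, ratio, length_draws]

/-- Find the first accepted proposal. -/
def winnerProg : Prog :=
  .seq (.setLt 16 (.cell 8) .pid
    (.mul (.rand (.add (.add (.cell 7) (.mul .pid (.add kExp (.const 1)))) (.cell 6)))
      (.ofNat (.cell 9)))
    (.load 5 (.add (.mul .pid (.cell 6)) (.sub (.cell 6) (.const 1)))))
  (.seq (.setN 17 (.cell 8) .pid (.load 16 .pid))
  (.seq (scanNat 17 19 (.cell 8) (.const 1) (.cell 8))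
  (.seq (.setN 18 (.const 1) (.const 0) (.const 0))
  (.setN 18 (.cell 8)
    (.ite (.mul (.load 16 .pid) (.eq (.load 17 .pid) (.const 1))) (.const 0)
      (.add .pid (.const 1)))
    (.add .pid (.const 1))))))

theorem runs_winnerProg [NeZero n] {k m ell b T B : ℕ} {S : Finset (Fin n)}
    (hs : RoundState k m ell b T B S s) (hc : Enough c ell T)
    (hR : ∀ t < T, ∀ j < ell, s.real 5 (t * ell + j) =
      ratio c.oracle S m (draws c.oracle S m c.tape (b + t * (k + 1)) (j + 1)))
    (h : ∀ s' : Mem, s.SameBelow 16 6 s' →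
      (s'.nat 18 0 = 0 ∧ (∀ t < T, ¬ Accepted c.oracle S m ell B c.tape (b + t * (k + 1))) ∨
      ∃ t < T, s'.nat 18 0 = t + 1 ∧ Accepted c.oracle S m ell B c.tape (b + t * (k + 1)) ∧
        ∀ t' < t, ¬ Accepted c.oracle S m ell B c.tape (b + t' * (k + 1))) → Post s') :
    Runs c winnerProg s Post := by
  have hM := hc.one_le
  refine .seq (.setLt_array (w := T) hs.hT hM hc.width_trial fun s1 h1 h1' => ?_)
  have hacc : ∀ t < T, s1.nat 16 t =
      (open Classical in if Accepted c.oracle S m ell B c.tape (b + t * (k + 1)) then 1 else 0) := by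
    intro t ht
    have hl := hc.hell
    rw [h1, Function.update_self]
    simp only [ht, if_true, RExp.eval_mul, RExp.eval_rand, RExp.eval_ofNat, RExp.eval_load,
      NExp.eval_add, NExp.eval_mul, NExp.eval_sub, NExp.eval_load, NExp.eval_pid, NExp.eval_const,
      hs.hb, hs.hk, hs.hell, hs.hB, hR t ht (ell - 1) (by omega), Nat.sub_add_cancel hl, Accepted]
    congr
  refine .seq (.setN_array (w := T) (by simp [h1, hs.hT]) hM hc.width_trial fun s2 h2 h2' => ?_)
  refine .seq (runs_scanNat (W := T) (D := 1) (L := T) (by decide) ?_ hc.hT hc.T_le hM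
    hc.width_trial ?_)
  · intro s' hs' p
    simp [hs' 8 (by decide) (by decide), h2, h1, hs.hT]
  intro s3 h3' h3 h3v
  have h16 : ∀ t < T, s3.nat 16 t =
      (open Classical in if Accepted c.oracle S m ell B c.tape (b + t * (k + 1)) then 1 else 0) := by
    intro t ht
    rw [h3 16 (by decide) (by decide), h2, Function.update_of_ne (by decide), hacc t ht]
  have h17 : ∀ t < T, s3.nat 17 t = ∑ t' ∈ Finset.range (t + 1), s3.nat 16 t' := by
    intro t ht
    have e := block_sum (s2.nat 17) 1 T 0 t 0
    simp only [zero_mul, zero_add, add_zero, mul_one] at e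
    rw [h3v t ht, Nat.div_one, Nat.mod_eq_of_lt ht]
    simp only [mul_one]
    rw [e]
    refine Finset.sum_congr rfl fun t' ht' => ?_
    have ht' : t' < T := by have := Finset.mem_range.1 ht'; omega
    rw [h3 16 (by decide) (by decide)]
    simp [h2, ht']
  refine .seq (.setN_cell hM fun s4 h4 h4' => ?_)
  set cnd : NExp := .mul (.load 16 .pid) (.eq (.load 17 .pid) (.const 1)) with hcnd
  have hsel : ∀ t < T, cnd.eval s4 t ≠ 0 ↔
      Accepted c.oracle S m ell B c.tape (b + t * (k + 1)) ∧
        ∀ t' < t, ¬ Accepted c.oracle S m ell B c.tape (b + t' * (k + 1)) := by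
    intro t ht
    rw [hcnd, NExp.eval_mul_ne_zero, NExp.eval_eq_ne_zero]
    simp only [NExp.eval_load, NExp.eval_pid, NExp.eval_const, h4,
      Function.update_of_ne (show (16 : ℕ) ≠ 18 by decide),
      Function.update_of_ne (show (17 : ℕ) ≠ 18 by decide), h17 t ht, h16 t ht]
    by_cases ha : Accepted c.oracle S m ell B c.tape (b + t * (k + 1))
    · simp only [ha, if_true, ne_eq, one_ne_zero, not_false_eq_true, true_and]
      rw [Finset.sum_range_succ, h16 t ht, if_pos ha, Nat.add_eq_right,
        Finset.sum_eq_zero_iff]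
      refine ⟨fun h0 t' ht' hacc' => ?_, fun h0 t' ht' => ?_⟩
      · have := h0 t' (Finset.mem_range.2 ht')
        rw [h16 t' (ht'.trans ht), if_pos hacc'] at this
        exact one_ne_zero this
      · have ht' := Finset.mem_range.1 ht'
        rw [h16 t' (ht'.trans ht), if_neg (h0 t' ht')]
    · simp [ha]
  have hidx : ∀ p, (NExp.ite cnd (.const 0) (.add .pid (.const 1))).eval s4 p =
      if cnd.eval s4 p ≠ 0 then 0 else p + 1 := fun p => by rw [NExp.eval_ite]; rfl
  have hex : Exclusive T fun p => if cnd.eval s4 p ≠ 0 then 0 else p + 1 := by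
    intro p p' hp hp' heq
    beta_reduce at heq
    by_cases h5 : cnd.eval s4 p ≠ 0 <;> by_cases h6 : cnd.eval s4 p' ≠ 0
    · have h7 := (hsel p hp).1 h5
      have h8 := (hsel p' hp').1 h6
      rcases lt_trichotomy p p' with hlt | heq' | hlt
      · exact absurd h7.1 (h8.2 p hlt)
      · exact heq'
      · exact absurd h8.1 (h7.2 p' hlt)
    · rw [if_pos h5, if_neg h6] at heq
      omega
    · rw [if_neg h5, if_pos h6] at heq
      omega
    · rw [if_neg h5, if_neg h6] at heq
      omega
  refine .setN (w := T) (by simp [h4, h3 8 (by decide) (by decide), h2, h1, hs.hT]) hM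
    hc.width_trial (by simpa only [hidx] using hex) fun s5 h5 h5' => ?_
  simp only [hidx] at h5
  refine h s5 ⟨fun b hb => ?_, fun b _ => by rw [h5', h4', h3', h2', h1']⟩ ?_
  · have hb1 : b ≠ 16 := by omega
    have hb2 : b ≠ 17 := by omega
    have hb3 : b ≠ 18 := by omega
    have hb4 : b ≠ 19 := by omega
    simp [h5, h4, h3 b hb2 hb4, h2, h1, Function.update_of_ne hb1, Function.update_of_ne hb2,
      Function.update_of_ne hb3]
  · classical
    by_cases hexi : ∃ t, t < T ∧ Accepted c.oracle S m ell B c.tape (b + t * (k + 1))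
    · right
      have hsp := Nat.find_spec hexi
      have hmin : ∀ t' < Nat.find hexi,
          ¬ Accepted c.oracle S m ell B c.tape (b + t' * (k + 1)) := fun t' ht' ha =>
        Nat.find_min hexi ht' ⟨ht'.trans hsp.1, ha⟩
      refine ⟨Nat.find hexi, hsp.1, ?_, hsp.2, hmin⟩
      have h6 := (hsel _ hsp.1).2 ⟨hsp.2, hmin⟩
      have h7 := scatter_of_exclusive hex (s4.nat 18)
        (fun p => (NExp.add .pid (.const 1)).eval s4 p) hsp.1
      rw [if_pos h6] at h7
      rw [h5, Function.update_self, h7]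
      rfl
    · left
      refine ⟨?_, fun t ht ha => hexi ⟨t, ht, ha⟩⟩
      rw [h5, Function.update_self, scatter_of_forall_ne]
      · simp [h4]
      · intro p hp heq
        split_ifs at heq with h6
        exact hexi ⟨p, hp, ((hsel p hp).1 h6).1⟩

/-- Add the first accepted proposal to the set and update the variables. -/
def updateProg : Prog :=
  .seq (.setN 1 nExp .pid (.ite (.cell 18)
    (.load 15 (.add (.mul (.add (.mul (.sub (.cell 18) (.const 1)) (.add (.cell 6) (.const 1)))
      (.cell 6)) nExp) .pid)) (.load 1 .pid)))
  (.seq (.setN 5 (.const 1) (.const 0) (.sub (.cell 5) (.cell 6)))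
  (.setN 7 (.const 1) (.const 0) (.add (.cell 7) (.mul (.cell 8) (.add kExp (.const 1))))))

theorem runs_updateProg [NeZero n] {k m ell b T B : ℕ} {S : Finset (Fin n)}
    (hs : RoundState k m ell b T B S s) (hc : Enough c ell T)
    (hP : ∀ t < T, ∀ j ≤ ell, ∀ i : Fin n, s.nat 15 ((t * (ell + 1) + j) * n + i) ≠ 0 ↔
        i ∈ S ∪ (draws c.oracle S m c.tape (b + t * (k + 1)) j).toFinset)
    (hw : s.nat 18 0 = 0 ∧ (∀ t < T, ¬ Accepted c.oracle S m ell B c.tape (b + t * (k + 1))) ∨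
      ∃ t < T, s.nat 18 0 = t + 1 ∧ Accepted c.oracle S m ell B c.tape (b + t * (k + 1)) ∧
        ∀ t' < t, ¬ Accepted c.oracle S m ell B c.tape (b + t' * (k + 1)))
    (h : ∀ s' : Mem, (∀ a, a ≠ 1 → a ≠ 5 → a ≠ 7 → s'.nat a = s.nat a) → s'.real = s.real →
      RoundState k (m - ell) ell (b + T * (k + 1)) T B
        (round c.oracle m ell T (k + 1) B c.tape b S) s' → Post s') :
    Runs c updateProg s Post := by
  have hM := hc.one_le
  refine .seq (.setN_array (w := n) hs.hn hM hc.width_n fun s1 h1 h1' => ?_)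
  refine .seq (.setN_cell hM fun s2 h2 h2' => ?_)
  refine .setN_cell hM fun s3 h3 h3' => ?_
  refine h s3 (fun a h4 h5 h6 => ?_) (by rw [h3', h2', h1']) ?_
  · simp [h3, h2, h1, Function.update_of_ne h4, Function.update_of_ne h5,
      Function.update_of_ne h6]
  refine ⟨?_, ?_, ?_, ?_, ?_, ?_, ?_, fun i => ?_⟩
  · simp [h3, h2, h1, hs.hn]
  · simp [h3, h2, h1, hs.hk]
  · simp [h3, h2, h1, hs.hm, hs.hell]
  · simp [h3, h2, h1, hs.hell]
  · simp [h3, h2, h1, hs.hb, hs.hT, hs.hk]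
  · simp [h3, h2, h1, hs.hT]
  · simp [h3, h2, h1, hs.hB]
  · classical
    have e : s3.nat 1 i = if s.nat 18 0 ≠ 0 then
        s.nat 15 (((s.nat 18 0 - 1) * (ell + 1) + ell) * n + i) else s.nat 1 i := by
      rw [h3, Function.update_of_ne (by decide), h2, Function.update_of_ne (by decide), h1,
        Function.update_self]
      simp only [i.2, if_true, NExp.eval_ite]
      simp only [NExp.eval_load, NExp.eval_const, NExp.eval_add, NExp.eval_mul, NExp.eval_sub,
        NExp.eval_pid, hs.hell, hs.hn]
    rw [e]
    rcases hw with ⟨h0, hno⟩ | ⟨t, ht, h0, ha, hmin⟩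
    · have hex : ¬ ∃ t, t < T ∧ Accepted c.oracle S m ell B c.tape (b + t * (k + 1)) :=
        fun ⟨t, ht, ha⟩ => hno t ht ha
      rw [round, dif_neg hex, if_neg (by simpa using h0), hs.hS]
    · have hex : ∃ t, t < T ∧ Accepted c.oracle S m ell B c.tape (b + t * (k + 1)) := ⟨t, ht, ha⟩
      have hf : Nat.find hex = t := by
        rw [Nat.find_eq_iff]
        exact ⟨⟨ht, ha⟩, fun t' ht' h' => hmin t' ht' h'.2⟩
      rw [round, dif_pos hex, hf, if_pos (by omega), h0, Nat.add_sub_cancel, hP t ht ell le_rfl]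

/-- The batch size when `m` elements remain to be chosen. -/
def batch (g m : ℕ) : ℕ := if m = 0 then 0 else Nat.sqrt m / g + 1

/-- Compute the batch size. -/
def batchProg : Prog :=
  .seq (.setN 10 (.add (.cell 5) (.const 1))
    (.ite (.mul (.le (.pow (.mul (.mul (.const 2) (.mul (.cell 4) (.cell 3))) .pid) 2) (.cell 5))
      (.lt (.cell 5) (.pow (.mul (.mul (.const 2) (.mul (.cell 4) (.cell 3)))
        (.add .pid (.const 1))) 2)))
      (.const 0) (.add .pid (.const 1)))
    .pid)
  (.setN 6 (.const 1) (.const 0) (.add (.cell 10) (.const 1)))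

theorem sq_le_and_lt_sq_iff {g m f : ℕ} (hg : 0 < g) :
    (g * f) ^ 2 ≤ m ∧ m < (g * (f + 1)) ^ 2 ↔ f = Nat.sqrt m / g := by
  rw [← Nat.le_sqrt', ← Nat.sqrt_lt', mul_comm g f, ← Nat.le_div_iff_mul_le hg, mul_comm g,
    ← Nat.div_lt_iff_lt_mul hg]
  omega

theorem runs_batchProg {m q lam : ℕ} (hm : s.nat 5 0 = m) (hq : s.nat 4 0 = q)
    (hl : s.nat 3 0 = lam) (hg : 0 < 2 * (q * lam)) (hm0 : 0 < m) (hM : m + 1 ≤ c.mach)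
    (h : ∀ s' : Mem, (∀ a, a ≠ 6 → a ≠ 10 → s'.nat a = s.nat a) → s'.real = s.real →
      s'.nat 6 0 = batch (2 * (q * lam)) m → Post s') :
    Runs c batchProg s Post := by
  have hM1 : 1 ≤ c.mach := by omega
  set cnd : NExp := .mul (.le (.pow (.mul (.mul (.const 2) (.mul (.cell 4) (.cell 3))) .pid) 2)
    (.cell 5)) (.lt (.cell 5) (.pow (.mul (.mul (.const 2) (.mul (.cell 4) (.cell 3)))
        (.add .pid (.const 1))) 2)) with hcnd
  have hsel : ∀ p, cnd.eval s p ≠ 0 ↔ p = Nat.sqrt m / (2 * (q * lam)) := by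
    intro p
    rw [hcnd, NExp.eval_mul_ne_zero, NExp.eval_le_ne_zero, NExp.eval_lt_ne_zero]
    simp only [NExp.eval_pow, NExp.eval_mul, NExp.eval_load, NExp.eval_const, NExp.eval_pid,
      NExp.eval_add, hm, hq, hl]
    exact sq_le_and_lt_sq_iff hg
  have hex : Exclusive (m + 1) fun p =>
      (NExp.ite cnd (.const 0) (.add .pid (.const 1))).eval s p := by
    intro p p' _ _ heq
    simp only [NExp.eval_ite, hsel, NExp.eval_const, NExp.eval_add, NExp.eval_pid] at heq
    split_ifs at heq <;> omega
  have hlt : Nat.sqrt m / (2 * (q * lam)) < m + 1 :=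
    Nat.lt_succ_of_le ((Nat.div_le_self _ _).trans (Nat.sqrt_le_self m))
  refine .seq (.setN (w := m + 1) (by simp [hm]) hM1 hM hex fun s1 h1 h1' => ?_)
  refine .setN_cell hM1 fun s2 h2 h2' => ?_
  refine h s2 (fun a h3 h4 => ?_) (by rw [h2', h1']) ?_
  · simp [h2, h1, Function.update_of_ne h3, Function.update_of_ne h4]
  · have h5 := scatter_of_exclusive hex (s.nat 10) (fun p => NExp.pid.eval s p) hlt
    rw [NExp.eval_ite, if_pos ((hsel _).2 rfl), NExp.eval_const] at h5
    rw [h2, Function.update_self, Function.update_self, NExp.eval_add, NExp.eval_load,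
      NExp.eval_const, NExp.eval_const, h1, Function.update_self, h5, batch, if_neg hm0.ne']
    rfl

/-- One round of the algorithm. -/
def roundProg : Prog :=
  .seq batchProg (.seq marginalsProg (.seq proposeProg (.seq prefixProg (.seq ratioProg
    (.seq winnerProg updateProg)))))

theorem depth_roundProg : roundProg.depth = 1 := rfl

end Segments

section Loop

variable {n : ℕ} {c : Setting n} {s : Mem} {Post : Mem → Prop}

theorem runs_roundProg [NeZero n] {k m ell b T B q lam : ℕ} {S : Finset (Fin n)}
    (hs : RoundState k m ell b T B S s) (hq : s.nat 4 0 = q) (hl : s.nat 3 0 = lam)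
    (hg : 0 < 2 * (q * lam)) (hm0 : 0 < m) (hM : m + 1 ≤ c.mach)
    (hc : Enough c (batch (2 * (q * lam)) m) T)
    (h : ∀ s' : Mem, s'.nat 4 0 = q → s'.nat 3 0 = lam →
      RoundState k (m - batch (2 * (q * lam)) m) (batch (2 * (q * lam)) m) (b + T * (k + 1)) T B
        (round c.oracle m (batch (2 * (q * lam)) m) T (k + 1) B c.tape b S) s' → Post s') :
    Runs c roundProg s Post := by
  refine .seq (runs_batchProg hs.hm hq hl hg hm0 hM fun s1 h1 _ h1b => ?_)
  have hs1 : RoundState k m (batch (2 * (q * lam)) m) b T B S s1 :=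
    ⟨by rw [h1 0 (by decide) (by decide), hs.hn], by rw [h1 0 (by decide) (by decide), hs.hk],
      by rw [h1 5 (by decide) (by decide), hs.hm], h1b,
      by rw [h1 7 (by decide) (by decide), hs.hb], by rw [h1 8 (by decide) (by decide), hs.hT],
      by rw [h1 9 (by decide) (by decide), hs.hB],
      fun i => by rw [h1 1 (by decide) (by decide), hs.hS]⟩
  refine .seq (runs_marginalsProg hs1 hc fun s2 h2 hclip hcum => ?_)
  have hs2 := hs1.sameBelow h2 (by decide)
  refine .seq (runs_proposeProg hs2 hc hcum fun s3 h3 hX => ?_)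
  have hs3 := hs2.sameBelow h3 (by decide)
  refine .seq (runs_prefixProg hs3 hc hX fun s4 h4 hP => ?_)
  have hs4 := hs3.sameBelow h4 (by decide)
  refine .seq (runs_ratioProg hs4 hc ?_ ?_ hP fun s5 h5 hR => ?_)
  · intro i
    rw [h4.real 2 (by decide), h3.real 2 (by decide), hclip]
  · intro t ht j hj
    rw [h4.nat 13 (by decide), hX t ht j hj]
  have hs5 := hs4.sameBelow h5 (by decide)
  refine .seq (runs_winnerProg hs5 hc hR fun s6 h6 hw => ?_)
  have hs6 := hs5.sameBelow h6 (by decide)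
  refine runs_updateProg hs6 hc ?_ hw fun s7 h7 _ hs7 => ?_
  · intro t ht j hj i
    rw [h6.nat 15 (by decide), h5.nat 15 (by decide), hP t ht j hj i]
  have hkeep : ∀ a, 1 < a → a < 5 → s7.nat a = s.nat a := by
    intro a ha ha'
    rw [h7 a (by omega) (by omega) (by omega), h6.nat a (by omega), h5.nat a (by omega),
      h4.nat a (by omega), h3.nat a (by omega), h2.nat a (by omega), h1 a (by omega) (by omega)]
  exact h s7 (by rw [hkeep 4 (by decide) (by decide), hq])
    (by rw [hkeep 3 (by decide) (by decide), hl]) hs7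

theorem batch_le {g m : ℕ} (hg : 2 ≤ g) : batch g m ≤ m := by
  unfold batch
  split_ifs with h
  · omega
  · rcases Nat.lt_or_ge (Nat.sqrt m) g with h1 | h1
    · rw [Nat.div_eq_of_lt h1]
      omega
    · have h2 : Nat.sqrt m / g ≤ Nat.sqrt m / 2 := Nat.div_le_div_left hg two_pos
      have h3 := Nat.sqrt_le_self m
      omega

theorem one_add_sqrt_sub_batch_le {g m : ℕ} (hg : 2 ≤ g) (hm : 0 < m) :
    1 + 2 * g * Real.sqrt ((m - batch g m : ℕ) : ℝ) ≤ 2 * g * Real.sqrt m := by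
  have hle := batch_le (m := m) hg
  have hmR : (0 : ℝ) < m := by exact_mod_cast hm
  have hgR : (2 : ℝ) ≤ g := by exact_mod_cast hg
  set x := Real.sqrt m with hx
  set y := Real.sqrt ((m - batch g m : ℕ) : ℝ) with hy
  have hx0 : 0 < x := Real.sqrt_pos.2 hmR
  have hyx : y ≤ x := Real.sqrt_le_sqrt (by exact_mod_cast Nat.sub_le _ _)
  have hxx : x * x = m := Real.mul_self_sqrt hmR.le
  have hyy : y * y = m - batch g m := by
    rw [hy, Real.mul_self_sqrt (Nat.cast_nonneg _), Nat.cast_sub hle]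
  have hgb : x ≤ g * batch g m := by
    have h1 : Nat.sqrt m + 1 ≤ g * batch g m := by
      rw [batch, if_neg hm.ne', mul_add, mul_one]
      have h2 := Nat.div_add_mod (Nat.sqrt m) g
      have h3 := Nat.mod_lt (Nat.sqrt m) (show 0 < g by omega)
      omega
    have h2 : x ≤ Nat.sqrt m + 1 := by
      rw [hx]
      exact Real.real_sqrt_lt_nat_sqrt_succ.le
    have h3 : ((Nat.sqrt m + 1 : ℕ) : ℝ) ≤ ((g * batch g m : ℕ) : ℝ) := by exact_mod_cast h1
    push_cast at h3
    linarith
  have h4 : x ≤ g * ((x - y) * (2 * x)) := by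
    have h5 : (x - y) * (x + y) = batch g m := by
      have h5' : (x - y) * (x + y) = x * x - y * y := by ring
      rw [h5', hxx, hyy]
      ring
    rw [← h5] at hgb
    refine hgb.trans (mul_le_mul_of_nonneg_left ?_ (by linarith))
    exact mul_le_mul_of_nonneg_left (by linarith) (by linarith)
  have h6 : 1 * x ≤ (2 * g * (x - y)) * x := by linarith
  have := le_of_mul_le_mul_right h6 hx0
  linarith

/-- The main loop of the algorithm. -/
def mainLoop : Prog := .loop (.cell 5) roundProg

theorem exec_mainLoop [NeZero n] {k T B q lam : ℕ} (hg : 0 < q * lam) (hM : k + 1 ≤ c.mach)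
    (hc : ∀ m, 0 < m → m ≤ k → Enough c (batch (2 * (q * lam)) m) T) (F : ℕ) :
    ∀ (m ell b : ℕ) (S : Finset (Fin n)) (s : Mem), m ≤ F → m ≤ k →
      RoundState k m ell b T B S s → s.nat 4 0 = q → s.nat 3 0 = lam →
      ∃ s' t M r, Exec c.oracle c.tau c.kappa c.tape mainLoop s s' t M ∧
        t ≤ r * (2 + roundProg.cost c.tau c.it) + 2 ∧ M ≤ c.mach ∧
        (r : ℝ) ≤ 2 * ((2 * (q * lam) : ℕ) : ℝ) * Real.sqrt m ∧
        s'.readSet n 1 0 =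
          rounds c.oracle (batch (2 * (q * lam))) T (k + 1) B c.tape F m b S := by
  have hg2 : 2 ≤ 2 * (q * lam) := by omega
  have hdone : ∀ {m ell b : ℕ} {S : Finset (Fin n)} {s : Mem}, RoundState k m ell b T B S s →
      m = 0 → ∃ s' t M r, Exec c.oracle c.tau c.kappa c.tape mainLoop s s' t M ∧
        t ≤ r * (2 + roundProg.cost c.tau c.it) + 2 ∧ M ≤ c.mach ∧
        (r : ℝ) ≤ 2 * ((2 * (q * lam) : ℕ) : ℝ) * Real.sqrt m ∧ s'.readSet n 1 0 = S := by
    intro m ell b S s hs hm0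
    have hz : (NExp.cell 5).eval s 0 = 0 := by simp [hs.hm, hm0]
    refine ⟨s, _, _, 0, .loop_done hz, ?_, by omega, ?_, ?_⟩
    · simp [NExp.size]
    · simp [hm0]
    · ext i
      simpa [Mem.readSet] using hs.hS i
  induction F with
  | zero =>
    intro m ell b S s hF _ hs _ _
    simpa only [rounds] using hdone hs (Nat.le_zero.1 hF)
  | succ F ih =>
    intro m ell b S s hF hk hs hq hl
    by_cases hm0 : m = 0
    · simpa only [rounds, hm0, if_true] using hdone hs hm0
    have hm0' : 0 < m := Nat.pos_of_ne_zero hm0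
    have hb1 : 1 ≤ batch (2 * (q * lam)) m := by
      rw [batch, if_neg hm0]
      exact Nat.le_add_left _ _
    have hz : (NExp.cell 5).eval s 0 ≠ 0 := by simp [hs.hm, hm0]
    obtain ⟨s1, t1, M1, h1, h2, h3, hq1, hl1, hs1⟩ := runs_roundProg (c := c) (Post := fun s' =>
      s'.nat 4 0 = q ∧ s'.nat 3 0 = lam ∧
      RoundState k (m - batch (2 * (q * lam)) m) (batch (2 * (q * lam)) m) (b + T * (k + 1)) T B
        (round c.oracle m (batch (2 * (q * lam)) m) T (k + 1) B c.tape b S) s')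
      hs hq hl (by omega) hm0' (by omega) (hc m hm0' hk) fun s' h1 h2 h3 => ⟨h1, h2, h3⟩
    obtain ⟨s2, t2, M2, r, h4, h5, h6, h7, h8⟩ := ih _ _ _ _ s1
      (Nat.lt_succ_iff.1 ((Nat.sub_lt hm0' hb1).trans_le hF)) ((Nat.sub_le _ _).trans hk) hs1 hq1 hl1
    refine ⟨s2, _, _, r + 1, .loop_step hz h1 h4, ?_, max_le h3 h6, ?_, ?_⟩
    · simp only [NExp.size]
      rw [Nat.succ_mul]
      omega
    · have := one_add_sqrt_sub_batch_le hg2 hm0'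
      push_cast at this h7 ⊢
      linarith
    · rw [h8]
      simp only [rounds, hm0, if_false]

/-- Find the smallest power `2 ^ x` with `1 ≤ x` and `y ≤ (2 ^ x) ^ N * ε`; the power is stored
in the array `a` and its exponent in the array `l`. -/
def powerProg (a l N : ℕ) (y : NExp) : Prog :=
  .seq (.setN a (.const 1) (.const 0) (.const 2))
  (.seq (.setN l (.const 1) (.const 0) (.const 1))
  (.seq (.setLt 10 (.const 1) (.const 0)
    (.mul (.ofNat (.pow (.cell a) N)) (.load 0 (.const 0))) (.ofNat y))
  (.loop (.cell 10)
    (.seq (.setN a (.const 1) (.const 0) (.mul (.const 2) (.cell a)))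
    (.seq (.setN l (.const 1) (.const 0) (.add (.cell l) (.const 1)))
    (.setLt 10 (.const 1) (.const 0)
      (.mul (.ofNat (.pow (.cell a) N)) (.load 0 (.const 0))) (.ofNat y)))))))

theorem runs_powerProg {a l N x Y : ℕ} {y : NExp} {ε : ℝ} (hal : a ≠ l) (ha : a ≠ 10) (hl : l ≠ 10)
    (hε : s.real 0 0 = ε)
    (hy : ∀ s' : Mem, (∀ b, b ≠ a → b ≠ l → b ≠ 10 → s'.nat b = s.nat b) → y.eval s' 0 = Y)
    (hx1 : 1 ≤ x) (hx : (Y : ℝ) ≤ ((2 : ℝ) ^ x) ^ N * ε)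
    (hmin : ∀ i, 1 ≤ i → i < x → ((2 : ℝ) ^ i) ^ N * ε < Y) (hit : x ≤ c.it) (hM : 1 ≤ c.mach)
    (h : ∀ s' : Mem, s'.real = s.real → (∀ b, b ≠ a → b ≠ l → b ≠ 10 → s'.nat b = s.nat b) →
      s'.nat a 0 = 2 ^ x → s'.nat l 0 = x → Post s') :
    Runs c (powerProg a l N y) s Post := by
  refine .seq (.setN_cell hM fun s1 h1 h1' => ?_)
  refine .seq (.setN_cell hM fun s2 h2 h2' => ?_)
  refine .seq (.setLt_cell hM fun s3 h3 h3' => ?_)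
  have hcmp : ∀ (s' : Mem) (i : ℕ), s'.real = s.real →
      (∀ b, b ≠ a → b ≠ l → b ≠ 10 → s'.nat b = s.nat b) → s'.nat a 0 = 2 ^ i →
      ((RExp.mul (.ofNat (.pow (.cell a) N)) (.load 0 (.const 0))).eval c.tape s' 0 <
        (RExp.ofNat y).eval c.tape s' 0 ↔ ((2 : ℝ) ^ i) ^ N * ε < Y) := by
    intro s' i hr hf hi
    simp [hr, hε, hy s' hf, hi]
  refine Runs.loop (fun j s' => ∃ i, 1 ≤ i ∧ i + j = x ∧ s'.real = s.real ∧
    (∀ b, b ≠ a → b ≠ l → b ≠ 10 → s'.nat b = s.nat b) ∧ s'.nat a 0 = 2 ^ i ∧ s'.nat l 0 = i ∧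
    (s'.nat 10 0 ≠ 0 ↔ ((2 : ℝ) ^ i) ^ N * ε < Y)) ?_ ?_ hM (j := x - 1) (by omega) ?_
  · rintro j s4 ⟨i, hi, hij, hr, hf, hia, hil, hflag⟩ hne
    have hlt : i < x := by
      by_contra hge
      have : i = x := by omega
      subst this
      exact absurd (hflag.1 hne) (not_lt.2 hx)
    refine .seq (.setN_cell hM fun s5 h5 h5' => ?_)
    refine .seq (.setN_cell hM fun s6 h6 h6' => ?_)
    refine .setLt_cell hM fun s7 h7 h7' => ?_
    have hr6 : s6.real = s.real := by rw [h6', h5', hr]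
    have hf6 : ∀ b, b ≠ a → b ≠ l → b ≠ 10 → s6.nat b = s.nat b := by
      intro b hb hb' hb''
      rw [h6, Function.update_of_ne hb', h5, Function.update_of_ne hb, hf b hb hb' hb'']
    have ha6 : s6.nat a 0 = 2 ^ (i + 1) := by
      simp [h6, h5, Function.update_of_ne hal, hia, pow_succ, mul_comm]
    refine ⟨j - 1, by omega, i + 1, by omega, by omega, by rw [h7', hr6], ?_, ?_, ?_, ?_⟩
    · intro b hb hb' hb''
      rw [h7, Function.update_of_ne hb'', hf6 b hb hb' hb'']
    · rw [h7, Function.update_of_ne ha, ha6]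
    · simp [h7, Function.update_of_ne hl, h6, h5, Function.update_of_ne hal.symm, hil]
    · rw [h7, Function.update_self, Function.update_self, ← hcmp s6 (i + 1) hr6 hf6 ha6]
      split_ifs with h0
      · exact iff_of_true one_ne_zero h0
      · exact iff_of_false (by simp) h0
  · rintro j s4 ⟨i, hi, hij, hr, hf, hia, hil, hflag⟩ hz
    have hix : i = x := by
      by_contra hne
      exact (hflag.2 (hmin i hi (by omega))) hz
    subst hix
    exact h s4 hr hf hia hil
  · have hr2 : s2.real = s.real := by rw [h2', h1']
    have hf2 : ∀ b, b ≠ a → b ≠ l → b ≠ 10 → s2.nat b = s.nat b := by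
      intro b hb hb' _
      rw [h2, Function.update_of_ne hb', h1, Function.update_of_ne hb]
    have ha2 : s2.nat a 0 = 2 ^ 1 := by
      simp [h2, h1, Function.update_of_ne hal]
    refine ⟨1, le_rfl, by omega, by rw [h3', hr2], ?_, ?_, ?_, ?_⟩
    · intro b hb hb' hb''
      rw [h3, Function.update_of_ne hb'', hf2 b hb hb' hb'']
    · rw [h3, Function.update_of_ne ha, ha2]
    · simp [h3, Function.update_of_ne hl, h2]
    · rw [h3, Function.update_self, Function.update_self, ← hcmp s2 1 hr2 hf2 ha2]
      split_ifs with h0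
      · exact iff_of_true one_ne_zero h0
      · exact iff_of_false (by simp) h0

/-- Compute the parameters of the algorithm. -/
def initProg (N A : ℕ) : Prog :=
  .seq (powerProg 2 3 1 nExp)
  (.seq (powerProg 4 11 N kExp)
  (.seq (.setN 9 (.const 1) (.const 0) (.mul (.const A) (.pow (.cell 2) (7 * (N + 2)))))
  (.seq (.setN 8 (.const 1) (.const 0) (.mul (.cell 9) (.pow (.cell 2) 3)))
  (.setN 5 (.const 1) (.const 0) kExp))))

theorem depth_initProg (N A : ℕ) : (initProg N A).depth = 1 := rfl

theorem runs_initProg {k N A lam x : ℕ} {ε : ℝ} (hlam1 : 1 ≤ lam)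
    (hlam : (n : ℝ) ≤ ((2 : ℝ) ^ lam) ^ 1 * ε)
    (hlam' : ∀ i, 1 ≤ i → i < lam → ((2 : ℝ) ^ i) ^ 1 * ε < n)
    (hx1 : 1 ≤ x) (hx : (k : ℝ) ≤ ((2 : ℝ) ^ x) ^ N * ε)
    (hx' : ∀ i, 1 ≤ i → i < x → ((2 : ℝ) ^ i) ^ N * ε < k) (hit : lam ≤ c.it) (hit' : x ≤ c.it)
    (hM : 1 ≤ c.mach) (h : ∀ s' : Mem, RoundState k k 0 0
      (A * (2 ^ lam) ^ (7 * (N + 2)) * (2 ^ lam) ^ 3) (A * (2 ^ lam) ^ (7 * (N + 2)))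
      (∅ : Finset (Fin n)) s' → s'.nat 4 0 = 2 ^ x → s'.nat 3 0 = lam → Post s') :
    Runs c (initProg N A) (inputMem n k ε) Post := by
  refine .seq (runs_powerProg (x := lam) (Y := n) (ε := ε) (by decide) (by decide) (by decide)
    (by simp [inputMem]) (fun s' hs' => ?_) hlam1 hlam hlam' hit hM fun s1 h1' h1 h1a h1l => ?_)
  · simp [hs' 0 (by decide) (by decide) (by decide), inputMem]
  refine .seq (runs_powerProg (x := x) (Y := k) (ε := ε) (by decide) (by decide) (by decide)
    (by simp [h1', inputMem]) (fun s' hs' => ?_) hx1 hx hx' hit' hM fun s2 h2' h2 h2a h2l => ?_)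
  · simp [hs' 0 (by decide) (by decide) (by decide), h1 0 (by decide) (by decide) (by decide),
      inputMem]
  refine .seq (.setN_cell hM fun s3 h3 h3' => ?_)
  refine .seq (.setN_cell hM fun s4 h4 h4' => ?_)
  refine .setN_cell hM fun s5 h5 h5' => ?_
  have hin : ∀ b, b ∉ [2, 3, 4, 10, 11] → s2.nat b = (inputMem n k ε).nat b := by
    intro b hb
    simp only [List.mem_cons, not_or] at hb
    rw [h2 b (by tauto) (by tauto) (by tauto), h1 b (by tauto) (by tauto) (by tauto)]
  have h20 := hin 0 (by decide)
  have h21 := hin 1 (by decide)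
  have h26 := hin 6 (by decide)
  have h27 := hin 7 (by decide)
  have h22 : s2.nat 2 0 = 2 ^ lam := by rw [h2 2 (by decide) (by decide) (by decide), h1a]
  have h23 : s2.nat 3 0 = lam := by rw [h2 3 (by decide) (by decide) (by decide), h1l]
  refine h s5 ⟨?_, ?_, ?_, ?_, ?_, ?_, ?_, fun i => ?_⟩ ?_ ?_
  · simp [h5, h4, h3, h20, inputMem]
  · simp [h5, h4, h3, h20, inputMem]
  · simp [h5, h4, h3, h20, inputMem]
  · simp [h5, h4, h3, h26, inputMem]
  · simp [h5, h4, h3, h27, inputMem]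
  · simp [h5, h4, h3, h22]
  · simp [h5, h4, h3, h22]
  · simp [h5, h4, h3, h21, inputMem]
  · simp [h5, h4, h3, h2a]
  · simp [h5, h4, h3, h23]

theorem exists_power {N : ℕ} (hN : 1 ≤ N) {y ε : ℝ} (hε : 0 < ε) :
    ∃ x : ℕ, 1 ≤ x ∧ y ≤ ((2 : ℝ) ^ x) ^ N * ε ∧
      ∀ i, 1 ≤ i → i < x → ((2 : ℝ) ^ i) ^ N * ε < y := by
  classical
  have hex : ∃ x : ℕ, 1 ≤ x ∧ y ≤ ((2 : ℝ) ^ x) ^ N * ε := by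
    obtain ⟨x, hx⟩ := pow_unbounded_of_one_lt (y / ε) (one_lt_two (α := ℝ))
    refine ⟨x + 1, by omega, ?_⟩
    rw [← div_le_iff₀ hε]
    calc y / ε ≤ 2 ^ x := hx.le
      _ ≤ 2 ^ (x + 1) := pow_le_pow_right₀ one_le_two (Nat.le_succ _)
      _ ≤ (2 ^ (x + 1)) ^ N := le_self_pow₀ (one_le_pow₀ one_le_two) (by omega)
  exact ⟨Nat.find hex, (Nat.find_spec hex).1, (Nat.find_spec hex).2, fun i hi hix =>
    not_le.1 fun h => Nat.find_min hex hix ⟨hi, h⟩⟩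

/-- The program of the theorem. -/
def samplingProg (N A : ℕ) : Prog := .seq (initProg N A) mainLoop

theorem exists_time_le (N A : ℕ) : ∃ C : ℕ, ∀ tau it r t : ℕ,
    t ≤ (initProg N A).cost tau it + (r * (2 + roundProg.cost tau it) + 2) →
      t ≤ C * (1 + tau) * (1 + it) * (1 + r) := by
  obtain ⟨C, hC⟩ := (initProg N A).exists_cost_le
  obtain ⟨C', hC'⟩ := roundProg.exists_cost_le
  refine ⟨C + C' + 4, fun tau it r t ht => ht.trans ?_⟩
  have h1 := hC tau it
  have h2 := hC' tau it
  rw [depth_initProg, pow_one] at h1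
  rw [depth_roundProg, pow_one] at h2
  set X := (1 + tau) * (1 + it) with hX
  have hX1 : 1 ≤ X := Nat.one_le_iff_ne_zero.2 (by positivity)
  rw [mul_assoc] at h1 h2
  rw [mul_assoc (C + C' + 4)]
  calc _ ≤ C * X + (r * (2 + C' * X) + 2) := by gcongr
    _ ≤ C * X + (r * (2 * X + C' * X) + 2 * X) := by
      gcongr <;> omega
    _ ≤ (C + C' + 4) * X * (1 + r) := by
      have : (C + C' + 4) * X * (1 + r) = C * X + (r * (2 * X + C' * X) + 2 * X) +
        (C * X * r + C' * X + 2 * X + 2 * X * r) := by ring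
      omega

end Loop

section Algorithm

variable {n : ℕ}

theorem batch_pos {g m : ℕ} (hm : 0 < m) : 1 ≤ batch g m := by
  rw [batch, if_neg hm.ne']
  exact Nat.le_add_left _ _

theorem IsWeight.le {k : ℕ} {μ : Finset (Fin n) → ℝ} (hμ : IsWeight n k μ) : k ≤ n := by
  by_contra h
  refine hμ.pos.ne' (Finset.sum_eq_zero fun S _ => hμ.supp S fun hS => h ?_)
  simpa [hS] using S.card_le_univ

theorem exec_samplingProg [NeZero n] {k N A lam x : ℕ} {ε : ℝ} (hk : 1 ≤ k) (hkn : k ≤ n)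
    (hA : 1 ≤ A) (hlam1 : 1 ≤ lam) (hlam : (n : ℝ) ≤ ((2 : ℝ) ^ lam) ^ 1 * ε)
    (hlam' : ∀ i, 1 ≤ i → i < lam → ((2 : ℝ) ^ i) ^ 1 * ε < n) (hx1 : 1 ≤ x)
    (hx : (k : ℝ) ≤ ((2 : ℝ) ^ x) ^ N * ε)
    (hx' : ∀ i, 1 ≤ i → i < x → ((2 : ℝ) ^ i) ^ N * ε < k) (hnw : n ≤ 2 ^ lam) (hxlam : x ≤ lam)
    (O : Finset (Fin n) → Fin n → ℝ) (τ κ : ℕ) (ω : Tape) :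
    ∃ s t M r, Exec O τ κ ω (samplingProg N A) (inputMem n k ε) s t M ∧
      t ≤ (initProg N A).cost τ (A + (7 * (N + 2) + 3) * lam) +
        (r * (2 + roundProg.cost τ (A + (7 * (N + 2) + 3) * lam)) + 2) ∧
      M ≤ A * (2 ^ lam) ^ (7 * (N + 2)) * (2 ^ lam) ^ 3 * (k + 1) * n * max 1 κ ∧
      (r : ℝ) ≤ 2 * ((2 * (2 ^ x * lam) : ℕ) : ℝ) * Real.sqrt k ∧
      s.readSet n 1 0 = rounds O (batch (2 * (2 ^ x * lam)))
        (A * (2 ^ lam) ^ (7 * (N + 2)) * (2 ^ lam) ^ 3) (k + 1)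
        ((A * (2 ^ lam) ^ (7 * (N + 2)) : ℕ) : ℝ) ω k k 0 ∅ := by
  set T := A * (2 ^ lam) ^ (7 * (N + 2)) * (2 ^ lam) ^ 3 with hT
  set it := A + (7 * (N + 2) + 3) * lam with hit
  have hT1 : 0 < T := by positivity
  have hg : 0 < 2 ^ x * lam := by positivity
  have hn : 0 < n := NeZero.pos n
  have hlit : lam + 1 ≤ it := by
    have : 1 * lam ≤ (7 * (N + 2) + 3) * lam := Nat.mul_le_mul_right _ (by omega)
    omega
  have hTit : T ≤ 2 ^ it := by
    rw [hT, hit, mul_assoc, ← pow_add, ← pow_mul, pow_add, mul_comm lam]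
    exact Nat.mul_le_mul_right _ Nat.lt_two_pow_self.le
  have h2it : 2 ^ lam + 2 ^ lam ≤ 2 ^ it := by
    calc 2 ^ lam + 2 ^ lam = 2 ^ (lam + 1) := by ring
      _ ≤ 2 ^ it := Nat.pow_le_pow_right two_pos hlit
  have h1w : 1 ≤ 2 ^ lam := Nat.one_le_two_pow
  let c : Setting n := ⟨O, τ, κ, ω, it, T * (k + 1) * n * max 1 κ⟩
  have hmach : k + 1 ≤ c.mach :=
    calc k + 1 ≤ T * (k + 1) := Nat.le_mul_of_pos_left _ hT1
      _ ≤ T * (k + 1) * n := Nat.le_mul_of_pos_right _ hn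
      _ ≤ T * (k + 1) * n * max 1 κ := Nat.le_mul_of_pos_right _ (by simp)
  have hc : ∀ m, 0 < m → m ≤ k → Enough c (batch (2 * (2 ^ x * lam)) m) T := by
    intro m hm hmk
    have hbm : batch (2 * (2 ^ x * lam)) m ≤ m := batch_le (by omega)
    refine ⟨hn, batch_pos hm, hT1, ?_, ?_, ?_, hTit⟩
    · refine Nat.mul_le_mul_right _ (Nat.mul_le_mul_right _ (Nat.mul_le_mul_left _ ?_))
      omega
    · change n ≤ 2 ^ it
      omega
    · change _ ≤ 2 ^ it
      omega
  obtain ⟨s1, t1, M1, h1, h2, h3, hs1, hq1, hl1⟩ := runs_initProg (n := n) (c := c) (k := k) (N := N)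
    (A := A) (Post := fun s' => RoundState k k 0 0 T (A * (2 ^ lam) ^ (7 * (N + 2)))
      (∅ : Finset (Fin n)) s' ∧ s'.nat 4 0 = 2 ^ x ∧ s'.nat 3 0 = lam) hlam1 hlam hlam' hx1 hx hx'
    (show lam ≤ it by omega) (show x ≤ it by omega) (by omega) fun s' h h' h'' => ⟨h, h', h''⟩
  obtain ⟨s2, t2, M2, r, h4, h5, h6, h7, h8⟩ :=
    exec_mainLoop (c := c) hg hmach hc k k 0 0 ∅ s1 le_rfl le_rfl hs1 hq1 hl1
  exact ⟨s2, _, _, r, .seq h1 h4, Nat.add_le_add h2 h5, max_le h3 h6, h7, h8⟩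

theorem two_pow_le_rpow {N x : ℕ} {y ε p : ℝ} (hN : 1 ≤ N) (hε : 0 < ε) (hy : ε ≤ y) (hx1 : 1 ≤ x)
    (hx : ∀ i, 1 ≤ i → i < x → ((2 : ℝ) ^ i) ^ N * ε < y) (hp : 1 / (N : ℝ) ≤ p) :
    (2 : ℝ) ^ x ≤ 2 * (y / ε) ^ p := by
  have h1 : 1 ≤ y / ε := (one_le_div hε).2 hy
  have hp0 : 0 ≤ p := le_trans (by positivity) hp
  obtain ⟨z, rfl⟩ : ∃ z, x = z + 1 := ⟨x - 1, by omega⟩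
  rw [pow_succ, mul_comm]
  refine mul_le_mul_of_nonneg_left ?_ zero_le_two
  rcases Nat.eq_zero_or_pos z with rfl | hz
  · simpa using Real.one_le_rpow h1 hp0
  calc (2 : ℝ) ^ z = (((2 : ℝ) ^ z) ^ N) ^ (1 / (N : ℝ)) := by
        rw [one_div, Real.pow_rpow_inv_natCast (by positivity) (by omega)]
    _ ≤ (y / ε) ^ (1 / (N : ℝ)) :=
        Real.rpow_le_rpow (by positivity) ((lt_div_iff₀ hε).2 (hx z hz (Nat.lt_succ_self z))).le
          (by positivity)
    _ ≤ (y / ε) ^ p := Real.rpow_le_rpow_of_exponent_le h1 hp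

theorem tvDist_output_le [NeZero n] {k N A lam x : ℕ} {α ε : ℝ} {μ : Finset (Fin n) → ℝ}
    {O : Finset (Fin n) → Fin n → ℝ} (hμ : IsWeight n k μ) (hO : IsMarginalOracle μ O)
    (hα : 0 < α) (hα1 : α ≤ 1) (hE : AllCondEntropicallyIndependent α k μ) (hk : 1 ≤ k)
    (hε : 0 < ε) (hε1 : ε < 1) (hA : Real.exp (4 / α) ≤ A) (hlam1 : 1 ≤ lam)
    (hlam : (n : ℝ) ≤ ((2 : ℝ) ^ lam) ^ 1 * ε) (hx1 : 1 ≤ x)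
    (hx : (k : ℝ) ≤ ((2 : ℝ) ^ x) ^ N * ε) (hxlam : x ≤ lam) :
    tvDist (fun S => tapeLaw.real ((fun ω => rounds O (batch (2 * (2 ^ x * lam)))
      (A * (2 ^ lam) ^ (7 * (N + 2)) * (2 ^ lam) ^ 3) (k + 1)
      ((A * (2 ^ lam) ^ (7 * (N + 2)) : ℕ) : ℝ) ω k k 0 ∅) ⁻¹' {S})) (condDist μ ∅) ≤ ε := by
  have hA1 : 1 ≤ A := by
    have : (0 : ℝ) < A := (Real.exp_pos _).trans_le hA
    exact_mod_cast this
  have hg : 0 < 2 ^ x * lam := by positivity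
  have h2q : 2 ≤ 2 ^ x := by
    calc 2 = 2 ^ 1 := rfl
      _ ≤ 2 ^ x := Nat.pow_le_pow_right two_pos hx1
  have hkR : (0 : ℝ) < k := by exact_mod_cast hk
  have := tvDist_rounds_le (B := ((A * (2 ^ lam) ^ (7 * (N + 2)) : ℕ) : ℝ))
    (T := A * (2 ^ lam) ^ (7 * (N + 2)) * (2 ^ lam) ^ 3) (δ := ε / k) hμ hO
    (by exact_mod_cast Nat.one_le_iff_ne_zero.2 (by positivity))
    (fun m => batch_le (g := 2 * (2 ^ x * lam)) (by omega)) (fun m => batch_pos)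
    (Nat.lt_succ_self k) (fun S m hm hm0 hS => ?_) 0
  · rwa [mul_div_cancel₀ _ hkR.ne'] at this
  · rw [batch, if_neg hm0.ne']
    refine sum_seqProb_sub_addProb_le hμ hα hα1 hE hk hε hε1 rfl hlam1 h2q
      (Nat.pow_le_pow_right two_pos hxlam) (by simpa using hx) (by simpa using hlam) hA ?_ hm hm0 hS
    calc (2 * (2 ^ x * lam) * (Nat.sqrt m / (2 * (2 ^ x * lam)))) ^ 2 ≤ Nat.sqrt m ^ 2 :=
          Nat.pow_le_pow_left (Nat.mul_div_le _ _) 2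
      _ ≤ m := Nat.sqrt_le' m

theorem time_bound {a d e A lam k x r τ t C₀ : ℕ} {X Z : ℝ} (hk : 1 ≤ k) (hX1 : 1 ≤ X)
    (hZ1 : 1 ≤ Z) (hlam : (lam : ℝ) ≤ 2 * X)
    (hx : (2 : ℝ) ^ x ≤ 2 * Z) (hτ : (τ : ℝ) ≤ a * X ^ d)
    (hr : (r : ℝ) ≤ 2 * ((2 * (2 ^ x * lam) : ℕ) : ℝ) * Real.sqrt k)
    (ht : t ≤ C₀ * (1 + τ) * (1 + (A + e * lam)) * (1 + r)) :
    (t : ℝ) ≤ (C₀ * (1 + a) * (1 + A + 2 * e) * 17) * (Real.sqrt k * Z * X ^ (d + 2)) := by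
  have hs1 : 1 ≤ Real.sqrt k := Real.one_le_sqrt.2 (by exact_mod_cast hk)
  have hτ' : 1 + (τ : ℝ) ≤ (1 + a) * X ^ d := by
    have := one_le_pow₀ hX1 (n := d)
    linarith
  have hit : 1 + ((A : ℝ) + e * lam) ≤ (1 + A + 2 * e) * X := by
    have h1 : (e : ℝ) * lam ≤ e * (2 * X) := mul_le_mul_of_nonneg_left hlam (Nat.cast_nonneg _)
    have h2 : (1 + (A : ℝ)) * 1 ≤ (1 + A) * X := mul_le_mul_of_nonneg_left hX1 (by positivity)
    linarith
  have hr' : 1 + (r : ℝ) ≤ 17 * (X * Z * Real.sqrt k) := by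
    have h1 : (1 : ℝ) ≤ X * Z * Real.sqrt k :=
      one_le_mul_of_one_le_of_one_le (one_le_mul_of_one_le_of_one_le hX1 hZ1) hs1
    have h2 : (2 : ℝ) ^ x * lam ≤ 2 * Z * (2 * X) :=
      mul_le_mul hx hlam (Nat.cast_nonneg _) (by linarith)
    have h3 := mul_le_mul_of_nonneg_right h2 (Real.sqrt_nonneg k)
    push_cast at hr
    linarith
  have ht' : (t : ℝ) ≤ C₀ * (1 + τ) * (1 + (A + e * lam)) * (1 + r) := by exact_mod_cast ht
  have hX0 : 0 ≤ X := by linarith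
  have hZ0 : 0 ≤ Z := by linarith
  calc (t : ℝ) ≤ C₀ * (1 + τ) * (1 + (A + e * lam)) * (1 + r) := ht'
    _ ≤ C₀ * ((1 + a) * X ^ d) * ((1 + A + 2 * e) * X) * (17 * (X * Z * Real.sqrt k)) := by
        gcongr
    _ = _ := by ring

theorem machines_bound {a d e A lam k n κ M : ℕ} {Y p : ℝ} (hk : k ≤ n) (hn : 1 ≤ n)
    (hY1 : 1 ≤ Y) (hnY : (n : ℝ) ≤ Y) (hlam : (2 : ℝ) ^ lam ≤ 2 * Y) (hκ : (κ : ℝ) ≤ a * Y ^ d)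
    (hp : ((e + 2 + d : ℕ) : ℝ) ≤ p)
    (hM : M ≤ A * (2 ^ lam) ^ e * (k + 1) * n * max 1 κ) :
    (M : ℝ) ≤ (A * 2 ^ (e + 1) * (1 + a)) * Y ^ p := by
  have hM' : (M : ℝ) ≤ A * (2 ^ lam) ^ e * (k + 1) * n * max 1 (κ : ℝ) := by
    exact_mod_cast hM
  have hκ' : max 1 (κ : ℝ) ≤ (1 + a) * Y ^ d := by
    have h1 := one_le_pow₀ hY1 (n := d)
    have h2 : 0 ≤ (a : ℝ) * Y ^ d := by positivity
    exact max_le (by linarith) (by linarith)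
  have hk' : (k : ℝ) + 1 ≤ 2 * Y := by
    have : ((k + 1 : ℕ) : ℝ) ≤ ((n + n : ℕ) : ℝ) := by exact_mod_cast Nat.add_le_add hk hn
    push_cast at this
    linarith
  have hY0 : 0 ≤ Y := by linarith
  calc (M : ℝ) ≤ A * (2 ^ lam) ^ e * (k + 1) * n * max 1 (κ : ℝ) := hM'
    _ ≤ A * (2 * Y) ^ e * (2 * Y) * Y * ((1 + a) * Y ^ d) := by gcongr
    _ = (A * 2 ^ (e + 1) * (1 + a)) * Y ^ (e + 2 + d) := by ring
    _ = (A * 2 ^ (e + 1) * (1 + a)) * Y ^ ((e + 2 + d : ℕ) : ℝ) := by rw [Real.rpow_natCast]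
    _ ≤ _ := by
        refine mul_le_mul_of_nonneg_left ?_ (by positivity)
        exact Real.rpow_le_rpow_of_exponent_le hY1 hp

theorem natCast_le_of_two_pow_le {lam : ℕ} {Y : ℝ} (hY1 : 1 ≤ Y) (h : (2 : ℝ) ^ lam ≤ 2 * Y) :
    (lam : ℝ) ≤ 2 * (1 + Real.log Y) := by
  have h1 := Real.log_le_log (by positivity) h
  rw [Real.log_pow, Real.log_mul two_ne_zero (by linarith)] at h1
  have h2 := Real.log_two_gt_d9
  have h3 := Real.log_nonneg hY1
  by_contra! h4
  nlinarith [Real.log_two_lt_d9]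

end Algorithm

end ParSampling

theorem theorem5p1 :
    ∀ a d : ℕ, ∃ (K : ℝ) (D : ℕ), ∀ α c : ℝ, 0 < α → α ≤ 1 → 0 < c →
      ∃ (P : Prog) (C : ℝ), ∀ (n k : ℕ) (ε : ℝ) (μ : Finset (Fin n) → ℝ)
        (O : Finset (Fin n) → Fin n → ℝ) (τ κ : ℕ),
        1 ≤ k → 0 < ε → ε < 1 → IsWeight n k μ →
        AllCondEntropicallyIndependent α k μ →
        IsMarginalOracle μ O →
        (τ : ℝ) ≤ a * (1 + Real.log (n / ε)) ^ d →
        (κ : ℝ) ≤ a * (n / ε) ^ d →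
        SamplesWithin O τ κ P k ε
          (C * (Real.sqrt k * (k / ε) ^ c * (1 + Real.log (n / ε)) ^ D))
          (C * (n / ε) ^ (K / min c 1))
          (condDist μ ∅) ε := by
  intro a d
  refine ⟨33 + d, d + 2, fun α c hα hα1 hc => ?_⟩
  have hc0 : 0 < min c 1 := lt_min hc one_pos
  have hc1 : min c 1 ≤ 1 := min_le_right _ _
  have hc1' : 1 ≤ 1 / min c 1 := (one_le_div hc0).2 hc1
  set N := ⌈1 / min c 1⌉₊ with hNdef
  have hN : 1 ≤ N := Nat.one_le_iff_ne_zero.2 (Nat.ceil_pos.2 (by linarith)).ne'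
  have hNle : (N : ℝ) ≤ 2 / min c 1 := by
    have h1 := (Nat.ceil_lt_add_one (by linarith : 0 ≤ 1 / min c 1)).le
    calc (N : ℝ) ≤ 1 / min c 1 + 1 / min c 1 := by linarith
      _ = 2 / min c 1 := by ring
  have hNc : 1 / (N : ℝ) ≤ c := by
    refine le_trans ?_ (min_le_left c 1)
    rw [one_div_le (by exact_mod_cast hN) hc0]
    exact Nat.le_ceil _
  set A := ⌈Real.exp (4 / α)⌉₊ with hAdef
  have hA : Real.exp (4 / α) ≤ A := Nat.le_ceil _
  have hA1 : 1 ≤ A := Nat.one_le_iff_ne_zero.2 (Nat.ceil_pos.2 (Real.exp_pos _)).ne'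
  obtain ⟨C₀, hC₀⟩ := exists_time_le N A
  set e := 7 * (N + 2) + 3 with he
  have hp : ((e + 2 + d : ℕ) : ℝ) ≤ (33 + d) / min c 1 := by
    have h1 : (19 + d : ℝ) * 1 ≤ (19 + d) * (1 / min c 1) :=
      mul_le_mul_of_nonneg_left hc1' (by positivity)
    rw [he]
    push_cast
    calc (7 * ((N : ℝ) + 2) + 3 + 2 + d) = 7 * N + (19 + d) * 1 := by ring
      _ ≤ 7 * (2 / min c 1) + (19 + d) * (1 / min c 1) := by linarith
      _ = (33 + d) / min c 1 := by ring
  set C₁ : ℝ := C₀ * (1 + a) * (1 + A + 2 * e) * 17 with hC₁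
  set C₂ : ℝ := A * 2 ^ (e + 1) * (1 + a) with hC₂
  refine ⟨samplingProg N A, max C₁ C₂, fun n k ε μ O τ κ hk hε hε1 hμ hE hO hτ hκ => ?_⟩
  have hkn : k ≤ n := hμ.le
  have hn1 : 1 ≤ n := hk.trans hkn
  have : NeZero n := ⟨by omega⟩
  have hkR : (1 : ℝ) ≤ k := by exact_mod_cast hk
  have hnR : (1 : ℝ) ≤ n := by exact_mod_cast hn1
  obtain ⟨lam, hlam1, hlam, hlam'⟩ := exists_power (le_refl 1) (y := n) hε
  obtain ⟨x, hx1, hx, hx'⟩ := exists_power hN (y := k) hε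
  have hnY : (n : ℝ) ≤ n / ε := le_div_self (by linarith) hε hε1.le
  have hY1 : 1 ≤ (n : ℝ) / ε := hnR.trans hnY
  have hnw : n ≤ 2 ^ lam := by
    have : (n : ℝ) ≤ 2 ^ lam := by
      rw [pow_one] at hlam
      exact hlam.trans (mul_le_of_le_one_right (by positivity) hε1.le)
    exact_mod_cast this
  have hxlam : x ≤ lam := by
    by_contra! h
    refine absurd (hx' lam hlam1 h) (not_lt.2 ?_)
    calc (k : ℝ) ≤ n := by exact_mod_cast hkn
      _ ≤ ((2 : ℝ) ^ lam) ^ 1 * ε := hlam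
      _ ≤ ((2 : ℝ) ^ lam) ^ N * ε := mul_le_mul_of_nonneg_right
          (pow_le_pow_right₀ (one_le_pow₀ one_le_two) hN) hε.le
  have hw : (2 : ℝ) ^ lam ≤ 2 * (n / ε) := by
    simpa using two_pow_le_rpow le_rfl hε (by linarith : ε ≤ n) hlam1 hlam' (p := 1) (by simp)
  have hq : (2 : ℝ) ^ x ≤ 2 * ((k : ℝ) / ε) ^ c :=
    two_pow_le_rpow hN hε (by linarith) hx1 hx' hNc
  have hZ1 : 1 ≤ ((k : ℝ) / ε) ^ c :=
    Real.one_le_rpow ((one_le_div hε).2 (by linarith)) hc.le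
  have hX1 : 1 ≤ 1 + Real.log ((n : ℝ) / ε) := by
    have := Real.log_nonneg hY1
    linarith
  refine ⟨fun ω => rounds O (batch (2 * (2 ^ x * lam)))
    (A * (2 ^ lam) ^ (7 * (N + 2)) * (2 ^ lam) ^ 3) (k + 1)
    ((A * (2 ^ lam) ^ (7 * (N + 2)) : ℕ) : ℝ) ω k k 0 ∅, fun ω => ?_, fun S => ?_,
    tvDist_output_le hμ hO hα hα1 hE hk hε hε1 hA hlam1 hlam hx1 hx hxlam⟩
  · obtain ⟨s, t, M, r, h1, h2, h3, h4, h5⟩ := exec_samplingProg hk hkn hA1 hlam1 hlam hlam' hx1 hx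
      hx' hnw hxlam O τ κ ω
    refine ⟨s, t, M, h1, ?_, ?_, h5⟩
    · refine (time_bound hk hX1 hZ1 (natCast_le_of_two_pow_le hY1 hw) hq hτ h4
        (hC₀ τ _ r t h2)).trans (mul_le_mul_of_nonneg_right (le_max_left _ _) (by positivity))
    · refine (machines_bound (e := e) hkn hn1 hY1 hnY hw hκ hp ?_).trans
        (mul_le_mul_of_nonneg_right (le_max_right _ _) (by positivity))
      rwa [he, pow_add, ← mul_assoc]
  · have hg : 0 < 2 ^ x * lam := by positivity
    exact cellSigma_le _ _ (measurableSet_rounds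
      (fun m => batch_le (g := 2 * (2 ^ x * lam)) (by omega)) k (Nat.lt_succ_self k) 0 ∅ S)
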